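/- A \emph{primed number} is a symbol $i$ or $i'$ with $i$ a positive integer; write $\lceil i\rceil=\lceil i'\rceil=i$. A \emph{hook word} is a word $w_1w_2\cdots w_n$ of positive integers with $w_1\ge\dots\ge w_m<w_{m+1}<\dots<w_n$ for some $1\le m\le n$; $w_1\cdots w_m$ is its decreasing part, $w_{m+1}\cdots w_n$ its increasing part, and $w_m$ its middle element. For a strict partition $\lambda=(\lambda_1>\dots>\lambda_\ell>0)$, a \emph{decomposition tableau} of shape $\lambda$ is a filling $T$ of the shifted diagram of $\lambda$ by positive integers such that each row $\rho_i$ is a hook word and, for $1\le i<\ell$, $\rho_i$ is a hook subword (subsequence) of maximal length in $\rho_{i+1}\rho_i$. A \emph{primed decomposition tableau} is obtained from a decomposition tableau by adding primes to the middle elements of any subset of its rows. Let $\mathsf{DecTab}$ and $\mathsf{DecTab}^+$ be the sets of all decomposition tableaux, respectively primed decomposition tableaux, of all strict partition shapes (including the empty one). Let $\mathsf{revrow}(T)$ be the reversal of the word $\rho_\ell\cdots\rho_2\rho_1$. \emph{Decomposition insertion} of a primed number $x$ into a primed decomposition tableau $T$ inserts a primed number $a_i$ into row $i$ for $i=1,2,\dots$,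 starting with $a_1=x$, as follows. Let $a=\lceil a_i\rceil$, let $m_i$ be the (possibly primed) middle element of row $i$ if the row is nonempty, and remove its prime, if any. If adding $a$ to the end of the row gives a hook word, do so. Otherwise $a$ replaces the leftmost entry $b\ge a$ of the increasing part, and then $b$ replaces the leftmost entry $c<b$ of the decreasing part. (1) If the row was empty or the location of its middle element has changed, then the new middle element gets a prime if and only if $a_i$ is primed; the procedure halts if a box was added to the row, and otherwise $a_{i+1}$ is $c$ or $c'$ according to whether $m_i$ was unprimed or primed. (2) If the location of the middle element has not changed, then the middle element gets a prime if and only if $m_i$ was primed; the procedure halts if a box was added to the row, and otherwise $a_{i+1}$ is $c$ or $c'$ according to whether $a_i$ is unprimed or primed. For a word $w$ of primed numbers, $P_{\mathsf{dec}}(w)$ is the tableau obtained by inserting the letters of $w$, read from right to left, into the empty tableau. \textbf{Corollary.} Each of the sets $\mathsf{DecTab}$ and $\mathsf{DecTab}^+$ is a monoid (in particular is closed) under the product \[T * U := P_{\mathsf{dec}}(\mathsf{revrow}(T)\,\mathsf{revrow}(U)),\] where words are multiplied by concatenation, and the empty tableau is the unit element. -/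

import Mathlib

namespace DecompTab

/-- A primed number: the positive integer `val` (if `primed = false`) or `val'` (if `primed = true`).
The ceiling of `x` is `x.val`. -/
@[ext]
structure Letter where
  val : ℕ+
  primed : Bool
  deriving DecidableEq

/-- A primed word: a finite sequence of primed numbers. -/
abbrev Word := List Letter

/-- A tableau given by its list of rows: the `i`-th list is row `i`, read from left to right,
starting with the first row (the bottom one in French notation). As a shifted tableau, row `i`
(counted from `1`) occupies the boxes in columns `i, i + 1, …` of row `i`. -/
abbrev Tableau := List (List Letter)

/-- The row lengths of a tableau. -/
def shape (T : Tableau) : List ℕ := T.map List.length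

/-- `l` is a strict partition, given by the list of its (nonzero) parts. -/
def IsStrictPartition (l : List ℕ) : Prop := l.Pairwise (· > ·) ∧ ∀ k ∈ l, 0 < k

/-- Hook words: `w₁ ≥ w₂ ≥ ⋯ ≥ wₘ < wₘ₊₁ < ⋯ < wₙ` for some `1 ≤ m ≤ n`
(here `m = k + 1`). In particular a hook word is nonempty. -/
def IsHook (w : List ℕ+) : Prop :=
  ∃ k < w.length, (w.take (k + 1)).Pairwise (· ≥ ·) ∧ (w.drop k).Pairwise (· < ·)

instance (w : List ℕ+) : Decidable (IsHook w) := by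
  unfold IsHook; infer_instance

/-- The longest weakly decreasing prefix of a word. If the word is a hook word, this is its
decreasing part `w₁ ⋯ wₘ`. -/
def decPart : List ℕ+ → List ℕ+
  | [] => []
  | [a] => [a]
  | a :: b :: l => if b ≤ a then a :: decPart (b :: l) else [a]

/-- What remains of a word after the longest weakly decreasing prefix: the increasing part
`wₘ₊₁ ⋯ wₙ` of a hook word. -/
def incPart (w : List ℕ+) : List ℕ+ := w.drop (decPart w).length

/-- The (unprimed) word obtained from a primed word by forgetting the primes. -/
def vals (w : Word) : List ℕ+ := w.map Letter.val

/-- Removing all primes from a tableau. -/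
def unprime (T : Tableau) : Tableau := T.map fun r => r.map fun x => ⟨x.val, false⟩

/-- Semistandard decomposition tableaux (with unprimed entries): the shape is a strict partition,
each row is a hook word, and row `i` is a hook subword of maximal length in the concatenation of
row `i + 1` followed by row `i`. -/
structure IsDecTab (T : Tableau) : Prop where
  unprimed : ∀ r ∈ T, ∀ x ∈ r, x.primed = false
  strict : IsStrictPartition (shape T)
  hook : ∀ r ∈ T, IsHook (vals r)
  maximal : T.IsChain fun r s =>
    ∀ v : List ℕ+, v.Sublist (vals s ++ vals r) → IsHook v → v.length ≤ r.length

/-- Primed decomposition tableaux: removing the primes gives a decomposition tableau, and in each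
row only the middle element (the last letter of the decreasing part) may be primed. -/
structure IsPrimedDecTab (T : Tableau) : Prop where
  isDecTab_unprime : IsDecTab (unprime T)
  middle : ∀ r ∈ T, ∀ (j : ℕ) (hj : j < r.length),
    r[j].primed = true → j + 1 = (decPart (vals r)).length

/-- The set of all decomposition tableaux, of all strict partition shapes. -/
def DecTab : Type := {T : Tableau // IsDecTab T}

/-- The set of all primed decomposition tableaux, of all strict partition shapes. -/
def DecTabPlus : Type := {T : Tableau // IsPrimedDecTab T}

/-- The row reading word: the rows are read from left to right, starting with the last row. -/
def row (T : Tableau) : Word := T.reverse.flatten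

/-- The reverse row reading word. -/
def revrow (T : Tableau) : Word := (row T).reverse

/-- Replace the leftmost entry of a word that satisfies `p` by `y`; returns the replaced entry and
the new word, or `none` if no entry satisfies `p`. -/
def replaceFirst (p : ℕ+ → Bool) (y : ℕ+) : List ℕ+ → Option (ℕ+ × List ℕ+)
  | [] => none
  | x :: l => if p x then some (x, y :: l) else (replaceFirst p y l).map fun q => (q.1, x :: q.2)

/-- Insertion of the unprimed number `a` into an unprimed row `w` that is empty or a hook word.
If adding `a` to the end of `w` creates a hook word, then this is done and nothing is bumped.
Otherwise `a` replaces the leftmost entry `b ≥ a` of the increasing part, then `b` replaces the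
leftmost entry `c < b` of the decreasing part, and `c` is bumped. (If `w` is a hook word, then
these entries always exist; the two fallback values are never used.) -/
def insertUnprimed (a : ℕ+) (w : List ℕ+) : List ℕ+ × Option ℕ+ :=
  if IsHook (w ++ [a]) then (w ++ [a], none)
  else
    match replaceFirst (fun b => decide (a ≤ b)) a (incPart w) with
    | none => (w, none)
    | some (b, u) =>
      match replaceFirst (fun c => decide (c < b)) b (decPart w) with
      | none => (w, none)
      | some (c, d) => (d ++ u, some c)

/-- Whether the middle element of a row is primed (`false` for the empty row). -/
def middlePrimed (r : List Letter) : Bool :=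
  match r[(decPart (vals r)).length - 1]? with
  | none => false
  | some x => x.primed

/-- The row with entries `w` whose middle element is primed if `p = true`, and whose other entries
are unprimed. -/
def primeMiddle (p : Bool) (w : List ℕ+) : List Letter :=
  w.mapIdx fun j a => ⟨a, p && decide (j + 1 = (decPart w).length)⟩

/-- Insertion of the primed number `x` into one row `r` of a primed decomposition tableau.
Returns the new row and the primed number to be inserted in the next row, if any.
If the row was empty or the location of the middle element has changed, then the new middle
element receives the prime of `x` and the bumped number receives the prime of the old middle
element. Otherwise the middle element keeps its prime and the bumped number receives the prime
of `x`. -/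
def insertRow (x : Letter) (r : List Letter) : List Letter × Option Letter :=
  let q := insertUnprimed x.val (vals r)
  if (decPart q.1).length ≠ (decPart (vals r)).length then
    (primeMiddle x.primed q.1, q.2.map fun c => ⟨c, middlePrimed r⟩)
  else
    (primeMiddle (middlePrimed r) q.1, q.2.map fun c => ⟨c, x.primed⟩)

/-- Decomposition insertion of the primed number `x` into the tableau `T`. -/
def insert (x : Letter) : Tableau → Tableau
  | [] => [[x]]
  | r :: T =>
    match insertRow x r with
    | (r', none) => r' :: T
    | (r', some y) => r' :: insert y T

/-- The decomposition insertion tableau of a primed word: its letters are inserted from right to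
left, starting with the empty tableau. -/
def Pdec (w : Word) : Tableau := w.foldr insert []

end DecompTab

/-! The product is concatenation of words, transported to tableaux. Call two words equivalent
(`Eqv`) if inserting their letters has the same effect on every list of rows satisfying `GoodRow`;
this is a congruence because insertion can be continued. Reading from right to left undoes the
reversal in `revrow`, so products are computed from row reading words. Three facts suffice: (a)
every word is equivalent to the row reading word of its insertion tableau (`eqv_row_act_nil`); (b) a
tableau is the insertion tableau of its row reading word (`GoodTableau.act_row`); (c) insertion
always produces a primed decomposition tableau (`goodTableau_act`). Then (a) gives associativity,
(b) the unit laws, (c) closure. Unprimed letters never create primes, which gives the unprimed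
monoid.

For (a) explicit equivalences are needed: exchanges in words of four letters (`Move`) and changes of
an irrelevant prime in words of two letters (`BitMove`). By induction on rows it is enough that
related words turn a row into the same row and bump related or equivalent words (`eqv_of_rowAct`).
Insertion into a hook word is a Schensted bump in the increasing part followed by one in the
decreasing part, so Knuth's lemma on triples applies twice (`Bump3.knuthMove`). The difficulty is
that the middle element may move; how it moves, and where primes go, is governed by the comparisons
of consecutive letters (`Step.asc`, `Step.desc_false`, `Step.desc_true`), and the fourth letter of a
move supplies the missing comparison (`Move.run`). With these moves an inserted letter travels
through the reading word of a row until the bumped letter comes out in front (`Step.eqv`).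

Facts (b) and (c) rest on a theorem of Schensted type: the first row of the insertion tableau is as
long as the longest hook subword (`length_le_of_isHook`, `exists_isHook`). For (b), reverse
insertion absorbs the letters preceding a maximal row one by one without allowing longer hook
subwords (`rowAct_append_row`). For (c), the bound is applied to the reading word of the insertion
tableau, which is equivalent to the original word by (a). -/

namespace DecompTab
-- Bumping in a sorted list for an abstract relation, and Knuth moves on triples.
section Bumping

variable {α : Type*} {R : α → α → Prop}

/-- `Bump R a l b l'`: the letter `a` replaces the first entry `b` of `l` that may not precede
`a` with respect to `R`, and the result is `l'`. -/
inductive Bump (R : α → α → Prop) : α → List α → α → List α → Prop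
  | here {a e : α} {l : List α} : ¬ R e a → Bump R a (e :: l) e (a :: l)
  | there {a e b : α} {l l' : List α} : R e a → Bump R a l b l' → Bump R a (e :: l) b (e :: l')

namespace Bump

theorem det {a b b' : α} {l l₁ l₂ : List α} (h : Bump R a l b l₁) (h' : Bump R a l b' l₂) :
    b = b' ∧ l₁ = l₂ := by
  induction h generalizing b' l₂ with
  | here h => cases h' with
    | here => exact ⟨rfl, rfl⟩
    | there h1 => exact absurd h1 h
  | there h _ ih => cases h' with
    | here h1 => exact absurd h h1
    | there _ h2 => obtain ⟨rfl, rfl⟩ := ih h2; exact ⟨rfl, rfl⟩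

theorem not_rel {a b : α} {l l' : List α} (h : Bump R a l b l') : ¬ R b a := by
  induction h with
  | here h => exact h
  | there _ _ ih => exact ih

theorem mem_old {a b : α} {l l' : List α} (h : Bump R a l b l') : b ∈ l := by
  induction h with
  | here h => simp
  | there _ _ ih => simp [ih]

theorem mem_new {a b : α} {l l' : List α} (h : Bump R a l b l') : a ∈ l' := by
  induction h with
  | here h => simp
  | there _ _ ih => simp [ih]

theorem mem_of_mem_new {a b x : α} {l l' : List α} (h : Bump R a l b l') (hx : x ∈ l') :
    x = a ∨ x ∈ l := by
  induction h with
  | here h => simp at hx ⊢; tauto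
  | there _ _ ih => simp at hx ⊢; tauto

theorem mem_of_mem_old {a b x : α} {l l' : List α} (h : Bump R a l b l') (hx : x ∈ l) :
    x = b ∨ x ∈ l' := by
  induction h with
  | here h => simp at hx ⊢; tauto
  | there _ _ ih => simp at hx ⊢; tauto

theorem length_eq {a b : α} {l l' : List α} (h : Bump R a l b l') : l'.length = l.length := by
  induction h with
  | here h => simp
  | there _ _ ih => simp [ih]

theorem exists_of_mem {a x : α} {l : List α} (hx : x ∈ l) (h : ¬ R x a) :
    ∃ b l', Bump R a l b l' := by
  induction l with
  | nil => simp at hx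
  | cons e l ih =>
    by_cases he : R e a
    · rcases List.mem_cons.1 hx with rfl | hx
      · exact absurd he h
      · obtain ⟨b, l', hb⟩ := ih hx
        exact ⟨b, _, .there he hb⟩
    · exact ⟨e, _, .here he⟩

theorem append_right {a b : α} {l l' : List α} (h : Bump R a l b l') (k : List α) :
    Bump R a (l ++ k) b (l' ++ k) := by
  induction h with
  | here h => exact .here h
  | there h _ ih => exact .there h ih

theorem append_left {a b : α} {l l' : List α} (h : Bump R a l b l') {k : List α}
    (hk : ∀ x ∈ k, R x a) : Bump R a (k ++ l) b (k ++ l') := by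
  induction k with
  | nil => exact h
  | cons e k ih =>
    exact .there (hk e (by simp)) (ih fun x hx => hk x (by simp [hx]))

theorem at_end {a b : α} {k : List α} (hk : ∀ x ∈ k, R x a) (hb : ¬ R b a) (j : List α) :
    Bump R a (k ++ b :: j) b (k ++ a :: j) :=
  append_left (.here hb) hk

theorem append_inv {a b : α} {l k l' : List α} (h : Bump R a (l ++ k) b l') :
    (∃ m, Bump R a l b m ∧ l' = m ++ k) ∨
      ((∀ x ∈ l, R x a) ∧ ∃ m, Bump R a k b m ∧ l' = l ++ m) := by
  induction l generalizing l' with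
  | nil => exact Or.inr ⟨by simp, l', h, rfl⟩
  | cons e l ih =>
    cases h with
    | here h => exact Or.inl ⟨_, .here h, rfl⟩
    | there h h' =>
      rcases ih h' with ⟨m, h1, rfl⟩ | ⟨h1, m, h2, rfl⟩
      · exact Or.inl ⟨_, .there h h1, rfl⟩
      · exact Or.inr ⟨by simpa using ⟨h, h1⟩, m, h2, rfl⟩

theorem sorted (hn : ∀ a b c, ¬ R a b → ¬ R b c → ¬ R a c) {a b : α} {l l' : List α}
    (h : Bump R a l b l') (hl : l.Pairwise R) : l'.Pairwise R := by
  induction h with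
  | here h =>
    rw [List.pairwise_cons] at hl ⊢
    exact ⟨fun x hx => by_contra fun h' => hn _ _ _ h h' (hl.1 x hx), hl.2⟩
  | there h hb ih =>
    rw [List.pairwise_cons] at hl ⊢
    refine ⟨fun x hx => ?_, ih hl.2⟩
    rcases hb.mem_of_mem_new hx with rfl | hx
    · exact h
    · exact hl.1 x hx

/-- Row bumping lemma: `x` now stands in the box it changed and `y` may follow it, so `y` bumps an
entry further to the right. -/
theorem rel_of_rel (ht : ∀ a b c, R a b → R b c → R a c) {x y b c : α} {l l₁ l₂ : List α}
    (hl : l.Pairwise R) (h1 : Bump R x l b l₁) (h2 : Bump R y l₁ c l₂) (h : R x y) : R b c := by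
  induction h1 generalizing c l₂ with
  | here h1 =>
    rw [List.pairwise_cons] at hl
    cases h2 with
    | here h3 => exact absurd h h3
    | there _ h3 => exact hl.1 _ h3.mem_old
  | there h1 _ ih =>
    cases h2 with
    | here h3 => exact absurd (ht _ _ _ h1 h) h3
    | there _ h3 => exact ih hl.of_cons h3

/-- Since `y` may not follow `x`, it lands in the box of `x`, bumping `x` itself, or in an earlier
one. -/
theorem not_rel_of_not_rel (ht : ∀ a b c, R a b → R b c → R a c) {x y b c : α}
    {l l₁ l₂ : List α} (hl : l.Pairwise R) (h1 : Bump R x l b l₁) (h2 : Bump R y l₁ c l₂)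
    (h : ¬ R x y) : ¬ R b c := by
  induction h1 generalizing c l₂ with
  | here h1 =>
    cases h2 with
    | here h3 => exact h1
    | there h3 _ => exact absurd h3 h
  | there h1 h1' ih =>
    cases h2 with
    | here h3 => exact fun h4 => h1'.not_rel (ht _ _ _ h4 h1)
    | there _ h3 => exact ih hl.of_cons h3

end Bump

/-- Successive bumping of three letters. -/
def Bump3 (R : α → α → Prop) (u : α × α × α) (l : List α) (v : α × α × α) (l' : List α) : Prop :=
  ∃ l₁ l₂, Bump R u.1 l v.1 l₁ ∧ Bump R u.2.1 l₁ v.2.1 l₂ ∧ Bump R u.2.2 l₂ v.2.2 l'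

/-- The two elementary Knuth moves on words of length three. -/
inductive KnuthMove (R : α → α → Prop) : α × α × α → α × α × α → Prop
  | left {x y z : α} : R x z → ¬ R y z → KnuthMove R (x, y, z) (y, x, z)
  | right {x y z : α} : ¬ R x y → R x z → KnuthMove R (x, y, z) (x, z, y)

/-- Words of length three which differ by an elementary Knuth move. -/
def KnuthRel (R : α → α → Prop) (u v : α × α × α) : Prop :=
  KnuthMove R u v ∨ KnuthMove R v u

theorem Bump3.cons {x y z e b c d : α} {l l' : List α} (hx : R e x) (hy : R e y) (hz : R e z)
    (h : Bump3 R (x, y, z) l (b, c, d) l') :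
    Bump3 R (x, y, z) (e :: l) (b, c, d) (e :: l') := by
  obtain ⟨l₁, l₂, h1, h2, h3⟩ := h
  exact ⟨_, _, .there hx h1, .there hy h2, .there hz h3⟩

/-- Knuth's lemma, by comparing the three letters with the first entry of the list: if all pass it,
induct on the tail. Only transitivity of `R` and of its negation is used, so that it serves both for
`<` on increasing parts and for `≥` on decreasing parts. -/
theorem Bump3.knuthMove (ht : ∀ a b c, R a b → R b c → R a c)
    (hn : ∀ a b c, ¬ R a b → ¬ R b c → ¬ R a c) {u v w : α × α × α} {l l' : List α}
    (hl : l.Pairwise R) (hb : Bump3 R u l w l') (hk : KnuthRel R u v) :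
    ∃ w', Bump3 R v l w' l' ∧ KnuthRel R w w' := by
  induction l generalizing w l' with
  | nil => obtain ⟨_, _, h, _⟩ := hb; cases h
  | cons e l ih =>
    obtain ⟨c1, c2, c3⟩ := w
    have hl' := List.pairwise_cons.1 hl
    rcases hk with hk | hk
    · cases hk with
      | @left x y z hxz hyz =>
        have hxy : R x y := by_contra fun h => hn _ _ _ h hyz hxz
        have hyx : ¬ R y x := fun h => hyz (ht _ _ _ h hxz)
        obtain ⟨l₁, l₂, h1, h2, h3⟩ := hb
        dsimp only at h1 h2 h3
        cases h1 with
        | there hex h1 =>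
          cases h2 with
          | here h => exact absurd (ht _ _ _ hex hxy) h
          | there hey h2 =>
            cases h3 with
            | here h => exact absurd (ht _ _ _ hex hxz) h
            | there hez h3 =>
              obtain ⟨⟨d1, d2, d3⟩, h4, h5⟩ := ih (w := (c1, c2, c3)) hl'.2 ⟨_, _, h1, h2, h3⟩
              exact ⟨_, h4.cons hey hex hez, h5⟩
        | here hex =>
          cases h2 with
          | here h => exact absurd hxy h
          | there _ h2 =>
            cases h3 with
            | here h => exact absurd hxz h
            | there _ h3 =>
              by_cases hey : R e y
              · exact ⟨(c2, e, c3), ⟨_, _, .there hey h2, .here hex, .there hxz h3⟩,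
                  Or.inl (.left (by
                    rcases h2.mem_of_mem_new h3.mem_old with rfl | h
                    · exact hey
                    · exact hl'.1 _ h) (Bump.not_rel_of_not_rel ht hl'.2 h2 h3 hyz))⟩
              -- The first entry may precede neither `x` nor `y`. The third insertion must then bump
              -- `y` itself, whereas in the exchanged order `y` is bumped second: the output move is
              -- of the other type.
              · cases h2 with
                | there h _ =>
                  exact absurd (ht _ _ _ (hl'.1 _ (by simp)) h) hey
                | here h =>
                  cases h3 with
                  | there h _ => exact absurd h hyz
                  | here h' =>
                    exact ⟨(e, c3, c2), ⟨_, _, .here hey, .here hyx,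
                      .there hxz (.here (hn _ _ _ h hyz))⟩,
                      Or.inr (.right hey (hl'.1 _ (by simp)))⟩
      | @right x y z hxy hxz =>
        have hyz : R y z := by_contra fun h => hn _ _ _ hxy h hxz
        have hzy : ¬ R z y := fun h => hxy (ht _ _ _ hxz h)
        obtain ⟨l₁, l₂, h1, h2, h3⟩ := hb
        dsimp only at h1 h2 h3
        cases h1 with
        | there hex h1 =>
          have hez := ht _ _ _ hex hxz
          cases h2 with
          | there hey h2 =>
            cases h3 with
            | here h => exact absurd hez h
            | there hez h3 =>
              obtain ⟨⟨d1, d2, d3⟩, h4, h5⟩ := ih (w := (c1, c2, c3)) hl'.2 ⟨_, _, h1, h2, h3⟩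
              exact ⟨_, h4.cons hex hez hey, h5⟩
          | here hey =>
            cases h3 with
            | here h => exact absurd hyz h
            | there _ h3 =>
              exact ⟨(c1, c3, e), ⟨_, _, .there hex h1, .there hez h3, .here hey⟩,
                Or.inl (.right (fun h => h1.not_rel (ht _ _ _ h hex))
                  (Bump.rel_of_rel ht hl'.2 h1 h3 hxz))⟩
        | here hex =>
          cases h2 with
          | there h _ => exact absurd h hxy
          | here _ =>
            cases h3 with
            | here h => exact absurd hyz h
            | there _ h3 =>
              exact ⟨(e, c3, _), ⟨_, _, .here hex, .there hxz h3, .here hxy⟩,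
                Or.inl (.right hex (hl'.1 _ h3.mem_old))⟩
    · cases hk with
      | @left y x z hyz hxz =>
        -- the word is `x y z` and becomes `y x z`, where `R y z` and `¬ R x z`
        have hyx : R y x := by_contra fun h => hn _ _ _ h hxz hyz
        have hxy : ¬ R x y := fun h => hxz (ht _ _ _ h hyz)
        obtain ⟨l₁, l₂, h1, h2, h3⟩ := hb
        dsimp only at h1 h2 h3
        cases h1 with
        | there hex h1 =>
          cases h2 with
          | there hey h2 =>
            cases h3 with
            | here h => exact absurd (ht _ _ _ hey hyz) h
            | there hez h3 =>
              obtain ⟨⟨d1, d2, d3⟩, h4, h5⟩ := ih (w := (c1, c2, c3)) hl'.2 ⟨_, _, h1, h2, h3⟩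
              exact ⟨_, h4.cons hey hex hez, h5⟩
          | here hey =>
            cases h3 with
            | here h => exact absurd hyz h
            | there _ h3 =>
              exact ⟨(e, c1, c3), ⟨_, _, .here hey, .there hyx h1, .there hyz h3⟩,
                Or.inr (.left (by
                  rcases h1.mem_of_mem_new h3.mem_old with rfl | h
                  · exact hex
                  · exact hl'.1 _ h) (Bump.not_rel_of_not_rel ht hl'.2 h1 h3 hxz))⟩
        | here hex =>
          have hey : ¬ R e y := hn _ _ _ hex hxy
          cases h2 with
          | there h _ => exact absurd h hxy
          | here _ =>
            cases h3 with
            | here h => exact absurd hyz h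
            | there _ h3 =>
              cases h3 with
              | there h _ =>
                exact absurd (ht _ _ _ (hl'.1 _ (by simp)) h) (hn _ _ _ hex hxz)
              | here h =>
                have hfx : ¬ R c3 c2 := fun h' => hex (ht _ _ _ (hl'.1 _ (by simp)) h')
                exact ⟨(e, c3, c2), ⟨_, _, .here hey, .there hyx (.here hfx),
                  .there hyz (.here hxz)⟩, Or.inl (.right hex (hl'.1 _ (by simp)))⟩
      | @right x z y hxz hxy =>
        -- the word is `x y z` and becomes `x z y`, where `R x y` and `¬ R x z`
        have hzy : R z y := by_contra fun h => hn _ _ _ hxz h hxy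
        have hyz : ¬ R y z := fun h => hxz (ht _ _ _ hxy h)
        obtain ⟨l₁, l₂, h1, h2, h3⟩ := hb
        dsimp only at h1 h2 h3
        cases h1 with
        | there hex h1 =>
          have hey := ht _ _ _ hex hxy
          cases h2 with
          | here h => exact absurd hey h
          | there _ h2 =>
            cases h3 with
            | there hez h3 =>
              obtain ⟨⟨d1, d2, d3⟩, h4, h5⟩ := ih (w := (c1, c2, c3)) hl'.2 ⟨_, _, h1, h2, h3⟩
              exact ⟨_, h4.cons hex hez hey, h5⟩
            | here hez =>
              exact ⟨(c1, e, c2), ⟨_, _, .there hex h1, .here hez, .there hzy h2⟩,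
                Or.inr (.right (fun h => h1.not_rel (ht _ _ _ h hex))
                  (Bump.rel_of_rel ht hl'.2 h1 h2 hxy))⟩
        | here hex =>
          cases h2 with
          | here h => exact absurd hxy h
          | there _ h2 =>
            cases h3 with
            | there h _ => exact absurd h hxz
            | here _ =>
              exact ⟨(e, _, c2), ⟨_, _, .here hex, .here hxz, .there hzy h2⟩,
                Or.inr (.right hex (hl'.1 _ h2.mem_old))⟩

end Bumping
end DecompTab

namespace DecompTab
-- Insertion into one hook word: single steps and pairs of consecutive steps.
section HookRows

variable {α : Type*} [LinearOrder α]

/-- A nonempty row, with its middle element, what precedes it and what follows it. -/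
@[ext]
structure HookRow (α : Type*) where
  dec : List α
  mid : α
  inc : List α

/-- The row is a hook word, and `mid` is its middle element. -/
structure HookRow.Valid (X : HookRow α) : Prop where
  dec : (X.dec ++ [X.mid]).Pairwise (· ≥ ·)
  inc : (X.mid :: X.inc).Pairwise (· < ·)

theorem HookRow.Valid.le_dec {X : HookRow α} (h : X.Valid) {d : α} (hd : d ∈ X.dec) :
    X.mid ≤ d := by
  have := List.pairwise_append.1 h.dec
  exact this.2.2 d hd _ (by simp)

theorem HookRow.Valid.lt_inc {X : HookRow α} (h : X.Valid) {i : α} (hi : i ∈ X.inc) :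
    X.mid < i := (List.pairwise_cons.1 h.inc).1 i hi

theorem HookRow.Valid.dec_sorted {X : HookRow α} (h : X.Valid) : X.dec.Pairwise (· ≥ ·) :=
  (List.pairwise_append.1 h.dec).1

theorem HookRow.Valid.inc_sorted {X : HookRow α} (h : X.Valid) : X.inc.Pairwise (· < ·) :=
  (List.pairwise_cons.1 h.inc).2

/-- Insertion of a letter `a` into a row in which it bumps a letter `c`. The boolean tells whether
the location of the middle element changes. -/
inductive Step : HookRow α → α → α → HookRow α → Bool → Prop
  -- The letter `b` finds a smaller entry before the middle element, which is not affected.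
  | bulk {D I D' I' : List α} {m a b c : α} : m < a → Bump (· < ·) a I b I' →
      Bump (· ≥ ·) b D c D' → Step ⟨D, m, I⟩ a c ⟨D', m, I'⟩ false
  -- Here `a` replaces the first increasing entry and becomes the middle element. If `a > m`, this
  -- requires that `i` bump `m`, that is, that no entry of `D` be smaller than `i`; otherwise the
  -- step is `bulk`.
  | head {D I D' : List α} {m i a c : α} : a ≤ i → (a ≤ m ∨ ∀ d ∈ D, i ≤ d) →
      Bump (· ≥ ·) i (D ++ [m]) c D' → Step ⟨D, m, i :: I⟩ a c ⟨D', a, I⟩ true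
  -- Here `b` takes the place of `m`. As `i < a ≤ b`, the entry `i` now ends the decreasing part.
  | deep {D I I' : List α} {m i a b : α} : i < a → Bump (· < ·) a I b I' → (∀ d ∈ D, b ≤ d) →
      Step ⟨D, m, i :: I⟩ a m ⟨D ++ [b], i, I'⟩ true

theorem lt_trans' (a b c : α) (h : a < b) (h' : b < c) : a < c := h.trans h'
theorem ge_trans'' (a b c : α) (h : a ≥ b) (h' : b ≥ c) : a ≥ c := ge_trans h h'
theorem not_lt_trans (a b c : α) (h : ¬ a < b) (h' : ¬ b < c) : ¬ a < c := by
  rw [not_lt] at *; exact h'.trans h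
theorem not_ge_trans (a b c : α) (h : ¬ a ≥ b) (h' : ¬ b ≥ c) : ¬ a ≥ c := by
  rw [not_le] at *; exact h.trans h'

namespace Bump

theorem le {a b : α} {l l' : List α} (h : Bump (· < ·) a l b l') : a ≤ b := not_lt.1 h.not_rel

theorem lt {a b : α} {l l' : List α} (h : Bump (· ≥ ·) a l b l') : b < a := not_le.1 h.not_rel

theorem dec_le {a b : α} {l l' : List α} (h : Bump (· ≥ ·) a l b l')
    (hl : l.Pairwise (· ≥ ·)) {x : α} (hx : x ∈ l) (hxa : x < a) : x ≤ b := by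
  induction h with
  | here h =>
    rcases List.mem_cons.1 hx with rfl | hx
    · exact le_rfl
    · exact (List.pairwise_cons.1 hl).1 _ hx
  | there h _ ih =>
    rcases List.mem_cons.1 hx with rfl | hx
    · exact absurd h (not_le.2 hxa)
    · exact ih hl.of_cons hx

theorem le_inc {a b : α} {l l' : List α} (h : Bump (· < ·) a l b l')
    (hl : l.Pairwise (· < ·)) {x : α} (hx : x ∈ l) (hxa : a ≤ x) : b ≤ x := by
  induction h with
  | here h =>
    rcases List.mem_cons.1 hx with rfl | hx
    · exact le_rfl
    · exact ((List.pairwise_cons.1 hl).1 _ hx).le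
  | there h _ ih =>
    rcases List.mem_cons.1 hx with rfl | hx
    · exact absurd h (not_lt.2 hxa)
    · exact ih hl.of_cons hx

theorem inc_lt_of_lt {x y b c : α} {l l₁ l₂ : List α} (hl : l.Pairwise (· < ·))
    (h1 : Bump (· < ·) x l b l₁) (h2 : Bump (· < ·) y l₁ c l₂) (h : x < y) : b < c :=
  rel_of_rel lt_trans' hl h1 h2 h

theorem inc_le_of_le {x y b c : α} {l l₁ l₂ : List α} (hl : l.Pairwise (· < ·))
    (h1 : Bump (· < ·) x l b l₁) (h2 : Bump (· < ·) y l₁ c l₂) (h : y ≤ x) : c ≤ b :=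
  not_lt.1 (not_rel_of_not_rel lt_trans' hl h1 h2 (not_lt.2 h))

theorem dec_lt_of_lt {x y b c : α} {l l₁ l₂ : List α} (hl : l.Pairwise (· ≥ ·))
    (h1 : Bump (· ≥ ·) x l b l₁) (h2 : Bump (· ≥ ·) y l₁ c l₂) (h : x < y) : b < c :=
  not_le.1 (not_rel_of_not_rel ge_trans'' hl h1 h2 (not_le.2 h))

theorem dec_le_of_le {x y b c : α} {l l₁ l₂ : List α} (hl : l.Pairwise (· ≥ ·))
    (h1 : Bump (· ≥ ·) x l b l₁) (h2 : Bump (· ≥ ·) y l₁ c l₂) (h : y ≤ x) : c ≤ b :=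
  rel_of_rel ge_trans'' hl h1 h2 h

theorem inc_sorted {a b : α} {l l' : List α} (h : Bump (· < ·) a l b l')
    (hl : l.Pairwise (· < ·)) : l'.Pairwise (· < ·) := h.sorted not_lt_trans hl

theorem dec_sorted {a b : α} {l l' : List α} (h : Bump (· ≥ ·) a l b l')
    (hl : l.Pairwise (· ≥ ·)) : l'.Pairwise (· ≥ ·) := h.sorted not_ge_trans hl

/-- If all entries of `l` are at least `a`, then nothing in `l` is bumped. -/
theorem dec_append_of_le {a b m : α} {l l' : List α} (h : Bump (· ≥ ·) a (l ++ [m]) b l')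
    (hl : ∀ x ∈ l, a ≤ x) : b = m ∧ l' = l ++ [a] := by
  rcases h.append_inv with ⟨k, hk, _⟩ | ⟨_, k, hk, rfl⟩
  · exact absurd (hl _ hk.mem_old) (not_le.2 hk.lt)
  · cases hk with
    | here => exact ⟨rfl, rfl⟩
    | there _ h1 => cases h1

theorem dec_append_of_lt {a b x : α} {l k l' : List α} (h : Bump (· ≥ ·) a (l ++ k) b l')
    (hx : x ∈ l) (hxa : x < a) : ∃ m, Bump (· ≥ ·) a l b m ∧ l' = m ++ k := by
  rcases h.append_inv with h | ⟨h, _⟩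
  · exact h
  · exact absurd (h x hx) (not_le.2 hxa)

end Bump

theorem Step.head_le {D D' : List α} {m i a c : α} (hm : ∀ d ∈ D, m ≤ d) (h1 : a ≤ i)
    (h2 : a ≤ m ∨ ∀ d ∈ D, i ≤ d) (h3 : Bump (· ≥ ·) i (D ++ [m]) c D') : ∀ d ∈ D', a ≤ d := by
  intro d hd
  rcases h2 with h2 | h2
  · rcases h3.mem_of_mem_new hd with rfl | h
    · exact h1
    · rcases List.mem_append.1 h with h | h
      · exact h2.trans (hm d h)
      · rw [List.mem_singleton.1 h]; exact h2
  · obtain ⟨_, rfl⟩ := h3.dec_append_of_le h2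
    rcases List.mem_append.1 hd with h | h
    · exact h1.trans (h2 d h)
    · rw [List.mem_singleton.1 h]; exact h1

theorem pairwise_concat {l : List α} {a : α} :
    (l ++ [a]).Pairwise (· ≥ ·) ↔ l.Pairwise (· ≥ ·) ∧ ∀ x ∈ l, a ≤ x := by
  rw [List.pairwise_append]; simp

theorem Step.valid {X X' : HookRow α} {a c : α} {f : Bool} (hX : X.Valid)
    (h : Step X a c X' f) : X'.Valid := by
  cases h with
  | bulk h1 h2 h3 =>
    refine ⟨(h3.append_right _).dec_sorted hX.dec, ?_⟩
    exact (Bump.there h1 h2).inc_sorted hX.inc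
  | head h1 h2 h3 =>
    refine ⟨pairwise_concat.2 ⟨h3.dec_sorted hX.dec, ?_⟩, ?_⟩
    · exact Step.head_le (fun d hd => hX.le_dec hd) h1 h2 h3
    · have := List.pairwise_cons.1 hX.inc_sorted
      exact List.pairwise_cons.2 ⟨fun x hx => h1.trans_lt (this.1 x hx), this.2⟩
  | @deep D I I' m i a b h1 h2 h3 =>
    have hi : i < b := h1.trans_le h2.le
    refine ⟨pairwise_concat.2 ⟨pairwise_concat.2 ⟨hX.dec_sorted, h3⟩, ?_⟩, ?_⟩
    · intro x hx
      rcases List.mem_append.1 hx with h | h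
      · exact hi.le.trans (h3 x h)
      · rw [List.mem_singleton.1 h]; exact hi.le
    · exact (Bump.there h1 h2).inc_sorted hX.inc_sorted

theorem Step.det {X X' X'' : HookRow α} {a c c' : α} {f f' : Bool} (hX : X.Valid)
    (h : Step X a c X' f) (h' : Step X a c' X'' f') : c = c' ∧ X' = X'' ∧ f = f' := by
  cases h with
  | bulk h1 h2 h3 =>
    cases h' with
    | bulk h4 h5 h6 =>
      obtain ⟨rfl, rfl⟩ := h2.det h5
      obtain ⟨rfl, rfl⟩ := h3.det h6
      exact ⟨rfl, rfl, rfl⟩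
    | head h4 h5 h6 =>
      rcases h5 with h5 | h5
      · exact absurd h1 (not_lt.2 h5)
      · obtain ⟨rfl, rfl⟩ := h2.det (.here (not_lt.2 h4))
        exact absurd (h5 _ h3.mem_old) (not_le.2 h3.lt)
    | deep h4 h5 h6 =>
      obtain ⟨rfl, rfl⟩ := h2.det (.there h4 h5)
      exact absurd (h6 _ h3.mem_old) (not_le.2 h3.lt)
  | head h1 h2 h3 =>
    cases h' with
    | bulk h4 h5 h6 =>
      rcases h2 with h2 | h2
      · exact absurd h4 (not_lt.2 h2)
      · obtain ⟨rfl, rfl⟩ := h5.det (.here (not_lt.2 h1))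
        exact absurd (h2 _ h6.mem_old) (not_le.2 h6.lt)
    | head h4 h5 h6 =>
      obtain ⟨rfl, rfl⟩ := h3.det h6
      exact ⟨rfl, rfl, rfl⟩
    | deep h4 h5 h6 => exact absurd h4 (not_lt.2 h1)
  | deep h1 h2 h3 =>
    cases h' with
    | bulk h4 h5 h6 =>
      obtain ⟨rfl, rfl⟩ := h5.det (.there h1 h2)
      exact absurd (h3 _ h6.mem_old) (not_le.2 h6.lt)
    | head h4 h5 h6 => exact absurd h1 (not_lt.2 h4)
    | deep h4 h5 h6 =>
      obtain ⟨rfl, rfl⟩ := h2.det h5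
      exact ⟨rfl, rfl, rfl⟩

theorem Step.exists_of_le {X : HookRow α} {a x : α} (hX : X.Valid) (hx : x ∈ X.inc)
    (ha : a ≤ x) : ∃ c X' f, Step X a c X' f := by
  obtain ⟨D, m, I⟩ := X
  cases I with
  | nil => simp at hx
  | cons i I =>
    have hmi : m < i := hX.lt_inc (i := i) (by simp)
    by_cases hai : a ≤ i
    · by_cases hc : a ≤ m ∨ ∀ d ∈ D, i ≤ d
      · obtain ⟨c, D', h⟩ := Bump.exists_of_mem (R := (· ≥ ·)) (a := i) (x := m) (l := D ++ [m])
          (by simp) (not_le.2 hmi)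
        exact ⟨_, _, _, .head hai hc h⟩
      · push Not at hc
        obtain ⟨hma, d, hd, hdi⟩ := hc
        obtain ⟨c, D', h⟩ := Bump.exists_of_mem (R := (· ≥ ·)) hd (not_le.2 hdi)
        exact ⟨_, _, _, .bulk hma (.here (not_lt.2 hai)) h⟩
    · rw [not_le] at hai
      have hx' : x ∈ I := by
        rcases List.mem_cons.1 hx with rfl | h
        · exact absurd ha (not_le.2 hai)
        · exact h
      obtain ⟨b, I', hb⟩ := Bump.exists_of_mem (R := (· < ·)) hx' (not_lt.2 ha)
      by_cases hc : ∀ d ∈ D, b ≤ d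
      · exact ⟨_, _, _, .deep hai hb hc⟩
      · push Not at hc
        obtain ⟨d, hd, hdi⟩ := hc
        obtain ⟨c, D', h⟩ := Bump.exists_of_mem (R := (· ≥ ·)) hd (not_le.2 hdi)
        exact ⟨_, _, _, .bulk (hmi.trans hai) (.there hai hb) h⟩

/-- The row bumping lemma in each part gives the order of the bumped letters, except after `deep`,
where the old middle element is below everything. The middle cannot move in the second step: `a'`
does not fit at or before `a`, and the decreasing part now holds an entry smaller than the letter
that `a'` sends there. -/
theorem Step.asc {X X₁ X₂ : HookRow α} {a a' c c' : α} {f f' : Bool} (hX : X.Valid)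
    (h : Step X a c X₁ f) (h' : Step X₁ a' c' X₂ f') (ha : a < a') : f' = false ∧ c < c' := by
  have hX1 := h.valid hX
  cases h with
  | bulk h1 h2 h3 =>
    cases h' with
    | bulk h4 h5 h6 =>
      exact ⟨rfl, Bump.dec_lt_of_lt hX.dec_sorted h3 h6 (Bump.inc_lt_of_lt hX.inc_sorted h2 h5 ha)⟩
    | head h4 h5 h6 =>
      exfalso
      have := List.pairwise_cons.1 hX1.inc_sorted
      rcases List.mem_cons.1 h2.mem_new with h | h
      · subst h; exact absurd ha (not_lt.2 h4)
      · exact absurd (this.1 _ h) (not_lt.2 (ha.le.trans h4))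
    | deep h4 h5 h6 =>
      exact absurd (h6 _ h3.mem_new)
        (not_le.2 (Bump.inc_lt_of_lt hX.inc_sorted h2 (.there h4 h5) ha))
  | @head D I D' m i a c h1 h2 h3 =>
    have hi := (List.pairwise_cons.1 hX.inc_sorted).1
    cases h' with
    | bulk h4 h5 h6 =>
      exact ⟨rfl, Bump.dec_lt_of_lt hX.dec h3 h6 (hi _ h5.mem_old)⟩
    | head h4 h5 h6 =>
      rcases h5 with h5 | h5
      · exact absurd ha (not_lt.2 h5)
      · exact absurd (h5 _ h3.mem_new) (not_le.2 (hi _ (by simp)))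
    | deep h4 h5 h6 =>
      exact absurd (h6 _ h3.mem_new) (not_le.2 (hi _ (by simp [h5.mem_old])))
  | @deep D I I' m i a b h1 h2 h3 =>
    have hm := hX.lt_inc (i := i) (by simp)
    cases h' with
    | bulk h4 h5 h6 =>
      refine ⟨rfl, (hm.trans h1).trans_le (h2.le.trans ?_)⟩
      rcases List.mem_append.1 h6.mem_old with h | h
      · exact h3 _ h
      · rw [List.mem_singleton.1 h]
    | head h4 h5 h6 =>
      exfalso
      have := List.pairwise_cons.1 hX1.inc_sorted
      rcases List.mem_cons.1 h2.mem_new with h | h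
      · subst h; exact absurd ha (not_lt.2 h4)
      · exact absurd (this.1 _ h) (not_lt.2 (ha.le.trans h4))
    | deep h4 h5 h6 =>
      exact absurd (h6 b (by simp))
        (not_le.2 (Bump.inc_lt_of_lt hX.inc_sorted.of_cons h2 (.there h4 h5) ha))

/-- If the middle stayed, both parts bump weakly downwards; a middle element bumped by the second
step lies below the decreasing part anyway. -/
theorem Step.desc_false {X X₁ X₂ : HookRow α} {a a' c c' : α} {f' : Bool} (hX : X.Valid)
    (h : Step X a c X₁ false) (h' : Step X₁ a' c' X₂ f') (ha : a' ≤ a) : c' ≤ c := by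
  cases h with
  | bulk h1 h2 h3 =>
    cases h' with
    | bulk h4 h5 h6 =>
      exact Bump.dec_le_of_le hX.dec_sorted h3 h6 (Bump.inc_le_of_le hX.inc_sorted h2 h5 ha)
    | head h4 h5 h6 =>
      exact Bump.dec_le_of_le hX.dec (h3.append_right _) h6
        (Bump.inc_le_of_le hX.inc_sorted h2 (.here (not_lt.2 h4)) ha)
    | deep h4 h5 h6 => exact hX.le_dec h3.mem_old

/-- After a shift the bumped letters increase although the inserted ones decrease. After `head`, the
letter `a` is the middle element, so `a' ≤ a` again falls under `head` and sends up a letter larger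
than the one before. After `deep`, the old middle element and then the larger new one are bumped. -/
theorem Step.desc_true {X X₁ X₂ : HookRow α} {a a' c c' : α} {f' : Bool} (hX : X.Valid)
    (h : Step X a c X₁ true) (h' : Step X₁ a' c' X₂ f') (ha : a' ≤ a) : f' = true ∧ c < c' := by
  have hX1 := h.valid hX
  cases h with
  | @head D I D' m i a c h1 h2 h3 =>
    have hi := (List.pairwise_cons.1 hX.inc_sorted).1
    cases h' with
    | bulk h4 h5 h6 => exact absurd h4 (not_lt.2 ha)
    | head h4 h5 h6 =>
      have hi' := hi _ (List.mem_cons_self)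
      obtain ⟨k, h7, _⟩ := h6.dec_append_of_lt h3.mem_new hi'
      exact ⟨rfl, Bump.dec_lt_of_lt hX.dec h3 h7 hi'⟩
    | deep h4 h5 h6 =>
      exact absurd (hi _ List.mem_cons_self) (not_lt.2 (h4.le.trans (ha.trans h1)))
  | @deep D I I' m i a b h1 h2 h3 =>
    have hm := hX.lt_inc (i := i) (by simp)
    cases h' with
    | bulk h4 h5 h6 =>
      exfalso
      have hb := Bump.inc_le_of_le hX.inc_sorted.of_cons h2 h5 ha
      refine absurd h6.lt (not_lt.2 (hb.trans ?_))
      rcases List.mem_append.1 h6.mem_old with h | h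
      · exact h3 _ h
      · rw [List.mem_singleton.1 h]
    | head h4 h5 h6 =>
      have hb := Bump.inc_le_of_le hX.inc_sorted.of_cons h2 (.here (not_lt.2 h4)) ha
      obtain ⟨rfl, _⟩ := h6.dec_append_of_le (by
        intro x hx
        rcases List.mem_append.1 hx with h | h
        · exact hb.trans (h3 _ h)
        · rw [List.mem_singleton.1 h]; exact hb)
      exact ⟨rfl, hm⟩
    | deep h4 h5 h6 => exact ⟨rfl, hm⟩

theorem Step.length_dec {X X' : HookRow α} {a c : α} {f : Bool} (h : Step X a c X' f) :
    X'.dec.length = X.dec.length + f.toNat := by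
  cases h with
  | bulk h1 h2 h3 => simp [h3.length_eq]
  | head h1 h2 h3 => simp [h3.length_eq]
  | deep h1 h2 h3 => simp

end HookRows
end DecompTab

namespace DecompTab
-- Knuth moves for one row, by comparison with bumping that never renormalizes the middle.
section Triples

variable {α : Type*} [LinearOrder α]

theorem KnuthMove.ge_of_lt {u v : α × α × α} (h : KnuthMove (· < ·) u v) :
    KnuthMove (· ≥ ·) v u := by
  cases h with
  | left h1 h2 => exact .left (not_lt.1 h2) (not_le.2 h1)
  | right h1 h2 => exact .right (not_le.2 h2) (not_lt.1 h1)

theorem KnuthMove.lt_of_ge {u v : α × α × α} (h : KnuthMove (· ≥ ·) u v) :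
    KnuthMove (· < ·) v u := by
  cases h with
  | left h1 h2 => exact .left (not_le.1 h2) (not_lt.2 h1)
  | right h1 h2 => exact .right (not_lt.2 h2) (not_le.1 h1)

/-- Passing from `<` to `≥` only interchanges the two sides of each Knuth move. Hence the letters
bumped by the increasing part can be fed into Knuth's lemma for the decreasing part. -/
theorem knuthRel_ge_iff {u v : α × α × α} :
    KnuthRel (· ≥ ·) u v ↔ KnuthRel (· < ·) u v :=
  ⟨fun h => h.elim (fun h => Or.inr h.lt_of_ge) fun h => Or.inl h.lt_of_ge,
    fun h => h.elim (fun h => Or.inr h.ge_of_lt) fun h => Or.inl h.ge_of_lt⟩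

/-- Insertion of a letter into a pair of a decreasing and an increasing sequence, without
normalizing the position of the middle element. -/
def Pure (Y : List α × List α) (a c : α) (Y' : List α × List α) : Prop :=
  ∃ b, Bump (· < ·) a Y.2 b Y'.2 ∧ Bump (· ≥ ·) b Y.1 c Y'.1

theorem Pure.knuth {Y Y₁ Y₂ Y₃ : List α × List α} {a₁ a₂ a₃ c₁ c₂ c₃ b₁ b₂ b₃ : α}
    (hd : Y.1.Pairwise (· ≥ ·)) (hi : Y.2.Pairwise (· < ·))
    (h1 : Pure Y a₁ c₁ Y₁) (h2 : Pure Y₁ a₂ c₂ Y₂) (h3 : Pure Y₂ a₃ c₃ Y₃)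
    (hk : KnuthRel (· < ·) (a₁, a₂, a₃) (b₁, b₂, b₃)) :
    ∃ d₁ d₂ d₃ Z₁ Z₂, Pure Y b₁ d₁ Z₁ ∧ Pure Z₁ b₂ d₂ Z₂ ∧ Pure Z₂ b₃ d₃ Y₃ ∧
      KnuthRel (· < ·) (c₁, c₂, c₃) (d₁, d₂, d₃) := by
  obtain ⟨e1, h1, h1'⟩ := h1
  obtain ⟨e2, h2, h2'⟩ := h2
  obtain ⟨e3, h3, h3'⟩ := h3
  obtain ⟨⟨g1, g2, g3⟩, ⟨I1, I2, k1, k2, k3⟩, hg⟩ := Bump3.knuthMove lt_trans' not_lt_trans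
    (w := (e1, e2, e3)) hi ⟨_, _, h1, h2, h3⟩ hk
  obtain ⟨⟨d1, d2, d3⟩, ⟨D1, D2, l1, l2, l3⟩, hd⟩ := Bump3.knuthMove ge_trans'' not_ge_trans
    (w := (c₁, c₂, c₃)) hd ⟨_, _, h1', h2', h3'⟩ (knuthRel_ge_iff.2 hg)
  exact ⟨d1, d2, d3, (D1, I1), (D2, I2), ⟨_, k1, l1⟩, ⟨_, k2, l2⟩, ⟨_, k3, l3⟩,
    knuthRel_ge_iff.1 hd⟩

/-- `X` is the row obtained from the pair `Y` by moving, if needed, the first entry of its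
increasing sequence to the decreasing one. -/
inductive Lag : HookRow α → List α × List α → Prop
  | eq {D I : List α} {m : α} : Lag ⟨D, m, I⟩ (D ++ [m], I)
  | pop {D I : List α} {m : α} : (∀ d ∈ D, m ≤ d) → Lag ⟨D, m, I⟩ (D, m :: I)

/-- The two alternatives exclude each other: an entry heading the increasing list belongs to the
decreasing part only if it is at most all entries there. -/
theorem Lag.unique {X X' : HookRow α} {Y : List α × List α} (hX : X.Valid) (hX' : X'.Valid)
    (h : Lag X Y) (h' : Lag X' Y) : X = X' := by
  generalize hY : Y = Z at h'
  cases h with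
  | @eq D I m =>
    cases h' with
    | @eq D' I' m' =>
      obtain ⟨h1, h2⟩ := Prod.mk.injEq .. ▸ hY
      obtain ⟨rfl, h3⟩ := List.append_inj' h1 rfl
      obtain rfl := List.singleton_inj.1 h3
      rw [h2]
    | @pop D' I' m' h =>
      obtain ⟨rfl, rfl⟩ := Prod.mk.injEq .. ▸ hY
      exact absurd (h m (by simp)) (not_le.2 (hX.lt_inc (i := m') (by simp)))
  | @pop D I m h =>
    cases h' with
    | @eq D' I' m' =>
      obtain ⟨rfl, rfl⟩ := Prod.mk.injEq .. ▸ hY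
      exact absurd (h m' (by simp)) (not_le.2 (hX'.lt_inc (i := m) (by simp)))
    | @pop D' I' m' h =>
      obtain ⟨rfl, h2⟩ := Prod.mk.injEq .. ▸ hY
      obtain ⟨rfl, rfl⟩ := List.cons.inj h2
      rfl

theorem Step.mid_le {X X' : HookRow α} {a c : α} {f : Bool} (h : Step X a c X' f) :
    X'.mid ≤ a := by
  cases h with
  | bulk h1 h2 h3 => exact h1.le
  | head h1 h2 h3 => exact le_rfl
  | deep h1 h2 h3 => exact h1.le

theorem Step.mid_eq {X X' : HookRow α} {a c : α} (h : Step X a c X' false) :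
    X'.mid = X.mid := by
  cases h with
  | bulk h1 h2 h3 => rfl

/-- A pair may lag behind by one letter as long as `a` exceeds the middle element: the letter `a`
then passes it, wherever it is stored. Without this condition, `a` could dislodge a middle element
stored at the head of the increasing list, which finds no smaller entry to bump. -/
theorem Pure.step {X : HookRow α} {Y Y' : List α × List α} {a c : α} (hX : X.Valid)
    (hl : Lag X Y) (h : Pure Y a c Y') (hp : Y = (X.dec ++ [X.mid], X.inc) ∨ X.mid < a) :
    ∃ f X', Step X a c X' f ∧ Lag X' Y' := by
  obtain ⟨b, h1, h2⟩ := h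
  obtain ⟨D', I'⟩ := Y'
  cases hl with
  | @eq D I m =>
    dsimp only at h1 h2
    rcases h2.append_inv with ⟨D₁, h3, rfl⟩ | ⟨h3, D₁, h4, rfl⟩
    · by_cases hma : m < a
      · exact ⟨_, _, .bulk hma h1 h3, .eq⟩
      · rw [not_lt] at hma
        cases h1 with
        | here h =>
          have h' := not_lt.1 h
          exact ⟨_, _, .head h' (Or.inl hma) h2,
            .pop (Step.head_le (fun d hd => hX.le_dec hd) h' (Or.inl hma) h2)⟩
        | @there e _ _ _ h _ =>
          exact absurd (hX.lt_inc (i := e) (by simp)) (not_lt.2 (h.le.trans hma))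
    · have h3' : ∀ d ∈ D, b ≤ d := h3
      obtain ⟨rfl, h5⟩ := h2.dec_append_of_le h3'
      rw [h5] at h2 ⊢
      cases h1 with
      | here h =>
        have h' := not_lt.1 h
        exact ⟨_, _, .head h' (Or.inr h3') h2,
          .pop (Step.head_le (fun d hd => hX.le_dec hd) h' (Or.inr h3') h2)⟩
      | there h h' =>
        refine ⟨_, _, .deep h h' h3', .pop fun d hd => ?_⟩
        have hb := (h.trans_le h'.le).le
        rcases List.mem_append.1 hd with h | h
        · exact hb.trans (h3' d h)
        · rw [List.mem_singleton.1 h]; exact hb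
  | @pop D I m hD =>
    rcases hp with hp | hp
    · obtain ⟨h3, -⟩ := Prod.mk.injEq .. ▸ hp
      simp at h3
    · dsimp only at h1 h2 hp
      cases h1 with
      | here h => exact absurd hp h
      | there h h' =>
        refine ⟨_, _, .bulk hp h' h2, .pop fun d hd => ?_⟩
        rcases h2.mem_of_mem_new hd with rfl | h
        · exact (hp.trans_le h'.le).le
        · exact hD d h

theorem Step.pure {X X' : HookRow α} {Y : List α × List α} {a c : α} {f : Bool} (hX : X.Valid)
    (hl : Lag X Y) (h : Step X a c X' f)
    (hp : Y = (X.dec ++ [X.mid], X.inc) ∨ X.mid < a ∧ f = false) :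
    ∃ Y', Pure Y a c Y' ∧ Lag X' Y' := by
  cases hl with
  | eq =>
    cases h with
    | bulk h1 h2 h3 => exact ⟨(_, _), ⟨_, h2, h3.append_right _⟩, .eq⟩
    | head h1 h2 h3 =>
      exact ⟨(_, _), ⟨_, .here (not_lt.2 h1), h3⟩,
        .pop (Step.head_le (fun d hd => hX.le_dec hd) h1 h2 h3)⟩
    | deep h1 h2 h3 =>
      have hb := h1.trans_le h2.le
      refine ⟨(_, _), ⟨_, .there h1 h2,
        Bump.at_end (R := (· ≥ ·)) h3 (not_le.2 ((hX.lt_inc List.mem_cons_self).trans hb)) _⟩,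
        .pop fun d hd => ?_⟩
      rcases List.mem_append.1 hd with h | h
      · exact hb.le.trans (h3 d h)
      · rw [List.mem_singleton.1 h]; exact hb.le
  | pop hD =>
    rcases hp with hp | ⟨hp, rfl⟩
    · obtain ⟨h3, -⟩ := Prod.mk.injEq .. ▸ hp
      simp at h3
    · cases h with
      | bulk h1 h2 h3 =>
        refine ⟨(_, _), ⟨_, .there h1 h2, h3⟩, .pop fun d hd => ?_⟩
        rcases h3.mem_of_mem_new hd with rfl | h
        · exact (h1.trans_le h2.le).le
        · exact hD d h

theorem Lag.eq' (X : HookRow α) : Lag X (X.dec ++ [X.mid], X.inc) := .eq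

theorem Lag.of_false {X X' : HookRow α} {Y' : List α × List α} {a c : α}
    (h : Step X a c X' false) (h' : Pure (X.dec ++ [X.mid], X.inc) a c Y') :
    Y' = (X'.dec ++ [X'.mid], X'.inc) := by
  cases h with
  | bulk h1 h2 h3 =>
    obtain ⟨b, h4, h5⟩ := h'
    obtain ⟨rfl, h6⟩ := h2.det h4
    obtain ⟨_, h7⟩ := (h3.append_right _).det h5
    exact Prod.ext h7.symm h6.symm

/-- If the first insertion does not move the middle element, then exchanging the first two letters
of `s p q` with `p < q ≤ s` results in a Knuth move of the bumped letters. -/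
theorem Step.knuth_left {X X₁ X₂ X₃ : HookRow α} {p q s c₁ c₂ c₃ : α} {f f' : Bool}
    (hX : X.Valid) (h1 : Step X s c₁ X₁ false) (h2 : Step X₁ p c₂ X₂ f) (h3 : Step X₂ q c₃ X₃ f')
    (hpq : p < q) (hqs : q ≤ s) :
    ∃ d₁ d₂ d₃ Z₁ Z₂ g g', Step X p d₁ Z₁ g ∧ Step Z₁ s d₂ Z₂ false ∧ Step Z₂ q d₃ X₃ g' ∧
      KnuthRel (· < ·) (c₁, c₂, c₃) (d₁, d₂, d₃) ∧ g.toNat + g'.toNat = f.toNat := by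
  have hX1 := h1.valid hX
  have hX2 := h2.valid hX1
  have hX3 := h3.valid hX2
  have hf' := (h2.asc hX1 h3 hpq).1
  subst hf'
  obtain ⟨Y1, k1, l1⟩ := h1.pure hX (.eq' X) (Or.inl rfl)
  obtain rfl := Lag.of_false h1 k1
  obtain ⟨Y2, k2, l2⟩ := h2.pure hX1 l1 (Or.inl rfl)
  obtain ⟨Y3, k3, l3⟩ := h3.pure hX2 l2 (Or.inr ⟨h2.mid_le.trans_lt hpq, rfl⟩)
  -- After `p` the pair may lag, but `p < q ≤ s` bounds the middle element below both remaining
  -- letters, so the exchanged word can be translated back step by step.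
  obtain ⟨d1, d2, d3, Z1, Z2, m1, m2, m3, hk⟩ := Pure.knuth (b₁ := p) (b₂ := s) (b₃ := q)
    hX.dec hX.inc_sorted k1 k2 k3 (Or.inr (.left hpq (not_lt.2 hqs)))
  obtain ⟨g, W1, n1, o1⟩ := m1.step hX (.eq' X) (Or.inl rfl)
  have hW1 := n1.valid hX
  have hps := hpq.trans_le hqs
  obtain ⟨g1, W2, n2, o2⟩ := m2.step hW1 o1 (Or.inr (n1.mid_le.trans_lt hps))
  have hW2 := n2.valid hW1
  have hg1 := (n1.asc hX n2 hps).1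
  subst hg1
  obtain ⟨g2, W3, n3, o3⟩ := m3.step hW2 o2
    (Or.inr (n2.mid_eq.trans_le n1.mid_le |>.trans_lt hpq))
  obtain rfl := Lag.unique hX3 (n3.valid hW2) l3 o3
  refine ⟨_, _, _, _, _, _, _, n1, n2, n3, hk, ?_⟩
  -- Each flag lengthens the decreasing part by one, and both runs end in the same row, so they
  -- raise equally many flags.
  have e1 := h1.length_dec
  have e2 := h2.length_dec
  have e3 := h3.length_dec
  have e4 := n1.length_dec
  have e5 := n2.length_dec
  have e6 := n3.length_dec
  simp only [Bool.toNat_false] at *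
  omega

/-- If the first insertion does not move the middle element, then exchanging the last two letters
of `q p s` with `p ≤ q < s` results in a Knuth move of the bumped letters. -/
theorem Step.knuth_right {X X₁ X₂ X₃ : HookRow α} {p q s c₁ c₂ c₃ : α} {f f' : Bool}
    (hX : X.Valid) (h1 : Step X q c₁ X₁ false) (h2 : Step X₁ p c₂ X₂ f) (h3 : Step X₂ s c₃ X₃ f')
    (hpq : p ≤ q) (hqs : q < s) :
    ∃ d₂ d₃ Z, Step X₁ s d₂ Z false ∧ Step Z p d₃ X₃ f ∧
      KnuthRel (· < ·) (c₁, c₂, c₃) (c₁, d₂, d₃) := by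
  have hX1 := h1.valid hX
  have hX2 := h2.valid hX1
  have hX3 := h3.valid hX2
  have hps := hpq.trans_lt hqs
  have hf' := (h2.asc hX1 h3 hps).1
  subst hf'
  obtain ⟨Y1, k1, l1⟩ := h1.pure hX (.eq' X) (Or.inl rfl)
  obtain rfl := Lag.of_false h1 k1
  obtain ⟨Y2, k2, l2⟩ := h2.pure hX1 l1 (Or.inl rfl)
  obtain ⟨Y3, k3, l3⟩ := h3.pure hX2 l2 (Or.inr ⟨h2.mid_le.trans_lt hps, rfl⟩)
  obtain ⟨d1, d2, d3, Z1, Z2, m1, m2, m3, hk⟩ := Pure.knuth (b₁ := q) (b₂ := s) (b₃ := p)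
    hX.dec hX.inc_sorted k1 k2 k3 (Or.inl (.right (not_lt.2 hpq) hqs))
  obtain ⟨g, W1, n1, o1⟩ := m1.step hX (.eq' X) (Or.inl rfl)
  obtain ⟨rfl, rfl, rfl⟩ := n1.det hX h1
  obtain rfl := Lag.of_false h1 m1
  obtain ⟨g1, W2, n2, o2⟩ := m2.step hX1 l1 (Or.inl rfl)
  have hW2 := n2.valid hX1
  have hg1 := (h1.asc hX n2 hqs).1
  subst hg1
  obtain rfl := Lag.of_false n2 m2
  obtain ⟨g2, W3, n3, o3⟩ := m3.step hW2 o2 (Or.inl rfl)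
  obtain rfl := Lag.unique hX3 (n3.valid hW2) l3 o3
  have e2 := h2.length_dec
  have e3 := h3.length_dec
  have e5 := n2.length_dec
  have e6 := n3.length_dec
  have : g2 = f := by
    simp only [Bool.toNat_false] at *
    cases g2 <;> cases f <;> simp at * <;> omega
  subst this
  exact ⟨_, _, _, n2, n3, hk⟩

end Triples
end DecompTab

namespace DecompTab
-- Exchanges when the first letter already moves the middle, where a fourth letter is needed.
section DoubleShift

variable {α : Type*} [LinearOrder α]

theorem Step.mem {X X' : HookRow α} {a c : α} {f : Bool} (h : Step X a c X' f) :
    a = X'.mid ∨ a ∈ X'.inc := by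
  cases h with
  | bulk h1 h2 h3 => exact Or.inr h2.mem_new
  | head h1 h2 h3 => exact Or.inl rfl
  | deep h1 h2 h3 => exact Or.inr h2.mem_new

/-- Since `b < y`, the letter `y` acts strictly to the right of the box changed by `x`, and the two
bumps do not interact. -/
theorem Bump.comm_of_lt {x y b c : α} {l l₁ l₂ : List α} (h1 : Bump (· < ·) x l b l₁)
    (h2 : Bump (· < ·) y l₁ c l₂) (h : b < y) :
    ∃ k, Bump (· < ·) y l c k ∧ Bump (· < ·) x k b l₂ := by
  induction h1 generalizing c l₂ with
  | here h3 =>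
    have hxy := (not_lt.1 h3).trans_lt h
    cases h2 with
    | here h4 => exact absurd hxy h4
    | there _ h4 => exact ⟨_, .there h h4, .here h3⟩
  | there h3 h3' ih =>
    have hxy := h3.trans (h3'.le.trans_lt h)
    cases h2 with
    | here h4 => exact absurd hxy h4
    | there _ h4 =>
      obtain ⟨k, h5, h6⟩ := ih h4 h
      exact ⟨_, .there hxy h5, .there h3 h6⟩

theorem forall_concat_le {l : List α} {a b : α} (h : ∀ x ∈ l, a ≤ x) (hb : a ≤ b) :
    ∀ x ∈ l ++ [b], a ≤ x := by
  intro x hx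
  rcases List.mem_append.1 hx with hx | hx
  · exact h x hx
  · rw [List.mem_singleton.1 hx]; exact hb

theorem Bump.forall_le {a b e : α} {R : α → α → Prop} {l l' : List α} (h : Bump R a l b l')
    (hl : ∀ x ∈ l, e ≤ x) (ha : e ≤ a) : ∀ x ∈ l', e ≤ x := by
  intro x hx
  rcases h.mem_of_mem_new hx with rfl | hx
  · exact ha
  · exact hl x hx

/-- After exchanging `p` and `s` the rows may differ until `t` is inserted. When `p` acts by `head`,
the three letters leaving the increasing part form Knuth related triples, and Knuth's lemma is
applied to the decreasing part extended by the middle elements. When `p` acts by `deep`, the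
insertions of `p` and `s` commute. -/
theorem Step.double_right {X X₁ X₂ X₃ X₄ : HookRow α} {p q s t c₀ c₁ c₂ c₃ : α} {f : Bool}
    (hX : X.Valid) (h0 : Step X q c₀ X₁ true) (h1 : Step X₁ p c₁ X₂ true)
    (h2 : Step X₂ s c₂ X₃ false) (h3 : Step X₃ t c₃ X₄ f) (htp : t ≤ p) (hpq : p ≤ q)
    (hqs : q < s) :
    f = true ∧ ∃ d₁ d₂ d₃ Z₂ Z₃, Step X₁ s d₁ Z₂ false ∧ Step Z₂ p d₂ Z₃ true ∧
      Step Z₃ t d₃ X₄ true ∧ KnuthRel (· < ·) (c₁, c₂, c₃) (d₁, d₂, d₃) := by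
  have hX1 := h0.valid hX
  have hX2 := h1.valid hX1
  have hX3 := h2.valid hX2
  have hs : ∀ {x}, x ∈ X₁.inc → s ≤ x → ∃ d Z, Step X₁ s d Z false := by
    intro x hx hsx
    obtain ⟨d, Z, g, h⟩ := Step.exists_of_le hX1 hx hsx
    obtain rfl := (h0.asc hX h hqs).1
    exact ⟨d, Z, h⟩
  have hmem := h0.mem
  have h23 := h2.desc_false hX2 h3 (htp.trans (hpq.trans hqs.le))
  cases h1 with
  | @head D I0 D1 y i1 _ _ k1 k2 k3 =>
    have hy1 : y < i1 := hX1.lt_inc (i := i1) (by simp)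
    have hi1 := (List.pairwise_cons.1 hX1.inc_sorted).1
    cases h2 with
    | @bulk _ _ D2 I0' _ _ b _ k4 k5 k6 =>
      cases h3 with
      | bulk k7 _ _ => exact absurd k7 (not_lt.2 htp)
      | deep k7 _ _ =>
        exact absurd (k7.trans_le htp) (not_lt.2 (hX3.lt_inc List.mem_cons_self).le)
      | @head _ I1 D3 _ k _ _ k7 k8 k9 =>
        refine ⟨rfl, ?_⟩
        have hpk : p < k := hX3.lt_inc (i := k) (by simp)
        have hE : Bump3 (· ≥ ·) (i1, b, k) (D ++ [y] ++ [p]) (c₁, c₂, c₃) D3 :=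
          ⟨_, _, k3.append_right _, k6.append_right _, k9⟩
        -- Knuth's lemma needs this list to be decreasing, which holds exactly when `p ≤ y`; the
        -- other case is treated by hand.
        have hEs : (D ++ [y] ++ [p]).Pairwise (· ≥ ·) ∨ ¬ p ≤ y := by
          by_cases hpy : p ≤ y
          · exact Or.inl (pairwise_concat.2 ⟨hX1.dec,
              forall_concat_le (fun x hx => hpy.trans (hX1.le_dec hx)) hpy⟩)
          · exact Or.inr hpy
        by_cases hsi : s ≤ i1
        · obtain ⟨d1, Z, hZ⟩ := hs (List.mem_cons_self) hsi
          cases hZ with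
          | @bulk _ _ D'' I' _ _ b' _ l1 l2 l3 =>
            obtain ⟨rfl, rfl⟩ := l2.det (.here (not_lt.2 hsi))
            have hpy : p ≤ y := by
              rcases k2 with h | h
              · exact h
              · exact absurd (h _ l3.mem_old) (not_le.2 l3.lt)
            have hEs' := hEs.resolve_right (not_not.2 hpy)
            cases k5 with
            | there k5 _ =>
              exact absurd (hi1 k (by simp)) (not_lt.2 (k5.le.trans hsi))
            | here k5 =>
              obtain ⟨⟨d1', d2, d3⟩, ⟨E1, E2, n1, n2, n3⟩, hk⟩ := Bump3.knuthMove
                ge_trans'' not_ge_trans (v := (b', s, b)) hEs' hE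
                (knuthRel_ge_iff.2 (Or.inr (.right (not_lt.2 hsi) (hi1 b (by simp)))))
              dsimp only at n1 n2 n3
              obtain ⟨rfl, rfl⟩ := n1.det ((l3.append_right [y]).append_right [p])
              obtain ⟨D2', n4, rfl⟩ := n2.dec_append_of_lt (x := y) (by simp) l1
              exact ⟨_, _, _, _, _, .bulk l1 l2 l3, .head (hpq.trans hqs.le) (Or.inl hpy) n4,
                .head (htp.trans (k4.le.trans (not_lt.1 k5))) (Or.inl htp) n3,
                knuthRel_ge_iff.1 hk⟩
        · rw [not_le] at hsi
          have hb := k5.le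
          obtain ⟨d1, Z, hZ⟩ := hs (List.mem_cons_of_mem _ k5.mem_old) hb
          cases hZ with
          | @bulk _ _ D'' I' _ _ b' _ l1 l2 l3 =>
            obtain ⟨rfl, rfl⟩ := l2.det (.there hsi k5)
            have hks : k ≤ s := by
              have := List.pairwise_cons.1 hX3.inc_sorted
              rcases List.mem_cons.1 k5.mem_new with h | h
              · exact h.ge
              · exact (this.1 _ h).le
            have hik : i1 < k := by
              rcases k5.mem_of_mem_new (x := k) (by simp) with h | h
              · rw [h]; exact hsi
              · exact hi1 _ h
            have hEs' : (D ++ [y] ++ [p]).Pairwise (· ≥ ·) ∨ ¬ p ≤ y := hEs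
            have key : ∃ d₁ d₂ d₃ E1 E2, Bump (· ≥ ·) b' (D ++ [y] ++ [p]) d₁ E1 ∧
                Bump (· ≥ ·) i1 E1 d₂ E2 ∧ Bump (· ≥ ·) k E2 d₃ D3 ∧
                KnuthRel (· < ·) (c₁, c₂, c₃) (d₁, d₂, d₃) := by
              by_cases hpy : p ≤ y
              · obtain ⟨⟨d1', d2, d3⟩, ⟨E1, E2, n1, n2, n3⟩, hk⟩ := Bump3.knuthMove
                  ge_trans'' not_ge_trans (v := (b', i1, k)) (hEs.resolve_right (not_not.2 hpy)) hE
                  (knuthRel_ge_iff.2 (Or.inl (.left hik (not_lt.2 (hks.trans hb)))))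
                exact ⟨_, _, _, _, _, n1, n2, n3, knuthRel_ge_iff.1 hk⟩
              · have hDi := k2.resolve_left hpy
                obtain ⟨rfl, rfl⟩ := k3.dec_append_of_le hDi
                obtain ⟨rfl, rfl⟩ := k6.det (l3.append_right [i1])
                have hD'' := l3.forall_le hDi (hsi.le.trans hb)
                obtain ⟨M, n1, -⟩ := k9.dec_append_of_lt (x := i1) (by simp) hik
                refine ⟨_, _, _, _, _, (l3.append_right [c₁]).append_right [p],
                  (Bump.at_end (R := (· ≥ ·)) hD'' (not_le.2 hy1) []).append_right [p], k9,
                  Or.inl (.left (hy1.trans_le ?_) (not_lt.2 h23))⟩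
                exact forall_concat_le hD'' le_rfl _ n1.mem_old
            obtain ⟨d1', d2, d3, E1, E2, n1, n2, n3, hk⟩ := key
            obtain ⟨rfl, rfl⟩ := n1.det ((l3.append_right [y]).append_right [p])
            obtain ⟨D2', n4, rfl⟩ := n2.dec_append_of_lt (x := y) (by simp) hy1
            exact ⟨_, _, _, _, _, .bulk l1 l2 l3,
              .head k1 (k2.imp_right fun h => l3.forall_le h (hsi.le.trans hb)) n4,
              .head k7 (Or.inl htp) n3, hk⟩
  | @deep D I0 J _ i1 _ b1 k1 k2 k3 =>
    cases h2 with
    | @bulk _ _ D2 J' _ _ bs _ k4 k5 k6 =>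
      have hq : q ∈ I0 := by
        rcases hmem with h | h
        · have h4 : c₁ < i1 := hX1.lt_inc (i := i1) (by simp)
          subst h
          exact absurd (k1.trans_le hpq) (not_lt.2 h4.le)
        · rcases List.mem_cons.1 h with rfl | h
          · exact absurd k1 (not_lt.2 hpq)
          · exact h
      have hb1 : b1 ≤ q := k2.le_inc hX1.inc_sorted.of_cons hq hpq
      have hps := hpq.trans_lt hqs
      obtain ⟨K, l1, l2⟩ := k2.comm_of_lt k5 (hb1.trans_lt hqs)
      obtain ⟨d1, Z, hZ⟩ := hs (List.mem_cons_of_mem _ l1.mem_old) l1.le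
      cases hZ with
      | @bulk _ _ D' I' _ _ b' _ l3 l4 l5 =>
        obtain ⟨rfl, rfl⟩ := l4.det (.there k4 l1)
        obtain ⟨rfl, rfl⟩ := k6.det (l5.append_right [b1])
        have n1 := Step.deep (m := c₁) k1 l2
          (l5.forall_le k3 (hb1.trans (hqs.le.trans l1.le)))
        have hZ2 := (Step.bulk l3 l4 l5).valid hX1
        obtain ⟨rfl, h13⟩ := n1.desc_true hZ2 h3 htp
        exact ⟨rfl, _, _, _, _, _, .bulk l3 l4 l5, n1, h3, Or.inl (.left h13 (not_lt.2 h23))⟩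

/-- Both orders bump the same first letter, and the other three undergo an exchange. The rows may
differ until `t` is inserted; its comparison with `q` guarantees a further shift of the middle. -/
theorem Step.double_left {X X₁ X₂ X₃ X₄ : HookRow α} {p q s t c₀ c₁ c₂ c₃ : α} {f : Bool}
    (hX : X.Valid) (h0 : Step X s c₀ X₁ true) (h1 : Step X₁ p c₁ X₂ true)
    (h2 : Step X₂ q c₂ X₃ false) (h3 : Step X₃ t c₃ X₄ f) (hpq : p < q) (hqs : q ≤ s)
    (htq : t ≤ q) :
    f = true ∧ ∃ d₁ d₂ d₃ Z₁ Z₂ Z₃, Step X p c₀ Z₁ true ∧ Step Z₁ s d₁ Z₂ false ∧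
      Step Z₂ q d₂ Z₃ true ∧ Step Z₃ t d₃ X₄ true ∧
      ((d₁ = c₁ ∧ d₂ = c₃ ∧ d₃ = c₂ ∧ c₃ ≤ c₁) ∨ (d₁ = c₂ ∧ d₂ = c₁ ∧ d₃ = c₃)) := by
  have hX1 := h0.valid hX
  have hX2 := h1.valid hX1
  have hX3 := h2.valid hX2
  have hps := hpq.trans_le hqs
  cases h0 with
  | @head D I D1 m i1 _ _ k1 k2 k3 =>
    have hD1 := Step.head_le (fun d hd => hX.le_dec hd) k1 k2 k3
    have hi1 := (List.pairwise_cons.1 hX.inc_sorted).1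
    cases h1 with
    | @deep _ _ _ _ i2 _ _ h =>
      exact absurd (h.trans hps) (not_lt.2 (hX1.lt_inc (i := i2) (by simp)).le)
    | @head _ I2 D2 _ i2 _ _ k4 k5 k6 =>
      have hi12 := hi1 i2 (by simp)
      have hi2 := (List.pairwise_cons.1 hX1.inc_sorted).1
      have hsi2 : s < i2 := hX1.lt_inc (i := i2) (by simp)
      obtain ⟨D1', k7, rfl⟩ := k6.dec_append_of_lt k3.mem_new hi12
      have hD1' := k7.forall_le hD1 hsi2.le
      cases h2 with
      | @bulk _ _ D3 I2' _ _ i3 _ k8 k9 k10 =>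
        cases k9 with
        | @there e _ _ _ h _ =>
          exact absurd (h.trans_le hqs) (not_lt.2 (hsi2.trans (hi2 e (by simp))).le)
        | @here _ I3 hq3 =>
          have hi23 := hi2 i3 (by simp)
          obtain ⟨D1'', k11, rfl⟩ := k10.dec_append_of_lt k7.mem_new hi23
          have hD3 : ∀ d ∈ D1'' ++ [s], q ≤ d := forall_concat_le
            (fun d hd => hqs.trans (k11.forall_le hD1' (hsi2.trans hi23).le d hd)) hqs
          cases h3 with
          | bulk _ k12 k13 =>
            obtain ⟨rfl, rfl⟩ := k12.det (.here (not_lt.2 htq))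
            exact absurd (hD3 _ k13.mem_old) (not_le.2 k13.lt)
          | deep h => exact absurd h (not_lt.2 htq)
          | head k12 k13 k14 =>
            obtain ⟨rfl, rfl⟩ := k14.dec_append_of_le hD3
            exact ⟨rfl, _, _, _, _, _, _, .head (hps.le.trans k1) (k2.imp_left hps.le.trans) k3,
              .bulk hps (.here (not_lt.2 hsi2.le)) k7,
              .head hqs (Or.inr hD1') (Bump.at_end (R := (· ≥ ·)) hD1' (not_le.2 hps) []),
              .head (htq.trans (not_lt.1 hq3)) (Or.inl htq)
                ((k11.append_right [s]).append_right [q]),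
              Or.inl ⟨rfl, rfl, rfl, hps.le.trans (hD1 _ k7.mem_old)⟩⟩
  | @deep D I0 I0' _ i1 _ b k1 k2 k3 =>
    have hci : c₀ < i1 := hX.lt_inc (i := i1) (by simp)
    have hI0 := hX.inc_sorted.of_cons
    have hi1 : ∀ d ∈ D, i1 ≤ d := fun d hd => (k1.trans_le k2.le).le.trans (k3 d hd)
    by_cases hpi : p ≤ i1
    · cases h1 with
      | @deep _ _ _ _ h _ _ hh =>
        exact absurd (hh.trans_le hpi) (not_lt.2 (hX1.lt_inc (i := h) (by simp)).le)
      | @head _ I1 D2 _ h _ _ k4 k5 k6 =>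
        have hh := (List.pairwise_cons.1 hX1.inc_sorted).1
        have hhs : h ≤ s := by
          rcases List.mem_cons.1 k2.mem_new with h | h
          · exact h.ge
          · exact (hh _ h).le
        have hDh : ∀ d ∈ D ++ [b], h ≤ d := forall_concat_le
          (fun d hd => hhs.trans (k2.le.trans (k3 d hd))) (hhs.trans k2.le)
        obtain ⟨rfl, rfl⟩ := k6.dec_append_of_le hDh
        have hph := hpi.trans_lt (hX1.lt_inc (i := h) (by simp))
        have n1 : Step ⟨D, c₀, c₁ :: I0⟩ p c₀ ⟨D ++ [c₁], p, I0⟩ true :=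
          .head hpi (Or.inr hi1) (Bump.at_end (R := (· ≥ ·)) hi1 (not_le.2 hci) [])
        have n2 : Step ⟨D ++ [c₁], p, I0⟩ s c₁ ⟨D ++ [b], p, h :: I1⟩ false :=
          .bulk hps k2 (Bump.at_end (R := (· ≥ ·)) k3 (not_le.2 (k1.trans_le k2.le)) [])
        cases h2 with
        | @bulk _ _ D3 I1' _ _ g _ k7 k8 k9 =>
          by_cases hqh : q ≤ h
          · cases k8 with
            | @there e _ _ _ h _ => exact absurd (h.trans_le hqh) (not_lt.2 (hh e (by simp)).le)
            | @here g I2 _ =>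
              have hhg := hh g (by simp)
              have hD3 : ∀ d ∈ D3, q ≤ d := fun d hd =>
                hqh.trans (k9.forall_le (forall_concat_le hDh le_rfl) hhg.le d hd)
              cases h3 with
              | bulk _ k12 k13 =>
                obtain ⟨rfl, rfl⟩ := k12.det (.here (not_lt.2 htq))
                exact absurd (hD3 _ k13.mem_old) (not_le.2 k13.lt)
              | deep h => exact absurd h (not_lt.2 htq)
              | head k12 k13 k14 =>
                obtain ⟨rfl, rfl⟩ := k14.dec_append_of_le hD3
                exact ⟨rfl, _, _, _, _, _, _, n1, n2,
                  .head hqh (Or.inr hDh) (Bump.at_end (R := (· ≥ ·)) hDh (not_le.2 hph) []),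
                  .head (htq.trans (hqh.trans hhg.le)) (Or.inl htq) (k9.append_right [q]),
                  Or.inl ⟨rfl, rfl, rfl, hpi⟩⟩
          · rw [not_le] at hqh
            have hs1 : s ∈ I1 := by
              rcases List.mem_cons.1 k2.mem_new with h | h
              · exact absurd (hqh.trans_le hqs) (not_lt.2 h.le)
              · exact h
            have hgs : g ≤ s := k8.le_inc hX2.inc_sorted hs1 hqs
            have hDg : ∀ d ∈ D ++ [b], g ≤ d := forall_concat_le
              (fun d hd => hgs.trans (k2.le.trans (k3 d hd))) (hgs.trans k2.le)
            have hDg' := forall_concat_le hDg (le_refl g)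
            obtain ⟨rfl, rfl⟩ := k9.dec_append_of_le hDg
            have n3 : Step ⟨D ++ [b], p, c₂ :: I1⟩ q p ⟨D ++ [b] ++ [g], c₂, I1'⟩ true :=
              .deep hqh k8 hDg
            cases h3 with
            | bulk _ k12 k13 =>
              have := k8.inc_le_of_le hX2.inc_sorted k12 htq
              exact absurd (this.trans (hDg' _ k13.mem_old)) (not_le.2 k13.lt)
            | @head _ I2 D4 _ e _ _ k12 k13 k14 =>
              have heg : e ≤ g := k8.inc_le_of_le hX2.inc_sorted (.here (not_lt.2 k12)) htq
              have hDe : ∀ d ∈ D ++ [b] ++ [g], e ≤ d := fun d hd => heg.trans (hDg' d hd)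
              have hhe : c₂ < e := by
                rcases k8.mem_of_mem_new (x := e) (by simp) with rfl | h
                · exact hqh
                · exact hh _ h
              obtain ⟨rfl, rfl⟩ := k14.dec_append_of_le hDe
              exact ⟨rfl, _, _, _, _, _, _, n1, n2, n3, .head k12 (Or.inr hDe)
                (Bump.at_end (R := (· ≥ ·)) hDe (not_le.2 hhe) []), Or.inl ⟨rfl, rfl, rfl, hpi⟩⟩
            | deep k12 k13 k14 =>
              exact ⟨rfl, _, _, _, _, _, _, n1, n2, n3, .deep k12 k13 k14,
                Or.inl ⟨rfl, rfl, rfl, hpi⟩⟩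
    · rw [not_le] at hpi
      obtain ⟨⟨E2, J⟩, ⟨b2, k4, k5⟩, hl2⟩ := h1.pure hX1 (.eq' _) (Or.inl rfl)
      obtain ⟨⟨D3, J3⟩, ⟨b3, k6, k7⟩, hl3⟩ :=
        h2.pure hX2 hl2 (Or.inr ⟨h1.mid_le.trans_lt hpq, rfl⟩)
      dsimp only at k4 k5 k6 k7
      have hb2 : b2 ≤ b := k2.inc_le_of_le hI0 k4 hps.le
      have hb23 : b2 < b3 := k4.inc_lt_of_lt (k2.inc_sorted hI0) k6 hpq
      have hib2 : i1 < b2 := hpi.trans_le k4.le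
      have hDb : ∀ d ∈ D ++ [b], b ≤ d := forall_concat_le k3 le_rfl
      have hDb2 : ∀ d ∈ D ++ [b], b2 ≤ d := fun d hd => hb2.trans (hDb d hd)
      obtain ⟨rfl, rfl⟩ := k5.dec_append_of_le hDb2
      obtain ⟨⟨e1, e2, e3⟩, ⟨J1, J2, n1, n2, n3⟩, hk⟩ := Bump3.knuthMove lt_trans' not_lt_trans
        (v := (p, s, q)) hI0 (w := (b, b2, b3)) ⟨_, _, k2, k4, k6⟩
        (Or.inr (.left hpq (not_lt.2 hqs)))
      dsimp only at n1 n2 n3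
      have key : e1 ≤ b ∧ ∃ D', D'.length = D.length + 1 ∧ Bump (· ≥ ·) e2 (D ++ [e1]) c₂ D' ∧
          Bump (· ≥ ·) e3 (D' ++ [c₁]) c₁ D3 := by
        rcases hk with hk | hk
        · cases hk with
          | left h1 h2 => exact absurd hb23 h2
          | right h1 h2 =>
            obtain ⟨D', m1, rfl⟩ := k7.dec_append_of_lt (x := b) (by simp) h2
            exact ⟨le_rfl, D', by simpa using m1.length_eq, m1, Bump.at_end (R := (· ≥ ·))
              (m1.forall_le hDb2 (hb2.trans h2.le)) (not_le.2 hib2) []⟩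
        · cases hk with
          | right h1 h2 => exact absurd h2 (not_lt.2 hb2)
          | left h1 h2 =>
            rw [not_lt] at h2
            have hDb3 : ∀ d ∈ D ++ [b], b3 ≤ d := fun d hd => h2.trans (hDb d hd)
            obtain ⟨rfl, rfl⟩ := k7.dec_append_of_le hDb3
            exact ⟨hb2, D ++ [b], by simp,
              Bump.at_end (R := (· ≥ ·)) k3 (not_le.2 (h1.trans_le h2)) [],
              Bump.at_end (R := (· ≥ ·)) hDb3 (not_le.2 (hib2.trans h1)) []⟩
      obtain ⟨he, D', hlen, m1, m2⟩ := key
      have o1 := Step.deep (m := c₀) hpi n1 fun d hd => he.trans (k3 d hd)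
      have o2 := Step.bulk k1 n2 m1
      have hZ2 := o2.valid (o1.valid hX)
      obtain ⟨g, Z3, o3, hl3'⟩ := Pure.step (c := c₁) (Y' := (D3, J3)) hZ2 (.eq' _)
        ⟨_, n3, m2⟩ (Or.inl rfl)
      obtain rfl := Lag.unique hX3 (o3.valid hZ2) hl3 hl3'
      -- The lengths of the decreasing parts force the flag of the exchanged third step, since the
      -- two runs agree before `t`.
      have e1 := h1.length_dec
      have e2 := h2.length_dec
      have e3 := o3.length_dec
      simp only [List.length_append, List.length_singleton, Bool.toNat_false, Bool.toNat_true,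
        hlen] at e1 e2 e3
      have hg : g = true := by
        cases g
        · simp only [Bool.toNat_false] at e3; omega
        · rfl
      subst hg
      obtain rfl := (o3.desc_true hZ2 h3 htq).1
      exact ⟨rfl, _, _, _, _, _, _, o1, o2, o3, h3, Or.inr ⟨rfl, rfl, rfl⟩⟩

end DoubleShift
end DecompTab

namespace DecompTab
-- Elementary moves on four primed letters are stable under insertion into a row.
section Moves

variable {α : Type*} [LinearOrder α]

/-- Successive insertion of the letters of a word into a row, each bumping a letter. The booleans
are the primes on the letters and on the middle element of the row. -/
inductive Run : HookRow α → Bool → List (α × Bool) → HookRow α → Bool → List (α × Bool) → Prop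
  | nil {X : HookRow α} {β : Bool} : Run X β [] X β []
  | cons {X X₁ X' : HookRow α} {β β' x f : Bool} {a c : α} {u v : List (α × Bool)} :
      Step X a c X₁ f → Run X₁ (bif f then x else β) u X' β' v →
      Run X β ((a, x) :: u) X' β' ((c, bif f then β else x) :: v)

/-- The elementary moves on primed words of length four which preserve the result of
decomposition insertion; the letters are listed in the order of insertion. -/
inductive Move : List (α × Bool) → List (α × Bool) → Prop
  -- The names `Left` and `Right` refer to the exchanges of `s p q` with `p s q` (`p < q ≤ s`) and
  -- of `q p s` with `q s p` (`p ≤ q < s`); the letter `t` stands in front in the first three moves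
  -- and behind in the last two. Only the primes `a` and `b` matter, and they may change owner;
  -- `x₁`, `x₂`, `y₁`, `y₂` are free.
  | ascLeft {p q s t : α} {a b x₁ x₂ y₁ y₂ : Bool} : t < p → p < q → q ≤ s →
      Move [(t, a), (s, x₁), (p, b), (q, x₂)] [(t, a), (p, y₁), (s, y₂), (q, b)]
  | midLeft {p q s t : α} {a b x₁ x₂ y₁ y₂ : Bool} : p ≤ t → t < s → p < q → q ≤ s →
      Move [(t, b), (s, x₁), (p, a), (q, x₂)] [(t, y₁), (p, a), (s, y₂), (q, b)]
  | ascRight {p q s t : α} {a b x₁ x₂ y₁ y₂ : Bool} : t < q → p ≤ q → q < s →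
      Move [(t, a), (q, x₁), (p, b), (s, x₂)] [(t, a), (q, y₁), (s, y₂), (p, b)]
  | descLeft {p q s t : α} {a b x₁ x₂ y₁ y₂ : Bool} : t ≤ q → p < q → q ≤ s →
      Move [(s, x₁), (p, a), (q, x₂), (t, b)] [(p, a), (s, y₁), (q, y₂), (t, b)]
  | descRight {p q s t : α} {a b x₁ x₂ y₁ y₂ : Bool} : t ≤ p → p ≤ q → q < s →
      Move [(q, x₁), (p, a), (s, x₂), (t, b)] [(q, a), (s, y₁), (p, y₂), (t, b)]

theorem KnuthRel.cases {c₁ c₂ c₃ d₁ d₂ d₃ : α}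
    (h : KnuthRel (· < ·) (c₁, c₂, c₃) (d₁, d₂, d₃)) :
    (c₁ < c₃ ∧ c₃ ≤ c₂ ∧ d₁ = c₂ ∧ d₂ = c₁ ∧ d₃ = c₃) ∨
      (c₂ ≤ c₁ ∧ c₁ < c₃ ∧ d₁ = c₁ ∧ d₂ = c₃ ∧ d₃ = c₂) ∨
      (c₂ < c₃ ∧ c₃ ≤ c₁ ∧ d₁ = c₂ ∧ d₂ = c₁ ∧ d₃ = c₃) ∨
      (c₃ ≤ c₁ ∧ c₁ < c₂ ∧ d₁ = c₁ ∧ d₂ = c₃ ∧ d₃ = c₂) := by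
  rcases h with h | h
  · cases h with
    | left h1 h2 => exact Or.inl ⟨h1, not_lt.1 h2, rfl, rfl, rfl⟩
    | right h1 h2 => exact Or.inr (Or.inl ⟨not_lt.1 h1, h2, rfl, rfl, rfl⟩)
  · cases h with
    | left h1 h2 => exact Or.inr (Or.inr (Or.inl ⟨h1, not_lt.1 h2, rfl, rfl, rfl⟩))
    | right h1 h2 => exact Or.inr (Or.inr (Or.inr ⟨not_lt.1 h1, h2, rfl, rfl, rfl⟩))

theorem Step.mem_of_false {X X' : HookRow α} {a c : α} (h : Step X a c X' false) :
    a ∈ X'.inc := by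
  cases h with
  | bulk h1 h2 h3 => exact h2.mem_new

/-- The letter `d` that `p` would bump right after `t` is smaller than the letter bumped by `s`, so
it survives the insertion of `s`. It is also smaller than every increasing entry that is at least
`p`, so it gives the letter sent up by `p` something to bump before the middle. -/
theorem Step.not_flag {X X₁ X₂ X₃ Z : HookRow α} {t s p c₀ c₁ c₂ d : α} (hX : X.Valid)
    (h0 : Step X t c₀ X₁ false) (h1 : Step X₁ s c₁ X₂ false) (h2 : Step X₁ p d Z false)
    (h3 : Step X₂ p c₂ X₃ true) (hpt : p ≤ t) (hts : t < s) : False := by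
  have hX1 := h0.valid hX
  have hX2 := h1.valid hX1
  have ht := h0.mem_of_false
  have key : ∃ e, t ≤ e ∧ e ≤ c₁ := by
    cases h0 with
    | bulk k1 k2 k3 =>
      cases h1 with
      | bulk l1 l2 l3 =>
        exact ⟨_, k2.le, l3.dec_le hX1.dec_sorted k3.mem_new (k2.inc_lt_of_lt hX.inc_sorted l2 hts)⟩
  obtain ⟨e, hte, hec⟩ := key
  cases h2 with
  | @bulk _ _ _ _ _ _ b _ k1 k2 k3 =>
    have hbt := k2.le_inc hX1.inc_sorted ht hpt
    have hdc : d < c₁ := k3.lt.trans_le (hbt.trans (hte.trans hec))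
    cases h1 with
    | @bulk _ _ _ I' _ _ _ _ l1 l2 l3 =>
      have hd := (l3.mem_of_mem_old k3.mem_old).resolve_left hdc.ne
      have hb : ∀ {i}, i ∈ I' → p ≤ i → d < i := by
        intro i hi hpi
        rcases l2.mem_of_mem_new hi with rfl | h
        · exact k3.lt.trans_le (hbt.trans hts.le)
        · exact k3.lt.trans_le (k2.le_inc hX1.inc_sorted h hpi)
      cases h3 with
      | head n1 n2 n3 =>
        rcases n2 with n2 | n2
        · exact absurd k1 (not_lt.2 n2)
        · exact absurd (n2 _ hd) (not_le.2 (hb (by simp) n1))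
      | deep n1 n2 n3 =>
        exact absurd (n3 _ hd) (not_le.2 (hb (List.mem_cons_of_mem _ n2.mem_old) n2.le))

/-- The comparisons in a move determine the flags up to a few cases, and the flags determine both
the order of the bumped letters and the transport of primes. In each case a free prime ends on a
bumped letter where it is again free. When the first letter of a `desc` move shifts the middle, the
output is an `asc` move read backwards; other shifts convert between `mid` and the remaining kinds.
-/
theorem Move.run {X X' : HookRow α} {β β' : Bool} {u u' v : List (α × Bool)} (hm : Move u u')
    (hX : X.Valid) (hr : Run X β u X' β' v) :
    ∃ v', Run X β u' X' β' v' ∧ (Move v v' ∨ Move v' v) := by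
  cases hm with
  | @ascLeft p q s t a b x₁ x₂ y₁ y₂ htp hpq hqs =>
    obtain _ | ⟨h0, _ | ⟨h1, _ | ⟨h2, _ | ⟨h3, ⟨⟩⟩⟩⟩⟩ := hr
    rename_i X1 f0 c0 X2 f1 c1 X3 f2 c2 f3 c3
    have hX1 := h0.valid hX
    have hX2 := h1.valid hX1
    have hX3 := h2.valid hX2
    obtain ⟨rfl, h01⟩ := h0.asc hX h1 (htp.trans (hpq.trans_le hqs))
    obtain ⟨rfl, h23⟩ := h2.asc hX2 h3 hpq
    have h21 := h1.desc_false hX1 h2 (hpq.le.trans hqs)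
    obtain ⟨d1, d2, d3, Z1, Z2, g, g', n1, n2, n3, hk, hg⟩ :=
      Step.knuth_left hX1 h1 h2 h3 hpq hqs
    obtain ⟨rfl, h04⟩ := h0.asc hX n1 htp
    have hg' : g' = f2 := by cases g' <;> cases f2 <;> simp at hg ⊢
    subst hg'
    refine ⟨_, .cons h0 (.cons n1 (.cons n2 (.cons n3 .nil))), ?_⟩
    rcases hk.cases with ⟨k1, k2, rfl, rfl, rfl⟩ | ⟨k1, k2, rfl, rfl, rfl⟩ |
      ⟨k1, k2, rfl, rfl, rfl⟩ | ⟨k1, k2, rfl, rfl, rfl⟩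
    · exact absurd (k1.trans_le k2) (not_lt.2 h21)
    · exact Or.inl (.ascRight h01 k1 k2)
    · exact Or.inl (.ascLeft h04 k1 k2)
    · exact absurd k2 (not_lt.2 h21)
  | @midLeft p q s t a b x₁ x₂ y₁ y₂ hpt hts hpq hqs =>
    obtain _ | ⟨h0, _ | ⟨h1, _ | ⟨h2, _ | ⟨h3, ⟨⟩⟩⟩⟩⟩ := hr
    rename_i X1 f0 c0 X2 f1 c1 X3 f2 c2 f3 c3
    have hX1 := h0.valid hX
    have hX2 := h1.valid hX1
    have hX3 := h2.valid hX2
    obtain ⟨rfl, h01⟩ := h0.asc hX h1 hts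
    obtain ⟨rfl, h23⟩ := h2.asc hX2 h3 hpq
    have h21 := h1.desc_false hX1 h2 (hpq.le.trans hqs)
    obtain ⟨d1, d2, d3, Z1, Z2, g, g', n1, n2, n3, hk, hg⟩ :=
      Step.knuth_left hX1 h1 h2 h3 hpq hqs
    cases f0 with
    | true =>
      obtain ⟨rfl, h04⟩ := h0.desc_true hX n1 hpt
      have hg' : g' = false ∧ f2 = true := by cases g' <;> cases f2 <;> simp at hg ⊢
      obtain ⟨rfl, rfl⟩ := hg'
      refine ⟨_, .cons h0 (.cons n1 (.cons n2 (.cons n3 .nil))), ?_⟩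
      rcases hk.cases with ⟨k1, k2, rfl, rfl, rfl⟩ | ⟨k1, k2, rfl, rfl, rfl⟩ |
        ⟨k1, k2, rfl, rfl, rfl⟩ | ⟨k1, k2, rfl, rfl, rfl⟩
      · exact absurd (k1.trans_le k2) (not_lt.2 h21)
      · exact Or.inl (.ascRight h01 k1 k2)
      · exact Or.inl (.ascLeft h04 k1 k2)
      · exact absurd k2 (not_lt.2 h21)
    | false =>
      have h40 := h0.desc_false hX n1 hpt
      have hg' : g = f2 ∧ g' = false := by
        cases g <;> cases g' <;> cases f2 <;> simp at hg ⊢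
        exact h0.not_flag hX h1 n1 h2 hpt hts
      obtain ⟨rfl, rfl⟩ := hg'
      refine ⟨_, .cons h0 (.cons n1 (.cons n2 (.cons n3 .nil))), ?_⟩
      rcases hk.cases with ⟨k1, k2, rfl, rfl, rfl⟩ | ⟨k1, k2, rfl, rfl, rfl⟩ |
        ⟨k1, k2, rfl, rfl, rfl⟩ | ⟨k1, k2, rfl, rfl, rfl⟩
      · exact absurd (k1.trans_le k2) (not_lt.2 h21)
      · exact absurd h01 (not_lt.2 h40)
      · exact Or.inl (.midLeft h40 h01 k1 k2)
      · exact absurd k2 (not_lt.2 h21)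
  | @ascRight p q s t a b x₁ x₂ y₁ y₂ htq hpq hqs =>
    obtain _ | ⟨h0, _ | ⟨h1, _ | ⟨h2, _ | ⟨h3, ⟨⟩⟩⟩⟩⟩ := hr
    rename_i X1 f0 c0 X2 f1 c1 X3 f2 c2 f3 c3
    have hX1 := h0.valid hX
    have hX2 := h1.valid hX1
    obtain ⟨rfl, h01⟩ := h0.asc hX h1 htq
    obtain ⟨rfl, h23⟩ := h2.asc hX2 h3 (hpq.trans_lt hqs)
    have h21 := h1.desc_false hX1 h2 hpq
    obtain ⟨d2, d3, Z, n1, n2, hk⟩ := Step.knuth_right hX1 h1 h2 h3 hpq hqs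
    refine ⟨_, .cons h0 (.cons h1 (.cons n1 (.cons n2 .nil))), ?_⟩
    rcases hk.cases with ⟨k1, k2, _, rfl, rfl⟩ | ⟨k1, k2, _, rfl, rfl⟩ |
      ⟨k1, k2, k3, rfl, rfl⟩ | ⟨k1, k2, _, rfl, rfl⟩
    · exact absurd (k1.trans_le k2) (not_lt.2 h21)
    · exact Or.inl (.ascRight h01 k1 k2)
    · exact absurd (k1.trans_le k2) (k3 ▸ lt_irrefl _)
    · exact absurd k2 (not_lt.2 h21)
  | @descLeft p q s t a b x₁ x₂ y₁ y₂ htq hpq hqs =>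
    obtain _ | ⟨h0, _ | ⟨h1, _ | ⟨h2, _ | ⟨h3, ⟨⟩⟩⟩⟩⟩ := hr
    rename_i X1 f0 c0 X2 f1 c1 X3 f2 c2 f3 c3
    have hX1 := h0.valid hX
    have hX2 := h1.valid hX1
    obtain ⟨rfl, h12⟩ := h1.asc hX1 h2 hpq
    have h32 := h2.desc_false hX2 h3 htq
    cases f0 with
    | false =>
      have h10 := h0.desc_false hX h1 (hpq.le.trans hqs)
      obtain ⟨d1, d2, d3, Z1, Z2, g, g', n1, n2, n3, hk, hg⟩ :=
        Step.knuth_left hX h0 h1 h2 hpq hqs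
      have hZ2 := n2.valid (n1.valid hX)
      cases g' with
      | false =>
        have hg' : g = f1 := by cases g <;> cases f1 <;> simp at hg ⊢
        subst hg'
        have h43 := n3.desc_false hZ2 h3 htq
        refine ⟨_, .cons n1 (.cons n2 (.cons n3 (.cons h3 .nil))), ?_⟩
        rcases hk.cases with ⟨k1, k2, rfl, rfl, rfl⟩ | ⟨k1, k2, rfl, rfl, rfl⟩ |
          ⟨k1, k2, rfl, rfl, rfl⟩ | ⟨k1, k2, rfl, rfl, rfl⟩
        · exact absurd (k1.trans_le k2) (not_lt.2 h10)
        · exact Or.inl (.descRight h43 k1 k2)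
        · exact Or.inl (.descLeft h32 k1 k2)
        · exact absurd k2 (not_lt.2 h10)
      | true =>
        have hg' : g = false ∧ f1 = true := by cases g <;> cases f1 <;> simp at hg ⊢
        obtain ⟨rfl, rfl⟩ := hg'
        obtain ⟨rfl, h34⟩ := n3.desc_true hZ2 h3 htq
        refine ⟨_, .cons n1 (.cons n2 (.cons n3 (.cons h3 .nil))), ?_⟩
        rcases hk.cases with ⟨k1, k2, rfl, rfl, rfl⟩ | ⟨k1, k2, rfl, rfl, rfl⟩ |
          ⟨k1, k2, rfl, rfl, rfl⟩ | ⟨k1, k2, rfl, rfl, rfl⟩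
        · exact absurd (k1.trans_le k2) (not_lt.2 h10)
        · exact Or.inr (.midLeft k1 k2 h34 h32)
        · exact absurd h34 (not_lt.2 h32)
        · exact absurd k2 (not_lt.2 h10)
    | true =>
      obtain ⟨rfl, h01⟩ := h0.desc_true hX h1 (hpq.le.trans hqs)
      obtain ⟨rfl, d1, d2, d3, Z1, Z2, Z3, n0, n1, n2, n3, hk⟩ :=
        Step.double_left hX h0 h1 h2 h3 hpq hqs htq
      have h23 := (n2.desc_true (n1.valid (n0.valid hX)) n3 htq).2
      refine ⟨_, .cons n0 (.cons n1 (.cons n2 (.cons n3 .nil))), ?_⟩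
      rcases hk with ⟨rfl, rfl, rfl, hk⟩ | ⟨rfl, rfl, rfl⟩
      · exact Or.inr (.ascRight h01 hk h12)
      · exact Or.inr (.ascLeft h01 h23 h32)
  | @descRight p q s t a b x₁ x₂ y₁ y₂ htp hpq hqs =>
    obtain _ | ⟨h0, _ | ⟨h1, _ | ⟨h2, _ | ⟨h3, ⟨⟩⟩⟩⟩⟩ := hr
    rename_i X1 f0 c0 X2 f1 c1 X3 f2 c2 f3 c3
    have hX1 := h0.valid hX
    have hX2 := h1.valid hX1
    obtain ⟨rfl, h12⟩ := h1.asc hX1 h2 (hpq.trans_lt hqs)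
    have h32 := h2.desc_false hX2 h3 (htp.trans (hpq.trans hqs.le))
    cases f0 with
    | false =>
      have h10 := h0.desc_false hX h1 hpq
      obtain ⟨d2, d3, Z, n1, n2, hk⟩ := Step.knuth_right hX h0 h1 h2 hpq hqs
      have hZ := n1.valid hX1
      rcases hk.cases with ⟨k1, k2, _, rfl, rfl⟩ | ⟨k1, k2, _, rfl, rfl⟩ |
        ⟨k1, k2, k3, rfl, rfl⟩ | ⟨k1, k2, _, rfl, rfl⟩
      · exact absurd (k1.trans_le k2) (not_lt.2 h10)
      · cases f1 with
        | false =>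
          exact ⟨_, .cons h0 (.cons n1 (.cons n2 (.cons h3 .nil))),
            Or.inl (.descRight (n2.desc_false hZ h3 htp) k1 k2)⟩
        | true =>
          obtain ⟨rfl, h34⟩ := n2.desc_true hZ h3 htp
          exact ⟨_, .cons h0 (.cons n1 (.cons n2 (.cons h3 .nil))),
            Or.inr (.midLeft k1 k2 h34 h32)⟩
      · exact absurd (k1.trans_le k2) (k3 ▸ lt_irrefl _)
      · exact absurd k2 (not_lt.2 h10)
    | true =>
      obtain ⟨rfl, h01⟩ := h0.desc_true hX h1 hpq
      obtain ⟨rfl, d1, d2, d3, Z2, Z3, n1, n2, n3, hk⟩ :=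
        Step.double_right hX h0 h1 h2 h3 htp hpq hqs
      refine ⟨_, .cons h0 (.cons n1 (.cons n2 (.cons n3 .nil))), ?_⟩
      rcases hk.cases with ⟨k1, k2, rfl, rfl, rfl⟩ | ⟨k1, k2, rfl, rfl, rfl⟩ |
        ⟨k1, k2, rfl, rfl, rfl⟩ | ⟨k1, k2, rfl, rfl, rfl⟩
      · exact Or.inr (.ascLeft h01 k1 k2)
      · exact absurd h12 (not_lt.2 k1)
      · exact absurd k1 (not_lt.2 h32)
      · exact Or.inr (.ascRight h01 k1 k2)

end Moves
end DecompTab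

namespace DecompTab
-- Dictionary between abstract hook rows and the lists used by the insertion algorithm.
section Rows

/-- The entries of a row. -/
def HookRow.word (X : HookRow ℕ+) : List ℕ+ := X.dec ++ X.mid :: X.inc

/-- The primed row whose middle element has the prime `β`. -/
def HookRow.row (X : HookRow ℕ+) (β : Bool) : List Letter :=
  X.dec.map (Letter.mk · false) ++ ⟨X.mid, β⟩ :: X.inc.map (Letter.mk · false)

@[simp] theorem HookRow.vals_row (X : HookRow ℕ+) (β : Bool) : vals (X.row β) = X.word := by
  simp [vals, row, word, Function.comp_def]

theorem decPart_append {D : List ℕ+} {m : ℕ+} {I : List ℕ+} (hD : (D ++ [m]).Pairwise (· ≥ ·))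
    (hI : ∀ i ∈ I.head?, m < i) : decPart (D ++ m :: I) = D ++ [m] := by
  induction D with
  | nil =>
    cases I with
    | nil => rfl
    | cons i I => simp [decPart, hI i (by simp)]
  | cons d D ih =>
    have h := ih hD.of_cons
    have h1 := (List.pairwise_cons.1 hD).1
    cases D with
    | nil =>
      simp only [List.nil_append, List.cons_append] at h ⊢
      rw [decPart, if_pos (h1 m (by simp)), h]
    | cons e D =>
      simp only [List.cons_append] at h ⊢
      rw [decPart, if_pos (h1 e (by simp)), h]

theorem HookRow.Valid.decPart_word {X : HookRow ℕ+} (hX : X.Valid) :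
    decPart X.word = X.dec ++ [X.mid] :=
  decPart_append hX.dec fun _ hi => hX.lt_inc (List.mem_of_mem_head? hi)

theorem HookRow.Valid.incPart_word {X : HookRow ℕ+} (hX : X.Valid) :
    incPart X.word = X.inc := by
  rw [incPart, hX.decPart_word]
  simp [HookRow.word]

theorem isHook_iff {w : List ℕ+} : IsHook w ↔ ∃ X : HookRow ℕ+, X.Valid ∧ w = X.word := by
  constructor
  · rintro ⟨k, hk, h1, h2⟩
    refine ⟨⟨w.take k, w[k], w.drop (k + 1)⟩, ⟨?_, ?_⟩, ?_⟩
    · simpa using h1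
    · simpa using h2
    · simp [HookRow.word]
  · rintro ⟨X, hX, rfl⟩
    refine ⟨X.dec.length, by simp [HookRow.word], ?_, ?_⟩
    · have : X.word.take (X.dec.length + 1) = X.dec ++ [X.mid] := by
        simp [HookRow.word, List.take_append]
      rw [this]; exact hX.dec
    · have : X.word.drop X.dec.length = X.mid :: X.inc := by
        simp [HookRow.word]
      rw [this]; exact hX.inc

theorem HookRow.Valid.isHook {X : HookRow ℕ+} (hX : X.Valid) : IsHook X.word :=
  isHook_iff.2 ⟨X, hX, rfl⟩

theorem HookRow.Valid.middlePrimed_row {X : HookRow ℕ+} (hX : X.Valid) (β : Bool) :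
    middlePrimed (X.row β) = β := by
  have : (X.row β)[X.dec.length]? = some ⟨X.mid, β⟩ := by
    simp [HookRow.row]
  simp [middlePrimed, hX.decPart_word, this]

theorem HookRow.Valid.primeMiddle_word {X : HookRow ℕ+} (hX : X.Valid) (β : Bool) :
    primeMiddle β X.word = X.row β := by
  rw [primeMiddle, hX.decPart_word]
  obtain ⟨D, m, I⟩ := X
  simp only [HookRow.word, HookRow.row, List.mapIdx_append, List.mapIdx_cons]
  congr 1
  · apply List.ext_getElem
    · simp
    · intro j h1 h2
      have : j < D.length := by simpa using h2
      simp; omega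
  · congr 1
    · simp
    · apply List.ext_getElem
      · simp
      · intro j h1 h2
        simp

theorem Bump.replaceFirst_lt {a b : ℕ+} {l l' : List ℕ+} (h : Bump (· < ·) a l b l') :
    replaceFirst (fun b => decide (a ≤ b)) a l = some (b, l') := by
  induction h with
  | here h => simp [replaceFirst, not_lt.1 h]
  | there h _ ih => simp [replaceFirst, not_le.2 h, ih]

theorem Bump.replaceFirst_ge {a b : ℕ+} {l l' : List ℕ+} (h : Bump (· ≥ ·) a l b l') :
    replaceFirst (fun b => decide (b < a)) a l = some (b, l') := by
  induction h with
  | here h => simp [replaceFirst, not_le.1 h]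
  | there h _ ih => simp [replaceFirst, not_lt.2 h, ih]

theorem not_isHook_append {X : HookRow ℕ+} (hX : X.Valid) {a x : ℕ+} (hx : x ∈ X.inc)
    (ha : a ≤ x) : ¬ IsHook (X.word ++ [a]) := by
  intro h
  obtain ⟨X', hX', h⟩ := isHook_iff.1 h
  have h1 := hX'.decPart_word
  have h2 : decPart (X.word ++ [a]) = X.dec ++ [X.mid] := by
    rw [HookRow.word, List.append_assoc, List.cons_append]
    refine decPart_append hX.dec fun i hi => ?_
    rw [List.head?_append_of_ne_nil _ (List.ne_nil_of_mem hx)] at hi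
    exact hX.lt_inc (List.mem_of_mem_head? hi)
  have h3 := hX'.incPart_word
  rw [← h, incPart, h2] at h3
  have h4 : X'.inc = X.inc ++ [a] := by simpa [HookRow.word] using h3.symm
  have h5 := hX'.inc_sorted
  rw [h4, List.pairwise_append] at h5
  exact absurd (h5.2.2 x hx a (by simp)) (not_lt.2 ha)

theorem insertUnprimed_of_bump {X X' : HookRow ℕ+} (hX : X.Valid) {a b c : ℕ+} {I D : List ℕ+}
    (h1 : Bump (· < ·) a X.inc b I) (h2 : Bump (· ≥ ·) b (X.dec ++ [X.mid]) c D)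
    (h3 : D ++ I = X'.word) : insertUnprimed a X.word = (X'.word, some c) := by
  rw [insertUnprimed, if_neg (not_isHook_append hX h1.mem_old h1.le), hX.incPart_word,
    h1.replaceFirst_lt]
  simp only [hX.decPart_word, h2.replaceFirst_ge, h3]

theorem Step.insertUnprimed {X X' : HookRow ℕ+} {a c : ℕ+} {f : Bool} (hX : X.Valid)
    (h : Step X a c X' f) : insertUnprimed a X.word = (X'.word, some c) := by
  cases h with
  | @bulk D I D' I' m _ _ _ h1 h2 h3 =>
    exact insertUnprimed_of_bump hX h2 (h3.append_right [m]) (by simp [HookRow.word])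
  | head h1 h2 h3 =>
    exact insertUnprimed_of_bump hX (.here (not_lt.2 h1)) h3 (by simp [HookRow.word])
  | deep h1 h2 h3 =>
    exact insertUnprimed_of_bump hX (.there h1 h2) (Bump.at_end (R := (· ≥ ·)) h3 (not_le.2
      ((hX.lt_inc List.mem_cons_self).trans (h1.trans_le h2.le))) []) (by simp [HookRow.word])

theorem insertRow_row {X X' : HookRow ℕ+} (hX : X.Valid) (hX' : X'.Valid) {a : ℕ+}
    {o : Option ℕ+} {f : Bool} (h : insertUnprimed a X.word = (X'.word, o))
    (hf : X'.dec.length = X.dec.length + f.toNat) (ξ β : Bool) :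
    insertRow ⟨a, ξ⟩ (X.row β) =
      (X'.row (bif f then ξ else β), o.map fun c => ⟨c, bif f then β else ξ⟩) := by
  simp only [insertRow, HookRow.vals_row, h, hX.decPart_word, hX'.decPart_word,
    hX.middlePrimed_row, hX'.primeMiddle_word, List.length_append, hf]
  cases f <;> simp

theorem Step.insertRow {X X' : HookRow ℕ+} {a c : ℕ+} {f : Bool} (hX : X.Valid)
    (h : Step X a c X' f) (ξ β : Bool) :
    insertRow ⟨a, ξ⟩ (X.row β) =
      (X'.row (bif f then ξ else β), some ⟨c, bif f then β else ξ⟩) :=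
  insertRow_row hX (h.valid hX) (h.insertUnprimed hX) h.length_dec ξ β

theorem insertRow_nil (x : Letter) : insertRow x [] = ([x], none) := by
  have h : IsHook [x.val] := ⟨0, by simp, by simp, by simp⟩
  simp [insertRow, insertUnprimed, vals, h, decPart, primeMiddle]

theorem valid_append_inc {X : HookRow ℕ+} (hX : X.Valid) {a : ℕ+} (hm : X.mid < a)
    (hI : ∀ i ∈ X.inc, i < a) : HookRow.Valid ⟨X.dec, X.mid, X.inc ++ [a]⟩ := by
  refine ⟨hX.dec, ?_⟩
  have h : ((X.mid :: X.inc) ++ [a]).Pairwise (· < ·) := by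
    rw [List.pairwise_append]
    refine ⟨hX.inc, by simp, ?_⟩
    rintro x hx y hy
    rw [List.mem_singleton.1 hy]
    rcases List.mem_cons.1 hx with rfl | hx
    · exact hm
    · exact hI _ hx
  exact h

theorem insertRow_append_inc {X : HookRow ℕ+} (hX : X.Valid) {a : ℕ+} (hm : X.mid < a)
    (hI : ∀ i ∈ X.inc, i < a) (ξ β : Bool) :
    insertRow ⟨a, ξ⟩ (X.row β) = (HookRow.row ⟨X.dec, X.mid, X.inc ++ [a]⟩ β, none) := by
  have hX' := valid_append_inc hX hm hI
  have h : X.word ++ [a] = HookRow.word ⟨X.dec, X.mid, X.inc ++ [a]⟩ := by simp [HookRow.word]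
  refine insertRow_row (f := false) hX hX' (o := none) ?_ rfl ξ β
  rw [insertUnprimed, h, if_pos hX'.isHook]

theorem valid_append_dec {D : List ℕ+} {m a : ℕ+} (hX : HookRow.Valid ⟨D, m, []⟩) (hm : a ≤ m) :
    HookRow.Valid ⟨D ++ [m], a, []⟩ :=
  ⟨pairwise_concat.2 ⟨hX.dec, forall_concat_le (fun _ hd => hm.trans (hX.le_dec hd)) hm⟩,
    by simp⟩

theorem insertRow_append_dec {D : List ℕ+} {m a : ℕ+} (hX : HookRow.Valid ⟨D, m, []⟩)
    (hm : a ≤ m) (ξ β : Bool) :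
    insertRow ⟨a, ξ⟩ (HookRow.row ⟨D, m, []⟩ β) = (HookRow.row ⟨D ++ [m], a, []⟩ ξ, none) := by
  have hX' := valid_append_dec hX hm
  have h : HookRow.word ⟨D, m, []⟩ ++ [a] = HookRow.word ⟨D ++ [m], a, []⟩ := by
    simp [HookRow.word]
  refine insertRow_row (f := true) hX hX' (o := none) ?_ (by simp) ξ β
  rw [insertUnprimed, h, if_pos hX'.isHook]

/-- The three cases of inserting a letter into a nonempty row. -/
theorem HookRow.Valid.insert_cases {X : HookRow ℕ+} (hX : X.Valid) (a : ℕ+) :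
    (X.mid < a ∧ ∀ i ∈ X.inc, i < a) ∨ (X.inc = [] ∧ a ≤ X.mid) ∨
      ∃ c X' f, Step X a c X' f := by
  by_cases h : ∃ i ∈ X.inc, a ≤ i
  · obtain ⟨i, hi, ha⟩ := h
    exact Or.inr (Or.inr (Step.exists_of_le hX hi ha))
  · push Not at h
    by_cases hm : X.mid < a
    · exact Or.inl ⟨hm, h⟩
    · rw [not_lt] at hm
      refine Or.inr (Or.inl ⟨List.eq_nil_iff_forall_not_mem.2 fun i hi => ?_, hm⟩)
      exact absurd (hX.lt_inc hi) (not_lt.2 ((h i hi).le.trans hm))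

/-- A row that is empty or a hook word, with at most the middle element primed. -/
def GoodRow (r : List Letter) : Prop := r = [] ∨ ∃ X : HookRow ℕ+, X.Valid ∧ ∃ β, r = X.row β

theorem valid_singleton (a : ℕ+) : HookRow.Valid ⟨[], a, []⟩ := ⟨by simp, by simp⟩

theorem GoodRow.insertRow {r : List Letter} (hr : GoodRow r) (x : Letter) :
    GoodRow (insertRow x r).1 := by
  rcases hr with rfl | ⟨⟨D, m, I⟩, hX, β, rfl⟩
  · rw [insertRow_nil]; exact Or.inr ⟨_, valid_singleton x.val, x.primed, rfl⟩
  · obtain ⟨a, ξ⟩ := x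
    rcases hX.insert_cases a with ⟨h1, h2⟩ | ⟨h1, h2⟩ | ⟨c, X', f, h⟩
    · rw [insertRow_append_inc hX h1 h2]; exact Or.inr ⟨_, valid_append_inc hX h1 h2, _, rfl⟩
    · dsimp only at h1 h2
      subst h1
      rw [insertRow_append_dec hX h2]; exact Or.inr ⟨_, valid_append_dec hX h2, _, rfl⟩
    · rw [h.insertRow hX]; exact Or.inr ⟨_, h.valid hX, _, rfl⟩

end Rows
end DecompTab

namespace DecompTab
-- Equivalence of words, and its proof for the elementary moves.
section Equivalence

/-- Insertion of the letters of a word, read from left to right. -/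
def act (T : Tableau) (u : Word) : Tableau := u.foldl (fun T x => insert x T) T

/-- Insertion of the letters of a word into a row; returns the new row and the word of the
bumped letters. -/
def rowAct (r : List Letter) : Word → List Letter × Word
  | [] => (r, [])
  | x :: u => ((rowAct (insertRow x r).1 u).1,
      (insertRow x r).2.toList ++ (rowAct (insertRow x r).1 u).2)

@[simp]
theorem act_nil (T : Tableau) : act T [] = T := rfl

theorem act_cons (T : Tableau) (x : Letter) (u : Word) : act T (x :: u) = act (insert x T) u := rfl

theorem act_append (T : Tableau) (u v : Word) : act T (u ++ v) = act (act T u) v :=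
  List.foldl_append

theorem insert_cons (x : Letter) (r : List Letter) (T : Tableau) :
    insert x (r :: T) = (insertRow x r).1 :: act T (insertRow x r).2.toList := by
  rw [insert]
  rcases insertRow x r with ⟨r', _ | y⟩ <;> rfl

theorem act_cons_row (r : List Letter) (T : Tableau) (u : Word) :
    act (r :: T) u = (rowAct r u).1 :: act T (rowAct r u).2 := by
  induction u generalizing r T with
  | nil => rfl
  | cons x u ih => rw [act_cons, insert_cons, ih, rowAct, act_append]

/-- The first letter opens a row, so an empty row may be supplied beforehand and no tableau has to
be treated as rowless. -/
theorem act_nil_cons (x : Letter) (u : Word) : act [] (x :: u) = act [[]] (x :: u) := by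
  rw [act_cons, act_cons, insert_cons, insertRow_nil]; rfl

theorem rowAct_append (r : List Letter) (u v : Word) :
    rowAct r (u ++ v) = ((rowAct (rowAct r u).1 v).1,
      (rowAct r u).2 ++ (rowAct (rowAct r u).1 v).2) := by
  induction u generalizing r with
  | nil => rfl
  | cons x u ih => simp [rowAct, ih]

theorem length_rowAct_le (r : List Letter) (u : Word) : (rowAct r u).2.length ≤ u.length := by
  induction u generalizing r with
  | nil => rfl
  | cons x u ih =>
    have := ih (insertRow x r).1
    rcases h : (insertRow x r).2 with _ | y <;> simp [rowAct, h] <;> omega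

theorem length_rowAct_nil_lt {u : Word} (hu : u ≠ []) : (rowAct [] u).2.length < u.length := by
  cases u with
  | nil => exact absurd rfl hu
  | cons x u =>
    have := length_rowAct_le [x] u
    simp [rowAct, insertRow_nil]; omega

theorem goodRow_nil : GoodRow [] := Or.inl rfl

theorem goodRow_insert {T : Tableau} (hT : ∀ r ∈ T, GoodRow r) (x : Letter) :
    ∀ r ∈ insert x T, GoodRow r := by
  induction T generalizing x with
  | nil =>
    intro r hr
    rw [insert, List.mem_singleton] at hr
    exact hr ▸ Or.inr ⟨_, valid_singleton x.val, x.primed, rfl⟩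
  | cons s T ih =>
    have h1 := (hT s (by simp)).insertRow x
    have hT' : ∀ r ∈ T, GoodRow r := fun r hr => hT r (by simp [hr])
    rw [insert_cons]
    rintro r hr
    rcases List.mem_cons.1 hr with rfl | hr
    · exact h1
    · rcases h : (insertRow x s).2 with _ | y
      · rw [h] at hr; exact hT' r hr
      · rw [h] at hr; exact ih hT' y r hr

theorem goodRow_act {T : Tableau} (hT : ∀ r ∈ T, GoodRow r) (u : Word) :
    ∀ r ∈ act T u, GoodRow r := by
  induction u generalizing T with
  | nil => exact hT
  | cons x u ih => exact ih (goodRow_insert hT x)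

/-- Words which act in the same way on all tableaux. -/
def Eqv (u v : Word) : Prop := ∀ T : Tableau, (∀ r ∈ T, GoodRow r) → act T u = act T v

theorem Eqv.refl (u : Word) : Eqv u u := fun _ _ => rfl

theorem Eqv.symm {u v : Word} (h : Eqv u v) : Eqv v u := fun T hT => (h T hT).symm

theorem Eqv.trans {u v w : Word} (h : Eqv u v) (h' : Eqv v w) : Eqv u w :=
  fun T hT => (h T hT).trans (h' T hT)

theorem Eqv.append {u v u' v' : Word} (h : Eqv u u') (h' : Eqv v v') :
    Eqv (u ++ v) (u' ++ v') := fun T hT => by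
  rw [act_append, act_append, h T hT, h' _ (goodRow_act hT u')]

theorem Eqv.append_left {v v' : Word} (u : Word) (h : Eqv v v') : Eqv (u ++ v) (u ++ v') :=
  (Eqv.refl u).append h

theorem Eqv.append_right {u u' : Word} (h : Eqv u u') (v : Word) : Eqv (u ++ v) (u' ++ v) :=
  h.append (Eqv.refl v)

theorem Eqv.cons {v v' : Word} (x : Letter) (h : Eqv v v') : Eqv (x :: v) (x :: v') :=
  h.append_left [x]

/-- A relation on words of a fixed length implies equivalence if it is preserved by insertion into
a row, up to equivalence of the bumped words. -/
theorem eqv_of_rowAct (P : Word → Word → Prop) (n : ℕ) (hn : 0 < n)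
    (hP : ∀ u v, P u v → u.length = n ∧ v.length = n)
    (h : ∀ u v, P u v → ∀ r, GoodRow r → (rowAct r u).1 = (rowAct r v).1 ∧
      (P (rowAct r u).2 (rowAct r v).2 ∨ Eqv (rowAct r u).2 (rowAct r v).2)) {u v : Word}
    (huv : P u v) : Eqv u v := by
  intro T hT
  induction T generalizing u v with
  | nil =>
    obtain ⟨hu, hv⟩ := hP u v huv
    have hu' : u ≠ [] := by rintro rfl; simp at hu; omega
    have hv' : v ≠ [] := by rintro rfl; simp at hv; omega
    have h1 : ∀ {w : Word}, w ≠ [] → act [] w = act [[]] w := by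
      rintro (_ | ⟨x, w⟩) hw
      · exact absurd rfl hw
      · exact act_nil_cons x w
    obtain ⟨h2, h3⟩ := h u v huv [] goodRow_nil
    rw [h1 hu', h1 hv', act_cons_row, act_cons_row, h2]
    rcases h3 with h3 | h3
    -- An empty row keeps at least one letter, so the bumped word is shorter than `n` and cannot be
    -- related by `P`.
    · have := (hP _ _ h3).1
      have := length_rowAct_nil_lt hu'
      omega
    · rw [h3 [] (by simp)]
  | cons r T ih =>
    obtain ⟨h2, h3⟩ := h u v huv r (hT r (by simp))
    have hT' : ∀ s ∈ T, GoodRow s := fun s hs => hT s (by simp [hs])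
    rw [act_cons_row, act_cons_row, h2]
    rcases h3 with h3 | h3
    · rw [ih h3 hT']
    · rw [h3 T hT']

/-- `X` and `β` represent the row `r` with entries at most `N`, completed with at least `k`
additional letters greater than `N` at the end and one letter greater than `N` at the beginning. -/
def Completion (N : ℕ+) (k : ℕ) (X : HookRow ℕ+) (β : Bool) (r : List Letter) : Prop :=
  ∃ (l : ℕ+) (M : List ℕ+), N < l ∧ (l :: M).Pairwise (· < ·) ∧ k ≤ M.length ∧
    ((r = [] ∧ X = ⟨[], l, M⟩) ∨ ∃ Y : HookRow ℕ+, Y.Valid ∧ (∀ y ∈ Y.word, y ≤ N) ∧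
      r = Y.row β ∧ X = ⟨l :: Y.dec, Y.mid, Y.inc ++ M⟩)

theorem Completion.valid {N : ℕ+} {k : ℕ} {X : HookRow ℕ+} {β : Bool} {r : List Letter}
    (h : Completion N k X β r) : X.Valid := by
  obtain ⟨l, M, hl, hM, -, ⟨-, rfl⟩ | ⟨⟨D, m, I⟩, hY, hN, -, rfl⟩⟩ := h
  · exact ⟨by simp, hM⟩
  · have hM' := List.pairwise_cons.1 hM
    refine ⟨?_, ?_⟩
    · change (l :: (D ++ [m])).Pairwise (· ≥ ·)
      refine List.pairwise_cons.2 ⟨fun d hd => ?_, hY.dec⟩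
      refine ((hN d ?_).trans_lt hl).le
      simp only [HookRow.word, List.mem_append, List.mem_cons, List.not_mem_nil, or_false] at hd ⊢
      tauto
    · change ((m :: I) ++ M).Pairwise (· < ·)
      rw [List.pairwise_append]
      refine ⟨hY.inc, hM'.2, fun x hx y hy => ?_⟩
      refine ((hN x ?_).trans_lt hl).trans (hM'.1 y hy)
      simp only [HookRow.word, List.mem_append]
      tauto

theorem exists_increasing (l : ℕ+) (k : ℕ) :
    ∃ M : List ℕ+, (l :: M).Pairwise (· < ·) ∧ M.length = k := by
  induction k generalizing l with
  | zero => exact ⟨[], by simp, rfl⟩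
  | succ k ih =>
    obtain ⟨M, h1, h2⟩ := ih (l + 1)
    have hl : l < l + 1 := PNat.lt_add_right l 1
    refine ⟨(l + 1) :: M, List.pairwise_cons.2 ⟨fun x hx => ?_, h1⟩, by simp [h2]⟩
    rcases List.mem_cons.1 hx with rfl | hx
    · exact hl
    · exact hl.trans ((List.pairwise_cons.1 h1).1 x hx)

/-- Runs require every insertion to bump a letter. The letters above `N` are placeholders for empty
boxes: with enough of them no inserted letter at most `N` lacks something to bump, and a bumped
placeholder means that a box was really added. -/
theorem exists_completion {r : List Letter} (hr : GoodRow r) (N : ℕ+)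
    (hN : ∀ x ∈ vals r, x ≤ N) (k : ℕ) : ∃ X β, Completion N k X β r := by
  obtain ⟨M, h1, h2⟩ := exists_increasing (N + 1) k
  have hl : N < N + 1 := PNat.lt_add_right N 1
  rcases hr with rfl | ⟨Y, hY, β, rfl⟩
  · exact ⟨_, false, _, M, hl, h1, h2.ge, Or.inl ⟨rfl, rfl⟩⟩
  · exact ⟨_, β, _, M, hl, h1, h2.ge, Or.inr ⟨Y, hY, by simpa using hN, rfl, rfl⟩⟩

theorem filter_append_le {N l : ℕ+} {I M : List ℕ+} (hI : ∀ i ∈ I, i ≤ N) (hl : N < l)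
    (hM : (l :: M).Pairwise (· < ·)) : (I ++ M).filter (fun x => decide (x ≤ N)) = I := by
  rw [List.filter_append, List.filter_eq_self.2 fun i hi => by simpa using hI i hi,
    List.filter_eq_nil_iff.2 fun m hm => ?_, List.append_nil]
  simpa using hl.trans ((List.pairwise_cons.1 hM).1 m hm)

theorem Completion.row_eq {N : ℕ+} {k k' : ℕ} {X : HookRow ℕ+} {β : Bool} {r r' : List Letter}
    (h : Completion N k X β r) (h' : Completion N k' X β r') : r = r' := by
  obtain ⟨l, M, hl, hM, hk, h⟩ := h
  obtain ⟨l', M', hl', hM', hk', h'⟩ := h'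
  have hmid : ∀ {Y : HookRow ℕ+}, (∀ y ∈ Y.word, y ≤ N) → Y.mid ≤ N := fun h =>
    h _ (by simp [HookRow.word])
  rcases h with ⟨rfl, rfl⟩ | ⟨Y, hY, hN, rfl, rfl⟩
  · rcases h' with ⟨rfl, -⟩ | ⟨Y', hY', hN', rfl, h⟩
    · rfl
    · have := congrArg HookRow.mid h
      exact absurd (hmid hN') (not_le.2 (this ▸ hl))
  · rcases h' with ⟨rfl, h⟩ | ⟨Y', hY', hN', rfl, h⟩
    · have := congrArg HookRow.mid h
      exact absurd (hmid hN) (not_le.2 (this ▸ hl'))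
    · obtain ⟨h1, h2, h3⟩ := HookRow.mk.injEq .. ▸ h
      obtain ⟨-, h1⟩ := List.cons.inj h1
      have h4 := congrArg (List.filter fun x => decide (x ≤ N)) h3
      rw [filter_append_le (fun y hy => hN y (by simp [HookRow.word, hy])) hl hM,
        filter_append_le (fun y hy => hN' y (by simp [HookRow.word, hy])) hl' hM'] at h4
      rw [HookRow.ext h1 h2 h4]

/-- Those letters of a word which are at most `N`. -/
def truncate (N : ℕ+) (v : List (ℕ+ × Bool)) : Word :=
  (v.filter fun x => decide (x.1 ≤ N)).map fun x => ⟨x.1, x.2⟩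

theorem Step.mem_word {X X' : HookRow ℕ+} {a c : ℕ+} {f : Bool} (h : Step X a c X' f) :
    c ∈ X.word ∧ ∀ y ∈ X'.word, y = a ∨ y ∈ X.word := by
  cases h with
  | @bulk _ _ _ _ _ _ b _ h1 h2 h3 =>
    refine ⟨by simp [HookRow.word, h3.mem_old], fun y hy => ?_⟩
    simp only [HookRow.word, List.mem_append, List.mem_cons] at hy ⊢
    have h4 := h2.mem_old
    rcases hy with hy | hy | hy
    · rcases h3.mem_of_mem_new hy with rfl | hy <;> tauto
    · tauto
    · rcases h2.mem_of_mem_new hy with rfl | hy <;> tauto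
  | head h1 h2 h3 =>
    have h4 := h3.mem_old
    simp only [HookRow.word, List.mem_append, List.mem_cons, List.not_mem_nil, or_false] at h4 ⊢
    refine ⟨by tauto, fun y hy => ?_⟩
    rcases hy with hy | hy | hy
    · rcases h3.mem_of_mem_new hy with rfl | hy
      · tauto
      · simp only [List.mem_append, List.mem_cons, List.not_mem_nil, or_false] at hy; tauto
    · tauto
    · tauto
  | deep h1 h2 h3 =>
    have h4 := h2.mem_old
    simp only [HookRow.word, List.mem_append, List.mem_cons, List.not_mem_nil, or_false]
    refine ⟨by tauto, fun y hy => ?_⟩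
    rcases hy with (hy | rfl) | hy | hy
    · tauto
    · tauto
    · tauto
    · rcases h2.mem_of_mem_new hy with rfl | hy <;> tauto

theorem Step.forall_word {X X' : HookRow ℕ+} {a c N : ℕ+} {f : Bool} (h : Step X a c X' f)
    (hX : ∀ y ∈ X.word, y ≤ N) (ha : a ≤ N) : (∀ y ∈ X'.word, y ≤ N) ∧ c ≤ N := by
  refine ⟨fun y hy => ?_, hX _ h.mem_word.1⟩
  rcases h.mem_word.2 y hy with rfl | hy
  exacts [ha, hX y hy]

/-- A letter that would lengthen the row replaces the first placeholder `m'`, which in turn replaces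
the placeholder `l` at the front; `l` is bumped and then erased by `truncate`. A letter that bumps
in the real row never touches the placeholders. -/
theorem Completion.step {N : ℕ+} {k : ℕ} {X : HookRow ℕ+} {β : Bool} {r : List Letter}
    (h : Completion N (k + 1) X β r) {a : ℕ+} (ξ : Bool) (ha : a ≤ N) :
    ∃ c X' f, Step X a c X' f ∧
      Completion N k X' (bif f then ξ else β) (insertRow ⟨a, ξ⟩ r).1 ∧
      (insertRow ⟨a, ξ⟩ r).2.toList = truncate N [(c, bif f then β else ξ)] := by
  obtain ⟨l, M, hl, hM, hk, h⟩ := h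
  rcases M with _ | ⟨m', M⟩
  · simp at hk
  have hM' := List.pairwise_cons.1 hM
  have hlm : l < m' := hM'.1 m' (by simp)
  have hk' : k ≤ M.length := by simpa using hk
  have hk'' : k ≤ (m' :: M).length := by simp; omega
  have hlN : ∀ b, truncate N [(l, b)] = [] := fun b => by simp [truncate, hl]
  have ham : a < m' := ha.trans_lt (hl.trans hlm)
  rcases h with ⟨rfl, rfl⟩ | ⟨⟨D, m, I⟩, hY, hN, rfl, rfl⟩
  · refine ⟨_, _, _, .head ham.le (Or.inr (by simp)) (.here (not_le.2 hlm)), ?_, ?_⟩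
    · rw [insertRow_nil]
      exact ⟨m', M, hl.trans hlm, hM'.2, hk', Or.inr ⟨⟨[], a, []⟩, valid_singleton a,
        by simpa [HookRow.word] using ha, rfl, rfl⟩⟩
    · rw [insertRow_nil, hlN]; rfl
  · have hm : m ≤ N := hN _ (by simp [HookRow.word])
    have hI : ∀ i ∈ I, i ≤ N := fun i hi => hN _ (by simp [HookRow.word, hi])
    have hD : ∀ d ∈ D, d ≤ N := fun d hd => hN _ (by simp [HookRow.word, hd])
    rcases hY.insert_cases a with ⟨h1, h2⟩ | ⟨h1, h2⟩ | ⟨c, X', f, h⟩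
    · refine ⟨_, _, _, .bulk h1 (Bump.at_end (R := (· < ·)) h2 (not_lt.2 ham.le) M)
        (.here (not_le.2 hlm)), ?_, ?_⟩
      · rw [insertRow_append_inc hY h1 h2]
        refine ⟨m', M, hl.trans hlm, hM'.2, hk', Or.inr ⟨_, valid_append_inc hY h1 h2, ?_, rfl,
          by simp⟩⟩
        intro y hy
        simp only [HookRow.word, List.mem_append, List.mem_cons, List.not_mem_nil, or_false] at hy
        rcases hy with hy | rfl | hy | rfl
        exacts [hD _ hy, hm, hI _ hy, ha]
      · rw [insertRow_append_inc hY h1 h2, hlN]; rfl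
    · dsimp only at h1 h2
      subst h1
      refine ⟨_, _, _, .head ham.le (Or.inl h2) (.here (not_le.2 hlm)), ?_, ?_⟩
      · rw [insertRow_append_dec hY h2]
        refine ⟨m', M, hl.trans hlm, hM'.2, hk', Or.inr ⟨_, valid_append_dec hY h2, ?_, rfl,
          by simp⟩⟩
        intro y hy
        simp only [HookRow.word, List.mem_append, List.mem_cons, List.not_mem_nil, or_false] at hy
        rcases hy with (hy | rfl) | rfl
        exacts [hD _ hy, hm, ha]
      · rw [insertRow_append_dec hY h2, hlN]; rfl
    · rw [h.insertRow hY]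
      have hv := h.valid hY
      have hw : (∀ y ∈ X'.word, y ≤ N) ∧ c ≤ N := h.forall_word hN ha
      refine ⟨c, ⟨l :: X'.dec, X'.mid, X'.inc ++ m' :: M⟩, f, ?_,
        ⟨l, m' :: M, hl, hM, hk'', Or.inr ⟨X', hv, hw.1, rfl, rfl⟩⟩,
        by simp [truncate, hw.2]⟩
      cases h with
      | @bulk _ _ _ _ _ _ b _ h1 h2 h3 =>
        exact .bulk h1 (h2.append_right _) (.there ((hI b h2.mem_old).trans hl.le) h3)
      | @head _ _ _ _ i _ _ h1 h2 h3 =>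
        have hi := (hI i (by simp)).trans hl.le
        exact .head h1 (h2.imp_right fun h => by simpa using ⟨hi, h⟩) (.there hi h3)
      | @deep _ _ _ _ i _ b h1 h2 h3 =>
        have hb := (hI b (List.mem_cons_of_mem _ h2.mem_old)).trans hl.le
        exact .deep h1 (h2.append_right _) (by simpa using ⟨hb, h3⟩)

theorem Run.det {X X' X'' : HookRow ℕ+} {β β' β'' : Bool} {u v v' : List (ℕ+ × Bool)}
    (hX : X.Valid) (h : Run X β u X' β' v) (h' : Run X β u X'' β'' v') :
    X' = X'' ∧ β' = β'' ∧ v = v' := by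
  induction h generalizing X'' β'' v' with
  | nil => cases h'; exact ⟨rfl, rfl, rfl⟩
  | cons h1 _ ih =>
    cases h' with
    | cons h2 h3 =>
      obtain ⟨rfl, rfl, rfl⟩ := h1.det hX h2
      obtain ⟨rfl, rfl, rfl⟩ := ih (h1.valid hX) h3
      exact ⟨rfl, rfl, rfl⟩

theorem truncate_cons (N : ℕ+) (x : ℕ+ × Bool) (v : List (ℕ+ × Bool)) :
    truncate N (x :: v) = truncate N [x] ++ truncate N v := by
  simp only [truncate, ← List.map_append, ← List.filter_append, List.singleton_append]

/-- The word of the letters with given values and primes. -/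
def letters (u : List (ℕ+ × Bool)) : Word := u.map fun x => ⟨x.1, x.2⟩

theorem Completion.run {N : ℕ+} {k : ℕ} {X : HookRow ℕ+} {β : Bool} {r : List Letter}
    {u : List (ℕ+ × Bool)} (h : Completion N (u.length + k) X β r) (hu : ∀ x ∈ u, x.1 ≤ N) :
    ∃ X' β' v, Run X β u X' β' v ∧ Completion N k X' β' (rowAct r (letters u)).1 ∧
      (rowAct r (letters u)).2 = truncate N v := by
  induction u generalizing X β r with
  | nil => exact ⟨X, β, [], .nil, by simpa [rowAct, letters] using h, rfl⟩
  | cons x u ih =>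
    have h' : Completion N (u.length + k + 1) X β r := by
      rwa [List.length_cons, Nat.add_right_comm] at h
    obtain ⟨c, X₁, f, h1, h2, h3⟩ := h'.step x.2 (hu x (by simp))
    obtain ⟨X', β', v, h4, h5, h6⟩ := ih h2 fun y hy => hu y (by simp [hy])
    refine ⟨X', β', _, .cons h1 h4, h5, ?_⟩
    rw [truncate_cons, ← h3, ← h6]; rfl

/-- If two words of the same length have the same effect on a completed row, then they have the
same effect on the row itself. -/
theorem rowAct_eq_of_run {u u' : List (ℕ+ × Bool)} (hl : u.length = u'.length)
    {r : List Letter} (hr : GoodRow r) (P : List (ℕ+ × Bool) → List (ℕ+ × Bool) → Prop)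
    (h : ∀ X X' : HookRow ℕ+, ∀ β β' v, X.Valid → Run X β u X' β' v →
      ∃ v', Run X β u' X' β' v' ∧ P v v') :
    (rowAct r (letters u)).1 = (rowAct r (letters u')).1 ∧
      ∃ N v v', P v v' ∧ (rowAct r (letters u)).2 = truncate N v ∧
        (rowAct r (letters u')).2 = truncate N v' := by
  obtain ⟨N, hN⟩ : ∃ N : ℕ+, ∀ x ∈ vals r ++ (u.map Prod.fst ++ u'.map Prod.fst), x ≤ N := by
    generalize vals r ++ (u.map Prod.fst ++ u'.map Prod.fst) = l
    induction l with
    | nil => exact ⟨1, by simp⟩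
    | cons x l ih =>
      obtain ⟨N, hN⟩ := ih
      refine ⟨max x N, fun y hy => ?_⟩
      rcases List.mem_cons.1 hy with rfl | hy
      · exact le_max_left _ _
      · exact (hN y hy).trans (le_max_right _ _)
  have hu : ∀ x ∈ u, x.1 ≤ N := fun x hx => hN _ (by
    simp only [List.mem_append]; exact Or.inr (Or.inl (List.mem_map_of_mem hx)))
  have hu' : ∀ x ∈ u', x.1 ≤ N := fun x hx => hN _ (by
    simp only [List.mem_append]; exact Or.inr (Or.inr (List.mem_map_of_mem hx)))
  obtain ⟨X, β, hc⟩ := exists_completion hr N (fun x hx => hN x (by simp [hx])) (u.length + 0)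
  have hX := hc.valid
  obtain ⟨X', β', v, h1, h2, h3⟩ := hc.run hu
  obtain ⟨v', h4, hP⟩ := h X X' β β' v hX h1
  rw [hl] at hc
  obtain ⟨X'', β'', v'', h5, h6, h7⟩ := hc.run hu'
  obtain ⟨rfl, rfl, rfl⟩ := h4.det hX h5
  exact ⟨h2.row_eq h6, N, v, v', hP, h3, h7⟩

/-- Words of length two in which a prime does not matter. -/
inductive BitMove : List (ℕ+ × Bool) → List (ℕ+ × Bool) → Prop
  | asc {a b : ℕ+} {x y z : Bool} : a < b → BitMove [(a, x), (b, y)] [(a, x), (b, z)]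
  | desc {a b : ℕ+} {x y z : Bool} : b ≤ a → BitMove [(a, y), (b, x)] [(a, z), (b, x)]

/-- The free prime sits on the second letter of an ascent or the first letter of a descent. The
second step of an ascent leaves the middle alone and passes the prime straight on. For a descent it
is passed on at once, or rests on the middle until the second shift gives it to the larger bumped
letter. -/
theorem BitMove.run {X X' : HookRow ℕ+} {β β' : Bool} {u u' v : List (ℕ+ × Bool)}
    (hm : BitMove u u') (hX : X.Valid) (hr : Run X β u X' β' v) :
    ∃ v', Run X β u' X' β' v' ∧ BitMove v v' := by
  cases hm with
  | @asc a b x y z hab =>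
    obtain _ | ⟨h0, _ | ⟨h1, ⟨⟩⟩⟩ := hr
    obtain ⟨rfl, h01⟩ := h0.asc hX h1 hab
    exact ⟨_, .cons h0 (.cons h1 .nil), .asc h01⟩
  | @desc a b x y z hab =>
    obtain _ | ⟨h0, _ | ⟨h1, ⟨⟩⟩⟩ := hr
    rename_i f _ _ _
    cases f with
    | true =>
      obtain ⟨rfl, h01⟩ := h0.desc_true hX h1 hab
      exact ⟨_, .cons h0 (.cons h1 .nil), .asc h01⟩
    | false => exact ⟨_, .cons h0 (.cons h1 .nil), .desc (h0.desc_false hX h1 hab)⟩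

theorem BitMove.eqv {u u' : List (ℕ+ × Bool)} (h : BitMove u u') :
    Eqv (letters u) (letters u') := by
  refine eqv_of_rowAct (fun w w' => ∃ u u', BitMove u u' ∧ w = letters u ∧ w' = letters u')
    2 (by simp) ?_ ?_ ⟨u, u', h, rfl, rfl⟩
  · rintro _ _ ⟨u, u', h, rfl, rfl⟩
    cases h <;> simp [letters]
  · rintro _ _ ⟨u, u', h, rfl, rfl⟩ r hr
    have hl : u.length = u'.length := by cases h <;> rfl
    obtain ⟨h1, N, v, v', hv, h2, h3⟩ :=
      rowAct_eq_of_run hl hr BitMove fun X X' β β' v hX hv => h.run hX hv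
    refine ⟨h1, ?_⟩
    rw [h2, h3]
    by_cases hN : ∀ x ∈ v, x.1 ≤ N
    · refine Or.inl ⟨v, v', hv, ?_, ?_⟩
      · rw [truncate, List.filter_eq_self.2 (by simpa using hN)]; rfl
      · rw [truncate, List.filter_eq_self.2]
        · rfl
        · cases hv <;> simpa using hN
    -- If a letter exceeds `N`, so does the one with the free prime, which is at least as large as
    -- the other; after truncation the words coincide.
    · right
      have : truncate N v = truncate N v' := by
        cases hv with
        | @asc a b x y z h =>
          by_cases hb : b ≤ N
          · exact absurd (by simpa using ⟨h.le.trans hb, hb⟩) hN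
          · simp [truncate, List.filter_cons, hb]
        | @desc a b x y z h =>
          by_cases hb : a ≤ N
          · exact absurd (by simpa using ⟨hb, h.trans hb⟩) hN
          · simp [truncate, hb]
      rw [this]; exact Eqv.refl _

theorem eqv_asc {a b : ℕ+} (x y z : Bool) (h : a < b) (w : Word) :
    Eqv (⟨a, x⟩ :: ⟨b, y⟩ :: w) (⟨a, x⟩ :: ⟨b, z⟩ :: w) :=
  (BitMove.asc (x := x) (y := y) (z := z) h).eqv.append_right w

theorem eqv_desc {a b : ℕ+} (x y z : Bool) (h : b ≤ a) (w : Word) :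
    Eqv (⟨a, y⟩ :: ⟨b, x⟩ :: w) (⟨a, z⟩ :: ⟨b, x⟩ :: w) :=
  (BitMove.desc (x := x) (y := y) (z := z) h).eqv.append_right w

/-- The letter `s` is the largest, so it is erased as soon as anything is. The remaining letters
stand in the same order on both sides and differ at most in primes, which the two-letter
equivalences adjust. -/
theorem Move.truncate_eqv {u v : List (ℕ+ × Bool)} (h : Move u v) (N : ℕ+)
    (hN : ¬ ∀ x ∈ u, x.1 ≤ N) : Eqv (truncate N u) (truncate N v) := by
  cases h with
  | @ascLeft p q s t a b x₁ x₂ y₁ y₂ htp hpq hqs =>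
    have hs : ¬ s ≤ N := fun hs => hN (by
      have hq := hqs.trans hs
      have hp := hpq.le.trans hq
      simpa using ⟨htp.le.trans hp, hs, hp, hq⟩)
    by_cases hq : q ≤ N
    · have hp := hpq.le.trans hq
      have ht := htp.le.trans hp
      simp only [truncate, List.filter_cons, hs, hq, hp, ht, decide_true, decide_false, if_true,
        List.map_cons, List.filter_nil, Bool.false_eq_true, if_false]
      exact (eqv_asc _ _ _ htp _).trans ((eqv_asc _ _ _ hpq _).cons _)
    · by_cases hp : p ≤ N
      · have ht := htp.le.trans hp
        simp only [truncate, List.filter_cons, hs, hq, hp, ht, decide_true, decide_false, if_true,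
          List.map_cons, List.filter_nil, Bool.false_eq_true, if_false]
        exact eqv_asc _ _ _ htp _
      · simp only [truncate, List.filter_cons, hs, hq, hp, decide_false, Bool.false_eq_true,
          if_false]
        exact Eqv.refl _
  | @midLeft p q s t a b x₁ x₂ y₁ y₂ hpt hts hpq hqs =>
    have hs : ¬ s ≤ N := fun hs => hN (by
      have hq := hqs.trans hs
      simpa using ⟨hts.le.trans hs, hs, hpq.le.trans hq, hq⟩)
    by_cases hp : p ≤ N
    · have h1 : Eqv (truncate N [(p, a), (q, x₂)]) (truncate N [(p, a), (q, b)]) := by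
        by_cases hq : q ≤ N
        · simp only [truncate, List.filter_cons, hq, hp, decide_true, if_true, List.map_cons,
            List.filter_nil]
          exact eqv_asc _ _ _ hpq _
        · simp only [truncate, List.filter_cons, hq, decide_false, Bool.false_eq_true, if_false]
          exact Eqv.refl _
      by_cases ht : t ≤ N
      · have h2 := h1.cons ⟨t, b⟩
        have h3 := eqv_desc a b y₁ hpt (truncate N [(q, b)])
        simp only [truncate, List.filter_cons, hs, hp, ht, decide_true, decide_false, if_true,
          List.map_cons, List.filter_nil, Bool.false_eq_true, if_false] at h2 h3 ⊢
        exact h2.trans h3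
      · simp only [truncate, List.filter_cons, hs, ht, decide_false, Bool.false_eq_true,
          if_false] at h1 ⊢
        exact h1
    · have ht : ¬ t ≤ N := fun ht => hp (hpt.trans ht)
      have hq : ¬ q ≤ N := fun hq => hp (hpq.le.trans hq)
      simp only [truncate, List.filter_cons, hs, ht, hp, hq, decide_false, Bool.false_eq_true,
          if_false]
      exact Eqv.refl _
  | @ascRight p q s t a b x₁ x₂ y₁ y₂ htq hpq hqs =>
    have hs : ¬ s ≤ N := fun hs => hN (by
      have hq := hqs.le.trans hs
      simpa using ⟨htq.le.trans hq, hq, hpq.trans hq, hs⟩)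
    by_cases hq : q ≤ N
    · have hp := hpq.trans hq
      have ht := htq.le.trans hq
      simp only [truncate, List.filter_cons, hs, hq, hp, ht, decide_true, decide_false, if_true,
        List.map_cons, List.filter_nil, Bool.false_eq_true, if_false]
      exact eqv_asc _ _ _ htq _
    · simp only [truncate, List.filter_cons, hs, hq, decide_false, Bool.false_eq_true, if_false]
      exact Eqv.refl _
  | @descLeft p q s t a b x₁ x₂ y₁ y₂ htq hpq hqs =>
    have hs : ¬ s ≤ N := fun hs => hN (by
      have hq := hqs.trans hs
      simpa using ⟨hs, hpq.le.trans hq, hq, htq.trans hq⟩)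
    by_cases hq : q ≤ N
    · have hp := hpq.le.trans hq
      have ht := htq.trans hq
      simp only [truncate, List.filter_cons, hs, hq, hp, ht, decide_true, decide_false, if_true,
        List.map_cons, List.filter_nil, Bool.false_eq_true, if_false]
      exact eqv_asc _ _ _ hpq _
    · simp only [truncate, List.filter_cons, hs, hq, decide_false, Bool.false_eq_true, if_false]
      exact Eqv.refl _
  | @descRight p q s t a b x₁ x₂ y₁ y₂ htp hpq hqs =>
    have hs : ¬ s ≤ N := fun hs => hN (by
      have hq := hqs.le.trans hs
      simpa using ⟨hq, hpq.trans hq, hs, htp.trans (hpq.trans hq)⟩)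
    by_cases hp : p ≤ N
    · have ht := htp.trans hp
      have h2 := eqv_desc b a y₂ htp []
      by_cases hq : q ≤ N
      · have h1 := eqv_desc a x₁ a hpq [⟨t, b⟩]
        simp only [truncate, List.filter_cons, hs, hq, hp, ht, decide_true, decide_false, if_true,
          List.map_cons, List.filter_nil, Bool.false_eq_true, if_false]
        exact h1.trans (h2.cons _)
      · simp only [truncate, List.filter_cons, hs, hq, hp, ht, decide_true, decide_false, if_true,
          List.map_cons, List.filter_nil, Bool.false_eq_true, if_false]
        exact h2
    · have hq : ¬ q ≤ N := fun hq => hp (hpq.trans hq)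
      simp only [truncate, List.filter_cons, hs, hq, hp, decide_false, Bool.false_eq_true,
        if_false]
      exact Eqv.refl _

theorem Move.length_eq {u v : List (ℕ+ × Bool)} (h : Move u v) :
    u.length = 4 ∧ v.length = 4 := by
  cases h <;> exact ⟨rfl, rfl⟩

theorem Move.forall_le {u v : List (ℕ+ × Bool)} (h : Move u v) {N : ℕ+} :
    (∀ x ∈ u, x.1 ≤ N) ↔ ∀ x ∈ v, x.1 ≤ N := by
  cases h <;> simp <;> tauto

theorem truncate_eq_letters {N : ℕ+} {v : List (ℕ+ × Bool)} (h : ∀ x ∈ v, x.1 ≤ N) :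
    truncate N v = letters v := by
  rw [truncate, List.filter_eq_self.2 (by simpa using h)]; rfl

theorem Move.eqv {u u' : List (ℕ+ × Bool)} (h : Move u u') : Eqv (letters u) (letters u') := by
  -- The relation is symmetrized because `Move.run` may reverse the direction of a move.
  refine eqv_of_rowAct (fun w w' => ∃ u u', (Move u u' ∨ Move u' u) ∧ w = letters u ∧
    w' = letters u') 4 (by simp) ?_ ?_ ⟨u, u', Or.inl h, rfl, rfl⟩
  · rintro _ _ ⟨u, u', h | h, rfl, rfl⟩ <;> simp [letters, h.length_eq]
  · have key : ∀ u u', Move u u' → ∀ r, GoodRow r →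
        (rowAct r (letters u)).1 = (rowAct r (letters u')).1 ∧
        ((∃ v v', (Move v v' ∨ Move v' v) ∧ (rowAct r (letters u)).2 = letters v ∧
          (rowAct r (letters u')).2 = letters v') ∨
        Eqv (rowAct r (letters u)).2 (rowAct r (letters u')).2) := by
      intro u u' h r hr
      obtain ⟨h1, N, v, v', hv, h2, h3⟩ :=
        rowAct_eq_of_run (h.length_eq.1.trans h.length_eq.2.symm) hr
          (fun v v' => Move v v' ∨ Move v' v) fun X X' β β' v hX hv => h.run hX hv
      refine ⟨h1, ?_⟩
      rw [h2, h3]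
      have h4 : (∀ x ∈ v, x.1 ≤ N) ↔ ∀ x ∈ v', x.1 ≤ N :=
        hv.elim (fun h => h.forall_le) fun h => h.forall_le.symm
      by_cases hN : ∀ x ∈ v, x.1 ≤ N
      · exact Or.inl ⟨v, v', hv, truncate_eq_letters hN, truncate_eq_letters (h4.1 hN)⟩
      · refine Or.inr ?_
        rcases hv with hv | hv
        · exact hv.truncate_eqv N hN
        · exact (hv.truncate_eqv N fun h => hN (h4.2 h)).symm
    rintro _ _ ⟨u, u', h | h, rfl, rfl⟩ r hr
    · exact key u u' h r hr
    · obtain ⟨h1, h2⟩ := key u' u h r hr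
      refine ⟨h1.symm, h2.imp ?_ Eqv.symm⟩
      rintro ⟨v, v', h3, h4, h5⟩
      exact ⟨v', v, h3.symm, h5, h4⟩

end Equivalence
end DecompTab

namespace DecompTab
-- A row followed by an inserted letter is equivalent to the bumped letter followed by the new row.
section RowWords

/-- An unprimed word. -/
abbrev plain (l : List ℕ+) : Word := l.map (Letter.mk · false)

theorem eqv_append_inc {t : ℕ+} {I : List ℕ+} {a : ℕ+} (ht : t < a) (hI : ∀ i ∈ I, i < a)
    (τ ξ : Bool) : Eqv (⟨t, τ⟩ :: (plain I ++ [⟨a, ξ⟩])) (⟨t, τ⟩ :: plain (I ++ [a])) := by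
  induction I generalizing t τ with
  | nil => exact eqv_asc _ _ _ ht []
  | cons i I ih => exact (ih (hI i (by simp)) (fun j hj => hI j (by simp [hj])) false).cons _

/-- The letter `a` moves left across entries larger than `b` by `ascRight`, always with `b` or a
later entry directly in front of the exchanged pair. -/
theorem eqv_shift_inc {t b a : ℕ+} {I : List ℕ+} (hI : (t :: b :: I).Pairwise (· < ·))
    (hab : a ≤ b) (τ ξ : Bool) :
    Eqv (⟨t, τ⟩ :: ⟨b, false⟩ :: (plain I ++ [⟨a, ξ⟩]))
      (⟨t, τ⟩ :: ⟨b, false⟩ :: ⟨a, ξ⟩ :: plain I) := by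
  induction I generalizing t b τ with
  | nil => exact Eqv.refl _
  | cons i I ih =>
    have h1 := (List.pairwise_cons.1 hI).1 b (by simp)
    have h2 := (List.pairwise_cons.1 hI.of_cons).1 i (by simp)
    exact ((ih hI.of_cons (hab.trans h2.le) false).cons _).trans
      ((Move.ascRight (a := τ) (b := ξ) (x₁ := false) (x₂ := false) (y₁ := false) (y₂ := false)
        h1 hab h2).eqv.symm.append_right (plain I))

/-- First `a` moves left until it stands behind the letter `b` it bumps; then `ascLeft` carries `b`
to the front, and the relevant prime moves along to the first letter of the new increasing part. -/
theorem eqv_bump_inc {t a b : ℕ+} {I I' : List ℕ+} (h : Bump (· < ·) a I b I')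
    (hI : (t :: I).Pairwise (· < ·)) (τ ξ : Bool) :
    ∃ y K, I' = y :: K ∧ y ≤ a ∧
      Eqv (⟨t, τ⟩ :: (plain I ++ [⟨a, ξ⟩])) (⟨t, τ⟩ :: ⟨b, false⟩ :: ⟨y, ξ⟩ :: plain K) := by
  induction h generalizing t τ with
  | here h => exact ⟨_, _, rfl, le_rfl, eqv_shift_inc hI (not_lt.1 h) τ ξ⟩
  | @there e b l l' h h' ih =>
    obtain ⟨y, K, rfl, hy, hK⟩ := ih hI.of_cons false
    have h1 := (List.pairwise_cons.1 hI).1 e (by simp)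
    have h2 : e < y := by
      rcases h'.mem_of_mem_new (x := y) (by simp) with rfl | h2
      · exact h
      · exact (List.pairwise_cons.1 hI.of_cons).1 y h2
    refine ⟨e, y :: K, rfl, h.le, (hK.cons _).trans ?_⟩
    exact (Move.ascLeft (a := τ) (b := ξ) (x₁ := false) (x₂ := false) (y₁ := false) (y₂ := false)
      h1 h2 (hy.trans h'.le)).eqv.symm.append_right (plain K)

/-- The letter `b` moves left by `descRight` past the entries below it until it stands behind `c`;
then `c` moves to the front by `descLeft`. These moves need a letter behind the exchanged triple; at
the right end this is `t`, and `t ≤ p` is needed only if `b` has to pass `p`. -/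
theorem eqv_bump_dec {D E : List ℕ+} {p b c t : ℕ+} (h : Bump (· ≥ ·) b (D ++ [p]) c E)
    (hD : (D ++ [p]).Pairwise (· ≥ ·)) (htb : t ≤ b) (ht : t ≤ p ∨ ∀ d ∈ D, b ≤ d)
    (ρ τ : Bool) (w : Word) :
    Eqv (plain D ++ ⟨p, ρ⟩ :: ⟨b, false⟩ :: ⟨t, τ⟩ :: w) (⟨c, ρ⟩ :: (plain E ++ ⟨t, τ⟩ :: w)) := by
  induction D generalizing c E with
  | nil =>
    cases h with
    | here h => exact Eqv.refl _
    | there _ h => cases h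
  | cons e D ih =>
    rw [List.cons_append] at hD h
    have hD' := List.pairwise_cons.1 hD
    cases h with
    | here h =>
      have hb : e < b := not_le.1 h
      have htp : t ≤ p := ht.resolve_right fun h' => absurd (h' e (by simp)) (not_le.2 hb)
      obtain ⟨f, F, hF⟩ : ∃ f F, D ++ [p] = f :: F := by
        cases D with
        | nil => exact ⟨_, _, rfl⟩
        | cons f F => exact ⟨_, _, rfl⟩
      have hfe : f ≤ e := hD'.1 f (by rw [hF]; simp)
      have h1 := ih (c := f) (E := b :: F) (by rw [hF]; exact .here (not_le.2 (hfe.trans_lt hb)))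
        hD'.2 (Or.inl htp)
      refine (h1.cons ⟨e, false⟩).trans ?_
      change Eqv _ (⟨e, ρ⟩ :: ⟨b, false⟩ :: (plain (D ++ [p]) ++ _))
      rw [hF]
      have htf : t ≤ f := by
        have hf : f ∈ D ++ [p] := by rw [hF]; simp
        rcases List.mem_append.1 hf with hf | hf
        · exact htp.trans ((List.pairwise_append.1 hD'.2).2.2 f hf p (by simp))
        · rwa [List.mem_singleton.1 hf]
      cases F with
      | nil =>
        exact (Move.descRight (a := ρ) (b := τ) (x₁ := false) (x₂ := false) (y₁ := false)
          (y₂ := false) htf hfe hb).eqv.append_right w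
      | cons g G =>
        have hgf : g ≤ f := by
          have := hD'.2
          rw [hF] at this
          exact (List.pairwise_cons.1 this).1 g (by simp)
        exact (Move.descRight (a := ρ) (b := false) (x₁ := false) (x₂ := false) (y₁ := false)
          (y₂ := false) hgf hfe hb).eqv.append_right (plain G ++ ⟨t, τ⟩ :: w)
    | @there _ _ _ E h h' =>
      have h1 := ih h' hD'.2 (ht.imp_right fun h d hd => h d (by simp [hd]))
      refine (h1.cons ⟨e, false⟩).trans ?_
      have hE := h'.dec_sorted hD'.2
      have hEe : ∀ x ∈ E, x ≤ e := by
        intro x hx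
        rcases h'.mem_of_mem_new hx with rfl | hx
        · exact h
        · exact hD'.1 x hx
      have hcb := h'.lt
      have hbm := h'.mem_new
      cases E with
      | nil => simp at hbm
      | cons f F =>
        have hbf : b ≤ f := by
          rcases List.mem_cons.1 hbm with rfl | h
          · exact le_rfl
          · exact (List.pairwise_cons.1 hE).1 b h
        cases F with
        | nil =>
          exact (Move.descLeft (a := ρ) (b := τ) (x₁ := false) (x₂ := false) (y₁ := false)
            (y₂ := false) (htb.trans hbf) (hcb.trans_le hbf)
            (hEe f (by simp))).eqv.append_right w
        | cons g G =>
          exact (Move.descLeft (a := ρ) (b := false) (x₁ := false) (x₂ := false) (y₁ := false)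
            (y₂ := false) ((List.pairwise_cons.1 hE).1 g (by simp)) (hcb.trans_le hbf)
            (hEe f (by simp))).eqv.append_right (plain G ++ ⟨t, τ⟩ :: w)

/-- The letter `b` leaves the increasing part by `eqv_bump_inc` and enters the decreasing part by
`eqv_bump_dec`. If the middle stays, `b` must still cross it; if it moves, the old middle is simply
the last entry of the list into which `b` bumps. -/
theorem Step.eqv {X X' : HookRow ℕ+} {a c : ℕ+} {f : Bool} (hX : X.Valid)
    (h : Step X a c X' f) (ξ β : Bool) :
    Eqv (X.row β ++ [⟨a, ξ⟩]) (⟨c, bif f then β else ξ⟩ :: X'.row (bif f then ξ else β)) := by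
  cases h with
  | @bulk D I D' I' m _ b _ h1 h2 h3 =>
    obtain ⟨y, K, rfl, hy, hK⟩ := eqv_bump_inc h2 hX.inc β ξ
    have hmy : m < y := by
      rcases h2.mem_of_mem_new (x := y) (by simp) with rfl | h
      · exact h1
      · exact hX.lt_inc h
    obtain ⟨D, d, rfl⟩ : ∃ D₀ d, D = D₀ ++ [d] := by
      rcases List.eq_nil_or_concat' D with rfl | h
      · cases h3
      · exact h
    have hdb : d < b := by
      have := List.pairwise_append.1 hX.dec_sorted
      rcases List.mem_append.1 h3.mem_old with h | h
      · exact (this.2.2 _ h d (by simp)).trans_lt h3.lt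
      · rw [← List.mem_singleton.1 h]; exact h3.lt
    have hmd : m ≤ d := hX.le_dec (d := d) (by simp)
    have e1 := (hK.append_left (plain (D ++ [d])))
    -- This carries `b` across the middle element and exchanges the roles of the primes `β` and `ξ`.
    have e2 := ((Move.midLeft (a := β) (b := ξ) (x₁ := false) (x₂ := false) (y₁ := false)
      (y₂ := false) hmd hdb hmy (hy.trans h2.le)).eqv.symm.append_right (plain K)).append_left
        (plain D)
    have e3 := eqv_bump_dec h3 hX.dec_sorted (hmd.trans hdb.le) (Or.inl hmd) ξ β (plain (y :: K))
    simp only [HookRow.row, plain, letters, List.map_append, List.map_cons, List.map_nil,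
      List.append_assoc, List.cons_append, List.nil_append, cond_false] at e1 e2 e3 ⊢
    exact e1.trans (e2.trans e3)
  | @head D I D' m i _ _ h1 h2 h3 =>
    have e1 := (eqv_shift_inc hX.inc h1 β ξ).append_left (plain D)
    have e3 := eqv_bump_dec h3 hX.dec h1 h2 β ξ (plain I)
    simp only [HookRow.row, plain, List.map_cons, List.append_assoc, List.cons_append,
      cond_true] at e1 e3 ⊢
    exact e1.trans e3
  | @deep D I I' m i _ b h1 h2 h3 =>
    obtain ⟨y, K, hyK, hy, hK⟩ := eqv_bump_inc (Bump.there h1 h2) hX.inc β ξ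
    obtain ⟨rfl, rfl⟩ := List.cons.inj hyK
    have hib := h1.trans_le h2.le
    have hb : Bump (· ≥ ·) b (D ++ [c]) c (D ++ [b]) := Bump.at_end (R := (· ≥ ·)) h3
      (not_le.2 ((hX.lt_inc List.mem_cons_self).trans hib)) []
    have e1 := hK.append_left (plain D)
    have e3 := eqv_bump_dec hb hX.dec hib.le (Or.inr h3) β ξ (plain I')
    simp only [HookRow.row, plain, List.map_append, List.map_cons, List.map_nil,
      List.append_assoc, List.cons_append, List.nil_append, cond_true] at e1 e3 ⊢
    exact e1.trans e3

theorem eqv_insertRow {r : List Letter} (hr : GoodRow r) (x : Letter) :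
    Eqv (r ++ [x]) ((insertRow x r).2.toList ++ (insertRow x r).1) := by
  rcases hr with rfl | ⟨⟨D, m, I⟩, hX, β, rfl⟩
  · rw [insertRow_nil]; exact Eqv.refl _
  · obtain ⟨a, ξ⟩ := x
    rcases hX.insert_cases a with ⟨h1, h2⟩ | ⟨h1, h2⟩ | ⟨c, X', f, h⟩
    · rw [insertRow_append_inc hX h1 h2]
      have := (eqv_append_inc h1 h2 β ξ).append_left (plain D)
      simpa [HookRow.row, plain] using this
    · dsimp only at h1 h2
      subst h1
      rw [insertRow_append_dec hX h2]
      have := (eqv_desc ξ β false h2 []).append_left (plain D)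
      simpa [HookRow.row, plain] using this
    · rw [h.insertRow hX]
      exact h.eqv hX ξ β

theorem row_cons (r : List Letter) (T : Tableau) : row (r :: T) = row T ++ r := by
  simp [row]

theorem eqv_row_insert {T : Tableau} (hT : ∀ r ∈ T, GoodRow r) (x : Letter) :
    Eqv (row (insert x T)) (row T ++ [x]) := by
  induction T generalizing x with
  | nil => exact Eqv.refl _
  | cons r T ih =>
    have hT' : ∀ s ∈ T, GoodRow s := fun s hs => hT s (by simp [hs])
    have h1 := eqv_insertRow (hT r (by simp)) x
    rw [insert_cons, row_cons, row_cons, List.append_assoc]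
    refine Eqv.trans ?_ (h1.symm.append_left (row T))
    rw [← List.append_assoc]
    refine Eqv.append_right ?_ _
    rcases (insertRow x r).2 with _ | y
    · simpa using Eqv.refl _
    · exact ih hT' y

theorem eqv_row_act {T : Tableau} (hT : ∀ r ∈ T, GoodRow r) (u : Word) :
    Eqv (row (act T u)) (row T ++ u) := by
  induction u generalizing T with
  | nil => simpa using Eqv.refl _
  | cons x u ih =>
    have := (ih (goodRow_insert hT x)).trans ((eqv_row_insert hT x).append_right u)
    rwa [List.append_assoc] at this

/-- Every word is equivalent to the row reading word of its insertion tableau. -/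
theorem eqv_row_act_nil (u : Word) : Eqv (row (act [] u)) u := by
  simpa [row] using eqv_row_act (T := []) (by simp) u

end RowWords
end DecompTab

namespace DecompTab
-- The length of the first row is the maximal length of a hook subword.
section Schensted

theorem sublist_concat_cases {α : Type*} {d u : List α} {x : α} (h : d.Sublist (u ++ [x])) :
    d.Sublist u ∨ ∃ d', d = d' ++ [x] ∧ d'.Sublist u := by
  obtain ⟨l₁, l₂, rfl, h1, h2⟩ := List.sublist_append_iff.1 h
  rcases List.sublist_singleton.1 h2 with rfl | rfl
  · exact Or.inl (by simpa using h1)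
  · exact Or.inr ⟨l₁, rfl, h1⟩

theorem countP_lt_of_mem {α : Type*} {p q : α → Bool} {l : List α} {x : α} (hx : x ∈ l)
    (hp : p x = true) (hq : q x = false) (h : ∀ y, q y = true → p y = true) :
    l.countP q + 1 ≤ l.countP p := by
  induction l with
  | nil => simp at hx
  | cons y l ih =>
    have h1 : l.countP q ≤ l.countP p := List.countP_mono_left fun y _ => h y
    rcases List.mem_cons.1 hx with rfl | hx
    · simp [hp, hq]; omega
    · have := ih hx
      have h2 := h y
      simp only [List.countP_cons]
      split_ifs <;> first | omega | simp_all

theorem Bump.countP {α : Type*} {R : α → α → Prop} {a b : α} {l l' : List α}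
    (h : Bump R a l b l') (p : α → Prop) [DecidablePred p] :
    l'.countP (fun x => decide (p x)) + (if p b then 1 else 0) =
      l.countP (fun x => decide (p x)) + (if p a then 1 else 0) := by
  induction h with
  | here h => simp only [List.countP_cons, decide_eq_true_eq]; omega
  | there _ _ ih => simp only [List.countP_cons, decide_eq_true_eq]; omega

variable {α : Type*} [LinearOrder α]

/-- The number of entries that are at least `a`. -/
abbrev countGe (a : α) (l : List α) : ℕ := l.countP fun x => decide (a ≤ x)

/-- The number of entries that are less than `a`. -/
abbrev countLt (a : α) (l : List α) : ℕ := l.countP fun x => decide (x < a)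

theorem countGe_mono {a b : α} (h : a ≤ b) (l : List α) : countGe b l ≤ countGe a l :=
  List.countP_mono_left fun x _ => by simpa using h.trans

theorem Bump.countGe_le {b c : α} {D D' : List α} (h : Bump (· ≥ ·) b D c D') (a : α) :
    countGe a D ≤ countGe a D' := by
  have h1 := h.countP (a ≤ ·)
  have h2 := h.lt
  unfold countGe
  by_cases hc : a ≤ c
  · rw [if_pos hc, if_pos (hc.trans h2.le)] at h1; omega
  · rw [if_neg hc] at h1; omega

theorem Bump.countGe_self {b c : α} {D D' : List α} (h : Bump (· ≥ ·) b D c D') :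
    countGe b D' = countGe b D + 1 := by
  have h1 := h.countP (b ≤ ·)
  rwa [if_neg (not_le.2 h.lt), if_pos le_rfl] at h1

theorem Bump.countGe_of_lt {b c a : α} {D D' : List α} (h : Bump (· ≥ ·) b D c D') (ha : b < a) :
    countGe a D' = countGe a D := by
  have h1 := h.countP (a ≤ ·)
  rwa [if_neg (not_le.2 (h.lt.trans ha)), if_neg (not_le.2 ha)] at h1

theorem Bump.countGe_of_le {b c a : α} {D D' : List α} (h : Bump (· ≥ ·) b D c D')
    (hD : D.Pairwise (· ≥ ·)) (ha : a ≤ b) :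
    countGe a D' = countGe a D ∨ countGe a D' = countGe b D + 1 := by
  have h1 := h.countP (a ≤ ·)
  unfold countGe
  by_cases hc : a ≤ c
  · rw [if_pos hc, if_pos ha] at h1; omega
  · have h2 : countGe a D = countGe b D := by
      refine List.countP_congr fun x hx => ?_
      simp only [decide_eq_true_eq]
      refine ⟨fun h3 => ?_, ha.trans⟩
      by_contra h4
      exact hc (h3.trans (h.dec_le hD hx (not_le.1 h4)))
    rw [if_neg hc, if_pos ha] at h1
    unfold countGe at h2; omega

theorem Bump.countLt_le {x b : α} {I I' : List α} (h : Bump (· < ·) x I b I') (a : α) :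
    countLt a I ≤ countLt a I' := by
  have h1 := h.countP (· < a)
  unfold countLt
  by_cases hc : b < a
  · rw [if_pos hc, if_pos (h.le.trans_lt hc)] at h1; omega
  · rw [if_neg hc] at h1; omega

theorem Bump.lt_countLt {x b a : α} {I I' : List α} (h : Bump (· < ·) x I b I') (ha : x < a) :
    countLt x I + 1 ≤ countLt a I' := by
  have h1 := h.countP (· < x)
  rw [if_neg (not_lt.2 h.le), if_neg (lt_irrefl x)] at h1
  have h3 : countLt x I' + 1 ≤ countLt a I' := countP_lt_of_mem h.mem_new (by simpa using ha)
    (by simp) (by simpa using fun y hy => hy.trans ha)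
  unfold countLt at *; omega

theorem Bump.countLt_cases {x b : α} {I I' : List α} (h : Bump (· < ·) x I b I')
    (hI : I.Pairwise (· < ·)) (a : α) :
    countLt a I' = countLt a I ∨ x < a ∧ countLt a I' = countLt x I + 1 := by
  have h1 := h.countP (· < a)
  unfold countLt
  by_cases hx : x < a
  · by_cases hb : b < a
    · rw [if_pos hx, if_pos hb] at h1; omega
    · have h2 : countLt a I = countLt x I := by
        refine List.countP_congr fun y hy => ?_
        simp only [decide_eq_true_eq]
        refine ⟨fun h3 => ?_, fun h => h.trans hx⟩
        by_contra h4
        exact hb ((h.le_inc hI hy (not_lt.1 h4)).trans_lt h3)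
      rw [if_pos hx, if_neg hb] at h1
      unfold countLt at h2
      exact Or.inr ⟨hx, by omega⟩
  · have hb : ¬ b < a := fun hb => hx (h.le.trans_lt hb)
    rw [if_neg hx, if_neg hb] at h1; omega

theorem Bump.eq_of_mem {x b : α} {I I' : List α} (h : Bump (· < ·) x I b I')
    (hI : I.Pairwise (· < ·)) (hb : b ∈ I') : b = x := by
  induction h with
  | here h =>
    rcases List.mem_cons.1 hb with h1 | h1
    · exact h1
    · exact absurd ((List.pairwise_cons.1 hI).1 _ h1) (lt_irrefl _)
  | there h h' ih =>
    rcases List.mem_cons.1 hb with rfl | h1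
    · exact absurd h (not_lt.2 h'.le)
    · exact ih hI.of_cons h1

/-- Upper bounds for the lengths of certain subwords of `u`, in terms of the pair of a decreasing
and an increasing sequence obtained by inserting the letters of `u`. -/
structure UpperBound (u D I : List α) : Prop where
  -- An entry `i` of `I` stands for decreasing subwords with letters at least `i` that are one
  -- longer than the count in `D`; this is the field `mid` of the lower bound. Hence the second
  -- alternative.
  dec : ∀ (d : List α) (a : α), d.Sublist u → d.Pairwise (· ≥ ·) → (∀ x ∈ d, a ≤ x) →
    d.length ≤ countGe a D ∨ ∃ i ∈ I, a ≤ i ∧ d.length ≤ countGe i D + 1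
  hook : ∀ (d e : List α) (a : α), (d ++ e).Sublist u → d.Pairwise (· ≥ ·) →
    e.Pairwise (· < ·) → e ≠ [] →
    (∀ x ∈ e, x < a) → d.length + e.length ≤ D.length + countLt a I

/-- A subword of `u ++ [x]` avoids `x` or ends in it. The hypotheses list what both bumping and
appending do to the counts; in particular an entry that leaves `I` must be compensated by a larger
count in `D`. A hook whose increasing part is only `[x]` is bounded through `hdec`. -/
theorem UpperBound.concat {u D I D' I' : List α} {x : α} (h : UpperBound u D I)
    (hdec : ∀ d : List α, d.Sublist u → d.Pairwise (· ≥ ·) → d.length ≤ D.length)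
    (hD : D'.length = D.length) (hI : ∀ a, countLt a I ≤ countLt a I')
    (hx : ∀ a, x < a → countLt x I + 1 ≤ countLt a I') (hxI : x ∈ I')
    (h1 : ∀ a, countGe a D ≤ countGe a D')
    (h2 : ∀ i ∈ I, i ∈ I' ∨ countGe i D + 1 ≤ countGe i D')
    (h3 : ∀ i ∈ I, x ≤ i → countGe i D + 1 ≤ countGe x D') :
    UpperBound (u ++ [x]) D' I' := by
  constructor
  · intro d a hd hdd hda
    rcases sublist_concat_cases hd with hd1 | ⟨d, rfl, hd1⟩
    · rcases h.dec d a hd1 hdd hda with h4 | ⟨i, hi, hai, h4⟩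
      · exact Or.inl (h4.trans (h1 a))
      · rcases h2 i hi with h5 | h5
        · exact Or.inr ⟨i, h5, hai, h4.trans (Nat.succ_le_succ (h1 i))⟩
        · exact Or.inl (h4.trans (h5.trans (countGe_mono hai D')))
    · have hd' := pairwise_concat.1 hdd
      refine Or.inr ⟨x, hxI, hda x (by simp), ?_⟩
      rw [List.length_append, List.length_singleton]
      refine Nat.succ_le_succ ?_
      rcases h.dec d x hd1 hd'.1 hd'.2 with h4 | ⟨i, hi, hai, h4⟩
      · exact h4.trans (h1 x)
      · exact h4.trans (h3 i hi hai)
  · intro d e a hde hd he hne hea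
    rcases sublist_concat_cases hde with hde1 | ⟨k, hk, hde1⟩
    · have := h.hook d e a hde1 hd he hne hea
      have := hI a
      omega
    · obtain ⟨e, y, rfl⟩ := (List.eq_nil_or_concat' e).resolve_left hne
      rw [← List.append_assoc] at hk
      obtain ⟨rfl, hy⟩ := List.append_inj' hk rfl
      obtain rfl := List.singleton_inj.1 hy
      rw [List.pairwise_append] at he
      have h4 := hx a (hea y (by simp))
      rw [List.length_append, List.length_singleton]
      by_cases he' : e = []
      · subst he'
        have := hdec d (by simpa using hde1) hd
        simp; omega
      · have := h.hook d e y hde1 hd he.1 he' fun z hz => he.2.2 z hz y (by simp)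
        omega

theorem UpperBound.pop {u D I : List α} {y : α} (h : UpperBound u D (y :: I)) :
    UpperBound u (D ++ [y]) I := by
  have hD : ∀ a, countGe a D ≤ countGe a (D ++ [y]) := fun a => by simp [countGe]
  constructor
  · intro d a hd hdd hda
    rcases h.dec d a hd hdd hda with h4 | ⟨i, hi, hai, h4⟩
    · exact Or.inl (h4.trans (hD a))
    · rcases List.mem_cons.1 hi with rfl | hi
      · refine Or.inl (h4.trans ?_)
        refine le_trans ?_ (countGe_mono hai _)
        simp [countGe]
      · exact Or.inr ⟨i, hi, hai, h4.trans (Nat.succ_le_succ (hD i))⟩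
  · intro d e a hde hd he hne hea
    have := h.hook d e a hde hd he hne hea
    simp only [countLt, List.countP_cons] at this
    simp only [List.length_append, List.length_singleton, countLt]
    split_ifs at this <;> omega

/-- Existence of subwords of `u` of certain lengths, in terms of the pair of a decreasing
and an increasing sequence obtained by inserting the letters of `u`. -/
structure LowerBound (u D I : List α) : Prop where
  dec : ∀ a, ∃ d : List α, d.Sublist u ∧ d.Pairwise (· ≥ ·) ∧ (∀ x ∈ d, a ≤ x) ∧
    countGe a D ≤ d.length
  mid : ∀ i ∈ I, ∃ d : List α, d.Sublist u ∧ d.Pairwise (· ≥ ·) ∧ (∀ x ∈ d, i ≤ x) ∧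
    countGe i D + 1 ≤ d.length
  hook : ∀ a, ∃ d e : List α, (d ++ e).Sublist u ∧ d.Pairwise (· ≥ ·) ∧ e.Pairwise (· < ·) ∧
    (∀ x ∈ e, x < a) ∧ D.length + countLt a I ≤ d.length + e.length

theorem LowerBound.concat {u D I D' I' : List α} {x : α} (h : LowerBound u D I)
    (h1 : ∀ a, ∃ d : List α, d.Sublist u ∧ d.Pairwise (· ≥ ·) ∧ (∀ x ∈ d, a ≤ x) ∧
      countGe a D' ≤ d.length)
    (h2 : ∀ i ∈ I', i ≠ x → ∃ d : List α, d.Sublist (u ++ [x]) ∧ d.Pairwise (· ≥ ·) ∧ (∀ y ∈ d, i ≤ y) ∧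
      countGe i D' + 1 ≤ d.length)
    (hD : D'.length = D.length)
    (hI : ∀ a, countLt a I' = countLt a I ∨ x < a ∧ countLt a I' = countLt x I + 1) :
    LowerBound (u ++ [x]) D' I' := by
  have hu : ∀ {d : List α}, d.Sublist u → d.Sublist (u ++ [x]) := fun hd =>
    hd.trans (List.sublist_append_left u [x])
  refine ⟨fun a => ?_, fun i hi => ?_, fun a => ?_⟩
  · obtain ⟨d, h3, h4⟩ := h1 a
    exact ⟨d, hu h3, h4⟩
  · by_cases hix : i = x
    · subst hix
      obtain ⟨d, h3, h4, h5, h6⟩ := h1 i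
      exact ⟨d ++ [i], h3.append_right _, pairwise_concat.2 ⟨h4, h5⟩, forall_concat_le h5 le_rfl,
        by simpa using h6⟩
    · exact h2 i hi hix
  · rcases hI a with h3 | ⟨hxa, h3⟩
    · obtain ⟨d, e, h4, h5, h6, h7, h8⟩ := h.hook a
      exact ⟨d, e, hu h4, h5, h6, h7, by rw [hD, h3]; exact h8⟩
    · obtain ⟨d, e, h4, h5, h6, h7, h8⟩ := h.hook x
      refine ⟨d, e ++ [x], ?_, h5, ?_, ?_, ?_⟩
      · rw [← List.append_assoc]; exact h4.append_right _
      · rw [List.pairwise_append]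
        exact ⟨h6, by simp, fun y hy z hz => by rw [List.mem_singleton.1 hz]; exact h7 y hy⟩
      · intro y hy
        rcases List.mem_append.1 hy with hy | hy
        · exact (h7 y hy).trans hxa
        · rw [List.mem_singleton.1 hy]; exact hxa
      · rw [hD, h3, List.length_append, List.length_singleton]; omega

/-- As `y` is at most every entry of `D`, the decreasing subword recorded by `y` has at least
`D.length + 1` letters, as required once `y` is counted in the decreasing part. -/
theorem LowerBound.pop {u D I : List α} {y : α} (h : LowerBound u D (y :: I))
    (hy : ∀ d ∈ D, y ≤ d) (hI : (y :: I).Pairwise (· < ·)) : LowerBound u (D ++ [y]) I := by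
  have hI' := (List.pairwise_cons.1 hI).1
  have hDy : countGe y D = D.length := List.countP_eq_length.2 (by simpa using hy)
  refine ⟨fun a => ?_, fun i hi => ?_, fun a => ?_⟩
  · by_cases ha : a ≤ y
    · obtain ⟨d, h1, h2, h3, h4⟩ := h.mid y (by simp)
      refine ⟨d, h1, h2, fun x hx => ha.trans (h3 x hx), ?_⟩
      rw [hDy] at h4
      exact List.countP_le_length.trans (by simpa using h4)
    · obtain ⟨d, h1, h2, h3, h4⟩ := h.dec a
      exact ⟨d, h1, h2, h3, by simpa [countGe, ha] using h4⟩
  · obtain ⟨d, h1, h2, h3, h4⟩ := h.mid i (by simp [hi])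
    exact ⟨d, h1, h2, h3, by simpa [countGe, hI' i hi] using h4⟩
  · by_cases ha : y < a
    · obtain ⟨d, e, h4, h5, h6, h7, h8⟩ := h.hook a
      refine ⟨d, e, h4, h5, h6, h7, ?_⟩
      simp [countLt, ha] at h8 ⊢; omega
    · obtain ⟨d, h1, h2, h3, h4⟩ := h.mid y (by simp)
      refine ⟨d, [], by simpa using h1, h2, by simp, by simp, ?_⟩
      have : countLt a I = 0 := List.countP_eq_zero.2 fun i hi => by
        simpa using (not_lt.1 ha).trans (hI' i hi).le
      rw [this]; simp; omega

/-- The two bounds together. -/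
structure Bounds (u D I : List α) : Prop where
  upper : UpperBound u D I
  lower : LowerBound u D I

theorem Bounds.nil : Bounds ([] : List α) [] [] :=
  ⟨⟨fun d a h _ _ => Or.inl (by simp [List.sublist_nil.1 h]),
    fun d e a h _ _ hne _ => absurd (List.append_eq_nil_iff.1 (List.sublist_nil.1 h)).2 hne⟩,
   ⟨fun a => ⟨[], by simp⟩, by simp, fun a => ⟨[], [], by simp⟩⟩⟩

theorem Bounds.lag {u : List α} {X : HookRow α} {Y : List α × List α} (hX : X.Valid)
    (hl : Lag X Y) (h : Bounds u Y.1 Y.2) : Bounds u (X.dec ++ [X.mid]) X.inc := by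
  cases hl with
  | eq => exact h
  | pop hD => exact ⟨h.upper.pop, h.lower.pop hD hX.inc⟩

/-- The middle element is smaller than every `i` in the increasing part, so it is not counted for
`i`; this leaves room for the extra letter in the second alternative. -/
theorem Bounds.length_dec_le {u : List α} {X : HookRow α} (hX : X.Valid)
    (h : Bounds u (X.dec ++ [X.mid]) X.inc) {d : List α} (hd : d.Sublist u)
    (hdd : d.Pairwise (· ≥ ·)) : d.length ≤ (X.dec ++ [X.mid]).length := by
  rcases List.eq_nil_or_concat' d with rfl | ⟨d, a, rfl⟩
  · simp
  · have hd' := forall_concat_le (pairwise_concat.1 hdd).2 le_rfl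
    rcases h.upper.dec _ a hd hdd hd' with h1 | ⟨i, hi, -, h1⟩
    · exact h1.trans List.countP_le_length
    · have h2 : countGe i [X.mid] = 0 := by simp [countGe, hX.lt_inc hi]
      have h3 : countGe i X.dec ≤ X.dec.length := List.countP_le_length
      rw [countGe, List.countP_append] at h1
      simp only [List.length_append, List.length_singleton] at h1 ⊢
      unfold countGe at h2 h3; omega

theorem Bounds.bump {u D I D' I' : List α} {x b c : α} (h : Bounds u D I)
    (hdec : ∀ d : List α, d.Sublist u → d.Pairwise (· ≥ ·) → d.length ≤ D.length)
    (hD : D.Pairwise (· ≥ ·)) (hI : I.Pairwise (· < ·))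
    (h1 : Bump (· < ·) x I b I') (h2 : Bump (· ≥ ·) b D c D') : Bounds (u ++ [x]) D' I' := by
  constructor
  · refine h.upper.concat hdec h2.length_eq h1.countLt_le (fun a ha => h1.lt_countLt ha) h1.mem_new
      h2.countGe_le (fun i hi => ?_) (fun i hi hxi => ?_)
    · rcases h1.mem_of_mem_old hi with rfl | h
      · exact Or.inr h2.countGe_self.ge
      · exact Or.inl h
    · have h3 := countGe_mono (h1.le_inc hI hi hxi) D
      have h4 := countGe_mono h1.le D'
      have h5 := h2.countGe_self
      omega
  · have key : ∀ a, ∃ d : List α, d.Sublist u ∧ d.Pairwise (· ≥ ·) ∧ (∀ x ∈ d, a ≤ x) ∧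
        countGe a D' ≤ d.length := by
      intro a
      by_cases hab : a ≤ b
      · rcases h2.countGe_of_le hD hab with h3 | h3
        · rw [h3]; exact h.lower.dec a
        · obtain ⟨d, h4, h5, h6, h7⟩ := h.lower.mid b h1.mem_old
          exact ⟨d, h4, h5, fun x hx => hab.trans (h6 x hx), by rw [h3]; exact h7⟩
      · rw [h2.countGe_of_lt (not_le.1 hab)]; exact h.lower.dec a
    refine h.lower.concat key (fun i hi hix => ?_) h2.length_eq (h1.countLt_cases hI)
    have hiI := (h1.mem_of_mem_new hi).resolve_left hix
    have hu : ∀ {d : List α}, d.Sublist u → d.Sublist (u ++ [x]) := fun hd =>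
      hd.trans (List.sublist_append_left u [x])
    by_cases hib : i ≤ b
    · have hlt : i ≤ x := by
        by_contra hlt
        rw [not_le] at hlt
        obtain rfl := le_antisymm hib (h1.le_inc hI hiI hlt.le)
        exact hix (h1.eq_of_mem hI hi)
      rcases h2.countGe_of_le hD hib with h3 | h3
      · rw [h3]
        obtain ⟨d, h4, h5⟩ := h.lower.mid i hiI
        exact ⟨d, hu h4, h5⟩
      · obtain ⟨d, h4, h5, h6, h7⟩ := h.lower.mid b h1.mem_old
        refine ⟨d ++ [x], h4.append_right _, pairwise_concat.2 ⟨h5, fun y hy => ?_⟩,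
          forall_concat_le (fun y hy => hib.trans (h6 y hy)) hlt, ?_⟩
        · exact h1.le.trans (h6 y hy)
        · rw [h3]; simpa using h7
    · rw [h2.countGe_of_lt (not_le.1 hib)]
      obtain ⟨d, h4, h5⟩ := h.lower.mid i hiI
      exact ⟨d, hu h4, h5⟩

theorem Bounds.append {u D I : List α} {x : α} (h : Bounds u D I)
    (hdec : ∀ d : List α, d.Sublist u → d.Pairwise (· ≥ ·) → d.length ≤ D.length)
    (hx : ∀ i ∈ I, i < x) : Bounds (u ++ [x]) D (I ++ [x]) := by
  have hI : countLt x I = I.length := List.countP_eq_length.2 (by simpa using hx)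
  constructor
  · refine h.upper.concat hdec rfl (fun a => by simp [countLt]) (fun a ha => ?_) (by simp)
      (fun a => le_rfl) (fun i hi => Or.inl (by simp [hi])) fun i hi hxi =>
        absurd (hx i hi) (not_lt.2 hxi)
    have : countLt a I = I.length :=
      List.countP_eq_length.2 (by simpa using fun i hi => (hx i hi).trans ha)
    rw [hI, countLt, List.countP_append]
    unfold countLt at this
    simp [this, ha]
  · refine h.lower.concat h.lower.dec (fun i hi hix => ?_) rfl fun a => ?_
    · obtain ⟨d, h1, h2⟩ := h.lower.mid i (by simpa [hix] using hi)
      exact ⟨d, h1.trans (List.sublist_append_left u [x]), h2⟩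
    · by_cases ha : x < a
      · have : countLt a I = I.length :=
          List.countP_eq_length.2 (by simpa using fun i hi => (hx i hi).trans ha)
        right
        refine ⟨ha, ?_⟩
        rw [hI, countLt, List.countP_append]
        unfold countLt at this
        simp [this, ha]
      · left; simp [countLt, ha]

/-- The row `r` satisfies the bounds for the word `u`. -/
def RowBounds (u : List ℕ+) (r : List Letter) : Prop :=
  (r = [] ∧ u = []) ∨ ∃ (X : HookRow ℕ+) (β : Bool), X.Valid ∧ r = X.row β ∧
    Bounds u (X.dec ++ [X.mid]) X.inc

/-- The bounds are proved for the pair before renormalization and then moved across `Lag`; a letter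
added at the end is first appended to the increasing list, even if it becomes the middle element. -/
theorem RowBounds.insertRow {u : List ℕ+} {r : List Letter} (h : RowBounds u r) (x : Letter) :
    RowBounds (u ++ [x.val]) (insertRow x r).1 := by
  obtain ⟨a, ξ⟩ := x
  rcases h with ⟨rfl, rfl⟩ | ⟨X, β, hX, rfl, h⟩
  · rw [insertRow_nil]
    have h1 := (Bounds.nil (α := ℕ+)).append (x := a) (by simp) (by simp)
    exact Or.inr ⟨⟨[], a, []⟩, ξ, valid_singleton a, rfl,
      Bounds.lag (valid_singleton a) (.pop (by simp)) h1⟩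
  · have hdec : ∀ d : List ℕ+, d.Sublist u → d.Pairwise (· ≥ ·) → _ :=
      fun d hd hdd => h.length_dec_le hX hd hdd
    rcases hX.insert_cases a with ⟨h1, h2⟩ | ⟨h1, h2⟩ | ⟨c, X', f, h1⟩
    · rw [insertRow_append_inc hX h1 h2]
      exact Or.inr ⟨_, _, valid_append_inc hX h1 h2, rfl, h.append hdec h2⟩
    · obtain ⟨D, m, I⟩ := X
      dsimp only at h1 h2
      subst h1
      rw [insertRow_append_dec hX h2]
      have hX' := valid_append_dec hX h2
      exact Or.inr ⟨_, _, hX', rfl, Bounds.lag hX' (.pop fun d hd => hX'.le_dec hd)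
        (h.append (x := a) hdec (by simp))⟩
    · rw [h1.insertRow hX]
      obtain ⟨⟨D', I'⟩, ⟨b, h2, h3⟩, h4⟩ := h1.pure hX (.eq' X) (Or.inl rfl)
      exact Or.inr ⟨_, _, h1.valid hX, rfl, Bounds.lag (h1.valid hX) h4
        (h.bump hdec hX.dec hX.inc_sorted h2 h3)⟩

theorem RowBounds.rowAct {u : List ℕ+} {r : List Letter} (h : RowBounds u r) (w : Word) :
    RowBounds (u ++ vals w) (rowAct r w).1 := by
  induction w generalizing u r with
  | nil => simpa [vals, DecompTab.rowAct] using h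
  | cons x w ih => simpa [vals, DecompTab.rowAct] using ih (h.insertRow x)

theorem exists_gt_all (l : List ℕ+) : ∃ a, ∀ x ∈ l, x < a := by
  induction l with
  | nil => exact ⟨1, by simp⟩
  | cons x l ih =>
    obtain ⟨a, ha⟩ := ih
    refine ⟨max a (x + 1), fun y hy => ?_⟩
    rcases List.mem_cons.1 hy with rfl | hy
    · exact (PNat.lt_add_right y 1).trans_le (le_max_right _ _)
    · exact (ha y hy).trans_le (le_max_left _ _)

theorem HookRow.length_row (X : HookRow ℕ+) (β : Bool) :
    (X.row β).length = X.dec.length + X.inc.length + 1 := by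
  simp [HookRow.row]; omega

/-- The first row of the insertion tableau is at least as long as every hook subword. -/
theorem length_le_of_isHook {w : Word} {v : List ℕ+} (hv : v.Sublist (vals w)) (h : IsHook v) :
    v.length ≤ (rowAct [] w).1.length := by
  obtain ⟨⟨d, m, e⟩, hX, rfl⟩ := isHook_iff.1 h
  obtain ⟨a, ha⟩ := exists_gt_all (m :: e)
  rcases RowBounds.rowAct (Or.inl ⟨rfl, rfl⟩ : RowBounds [] []) w with ⟨-, h1⟩ | ⟨Y, β, hY, h1, h2⟩
  · rw [List.nil_append] at h1
    rw [h1] at hv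
    simp [List.sublist_nil.1 hv]
  · have h3 := h2.upper.hook d (m :: e) a hv hX.dec_sorted hX.inc (by simp) ha
    have h4 : countLt a Y.inc ≤ Y.inc.length := List.countP_le_length
    rw [h1, Y.length_row]
    simp only [HookRow.word, List.length_append, List.length_cons, List.length_nil] at h3 ⊢
    omega

/-- The middle element is the last letter of `d` or the first of `e`, whichever fits the comparison
between the two. -/
theorem isHook_append {d e : List ℕ+} (hd : d.Pairwise (· ≥ ·)) (he : e.Pairwise (· < ·))
    (h : d ++ e ≠ []) : IsHook (d ++ e) := by
  rw [isHook_iff]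
  rcases List.eq_nil_or_concat' d with rfl | ⟨d, m, rfl⟩
  · cases e with
    | nil => exact absurd rfl h
    | cons m e => exact ⟨⟨[], m, e⟩, ⟨by simp, he⟩, rfl⟩
  · cases e with
    | nil => exact ⟨⟨d, m, []⟩, ⟨hd, by simp⟩, by simp [HookRow.word]⟩
    | cons i e =>
      by_cases hmi : m < i
      · refine ⟨⟨d, m, i :: e⟩, ⟨hd, List.pairwise_cons.2 ⟨fun x hx => ?_, he⟩⟩,
          by simp [HookRow.word]⟩
        rcases List.mem_cons.1 hx with rfl | hx
        · exact hmi
        · exact hmi.trans ((List.pairwise_cons.1 he).1 x hx)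
      · have hd' := pairwise_concat.1 hd
        have him := not_lt.1 hmi
        exact ⟨⟨d ++ [m], i, e⟩, ⟨pairwise_concat.2 ⟨hd, forall_concat_le
          (fun x hx => him.trans (hd'.2 x hx)) him⟩, he⟩, rfl⟩

/-- The first row of the insertion tableau is not longer than some hook subword. -/
theorem exists_isHook {w : Word} (hw : w ≠ []) :
    ∃ v, v.Sublist (vals w) ∧ IsHook v ∧ (rowAct [] w).1.length ≤ v.length := by
  rcases RowBounds.rowAct (Or.inl ⟨rfl, rfl⟩ : RowBounds [] []) w with ⟨-, h1⟩ | ⟨Y, β, hY, h1, h2⟩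
  · simp [vals] at h1; exact absurd h1 hw
  · obtain ⟨a, ha⟩ := exists_gt_all Y.inc
    obtain ⟨d, e, h3, h4, h5, -, h6⟩ := h2.lower.hook a
    have h7 : countLt a Y.inc = Y.inc.length := List.countP_eq_length.2 (by simpa using ha)
    have h8 : (rowAct [] w).1.length ≤ (d ++ e).length := by
      rw [h1, Y.length_row]
      rw [h7] at h6
      simp only [List.length_append, List.length_cons, List.length_nil] at h6 ⊢
      omega
    refine ⟨d ++ e, h3, isHook_append h4 h5 fun h => ?_, h8⟩
    rw [h, h1, Y.length_row] at h8
    simp at h8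

end Schensted
end DecompTab

namespace DecompTab
-- Reverse insertion into one row.
section Reverse

variable {α : Type*} [LinearOrder α]

/-- Reverse bumping: `b` goes back to the box of the last entry that is at most `b`. -/
theorem exists_bump_inc {b : α} {l : List α} (hl : l.Pairwise (· < ·)) (h : ∃ x ∈ l, x ≤ b) :
    ∃ x l', Bump (· < ·) x l' b l ∧ l'.Pairwise (· < ·) ∧ x ∈ l ∧ ∀ y ∈ l', y = b ∨ y ∈ l := by
  induction l with
  | nil => simp at h
  | cons e l ih =>
    have hl' := List.pairwise_cons.1 hl
    by_cases h1 : ∃ x ∈ l, x ≤ b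
    · obtain ⟨x, l', h2, h3, h4, h5⟩ := ih hl'.2 h1
      refine ⟨x, e :: l', .there (hl'.1 x h4) h2, List.pairwise_cons.2 ⟨fun y hy => ?_, h3⟩,
        by simp [h4], fun y hy => ?_⟩
      · rcases h5 y hy with rfl | h
        · exact (hl'.1 x h4).trans_le h2.le
        · exact hl'.1 y h
      · rcases List.mem_cons.1 hy with rfl | hy
        · simp
        · rcases h5 y hy with h | h <;> simp [h]
    · push Not at h1
      have he : e ≤ b := by
        obtain ⟨x, hx, hxb⟩ := h
        rcases List.mem_cons.1 hx with rfl | hx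
        · exact hxb
        · exact absurd hxb (not_le.2 (h1 x hx))
      exact ⟨e, b :: l, .here (not_lt.2 he), List.pairwise_cons.2 ⟨h1, hl'.2⟩, by simp,
        fun y hy => by rcases List.mem_cons.1 hy with h | h <;> simp [h]⟩

theorem exists_bump_dec {c : α} {l : List α} (hl : l.Pairwise (· ≥ ·)) (h : ∃ x ∈ l, c < x) :
    ∃ b l', Bump (· ≥ ·) b l' c l ∧ l'.Pairwise (· ≥ ·) ∧ b ∈ l ∧ ∀ y ∈ l', y = c ∨ y ∈ l := by
  induction l with
  | nil => simp at h
  | cons e l ih =>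
    have hl' := List.pairwise_cons.1 hl
    by_cases h1 : ∃ x ∈ l, c < x
    · obtain ⟨x, l', h2, h3, h4, h5⟩ := ih hl'.2 h1
      refine ⟨x, e :: l', .there (hl'.1 x h4) h2, List.pairwise_cons.2 ⟨fun y hy => ?_, h3⟩,
        by simp [h4], fun y hy => ?_⟩
      · rcases h5 y hy with rfl | h
        · exact h2.lt.le.trans (hl'.1 x h4)
        · exact hl'.1 y h
      · rcases List.mem_cons.1 hy with rfl | hy
        · simp
        · rcases h5 y hy with h | h <;> simp [h]
    · push Not at h1
      have he : c < e := by
        obtain ⟨x, hx, hxb⟩ := h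
        rcases List.mem_cons.1 hx with rfl | hx
        · exact hxb
        · exact absurd hxb (not_lt.2 (h1 x hx))
      exact ⟨e, c :: l, .here (not_le.2 he), List.pairwise_cons.2 ⟨h1, hl'.2⟩, by simp,
        fun y hy => by rcases List.mem_cons.1 hy with h | h <;> simp [h]⟩

/-- Every letter smaller than the first letter of the decreasing part can be obtained by bumping. -/
theorem Step.exists_reverse {X : HookRow α} (hX : X.Valid) {c : α} (h : ∃ d ∈ X.dec, c < d) :
    ∃ (Z : HookRow α) (x : α) (f : Bool), Z.Valid ∧ Step Z x c X f := by
  obtain ⟨D, m, I⟩ := X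
  dsimp only at h
  -- If `c < m`, then `c` was the middle element and was replaced by the last entry `b` of `D`.
  -- Return `b` to the list `m :: I`: if it dislodges `m` the step was `head`, otherwise `deep`.
  by_cases hcm : c < m
  · obtain ⟨D, b, rfl⟩ := (List.eq_nil_or_concat' D).resolve_left (by rintro rfl; simp at h)
    have hmb : m ≤ b := hX.le_dec (d := b) (by simp)
    have hDb := (pairwise_concat.1 hX.dec_sorted).2
    obtain ⟨x, l', h1, h2, h3, h4⟩ := exists_bump_inc hX.inc ⟨m, by simp, hmb⟩
    have hZ : HookRow.Valid ⟨D, c, l'⟩ := by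
      refine ⟨pairwise_concat.2 ⟨(pairwise_concat.1 hX.dec_sorted).1, fun d hd =>
        hcm.le.trans (hmb.trans (hDb d hd))⟩, List.pairwise_cons.2 ⟨fun y hy => ?_, h2⟩⟩
      rcases h4 y hy with rfl | h
      · exact hcm.trans_le hmb
      · rcases List.mem_cons.1 h with rfl | h
        · exact hcm
        · exact hcm.trans (hX.lt_inc h)
    cases h1 with
    | here h1 =>
      exact ⟨_, _, _, hZ, .head hmb (Or.inr hDb)
        (Bump.at_end (R := (· ≥ ·)) hDb (not_le.2 (hcm.trans_le hmb)) [])⟩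
    | there h1 h1' => exact ⟨_, _, _, hZ, .deep h1 h1' hDb⟩
  · rw [not_lt] at hcm
    obtain ⟨b, E, h1, h2, h3, h4⟩ := exists_bump_dec hX.dec_sorted h
    have hmb : m ≤ b := hX.le_dec h3
    have hEm : ∀ y ∈ E, m ≤ y := fun y hy => by
      rcases h4 y hy with rfl | h
      · exact hcm
      · exact hX.le_dec h
    -- If `b` finds a place in `I`, the step was `bulk`. Otherwise `b` headed the increasing part
    -- and the present middle element `m` is the inserted letter.
    by_cases hI : ∃ x ∈ I, x ≤ b
    · obtain ⟨x, J, h5, h6, h7, h8⟩ := exists_bump_inc hX.inc_sorted hI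
      refine ⟨⟨E, m, J⟩, x, _, ⟨pairwise_concat.2 ⟨h2, hEm⟩, List.pairwise_cons.2
        ⟨fun y hy => ?_, h6⟩⟩, .bulk (hX.lt_inc h7) h5 h1⟩
      rcases h8 y hy with rfl | h
      · exact hcm.trans_lt h1.lt
      · exact hX.lt_inc h
    · push Not at hI
      have hc := h1.mem_old
      obtain ⟨E, e, rfl⟩ := (List.eq_nil_or_concat' E).resolve_left (by rintro rfl; simp at hc)
      have hec : e ≤ c := by
        rcases List.mem_append.1 hc with h | h
        · exact (pairwise_concat.1 h2).2 c h
        · exact (List.mem_singleton.1 h).ge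
      have heb := hec.trans_lt h1.lt
      refine ⟨⟨E, e, b :: I⟩, m, _, ⟨h2, List.pairwise_cons.2 ⟨fun y hy => ?_,
        List.pairwise_cons.2 ⟨hI, hX.inc_sorted⟩⟩⟩, .head hmb (Or.inl (hEm e (by simp))) h1⟩
      rcases List.mem_cons.1 hy with rfl | hy
      · exact heb
      · exact heb.trans (hI y hy)

end Reverse

/-! ### Insertion tableaux are exactly the good tableaux. -/

section Tableaux

/-- Reverse insertion fails only if no entry before the middle exceeds `c`, and then `c` can be put
in front without destroying the hook. -/
theorem exists_reverse_of_not_isHook {X : HookRow ℕ+} (hX : X.Valid) {c : ℕ+}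
    (h : ¬ IsHook (c :: X.word)) :
    ∃ (Z : HookRow ℕ+) (x : ℕ+) (f : Bool), Z.Valid ∧ Step Z x c X f := by
  refine Step.exists_reverse hX ?_
  by_contra h1
  push Not at h1
  apply h
  rcases lt_or_ge c X.mid with h2 | h2
  · by_cases hD : X.dec = []
    · have : c :: X.word = [c] ++ (X.mid :: X.inc) := by simp [HookRow.word, hD]
      rw [this]
      exact isHook_append (by simp) hX.inc (by simp)
    · obtain ⟨d, hd⟩ := List.exists_mem_of_ne_nil _ hD
      exact absurd ((hX.le_dec hd).trans (h1 d hd)) (not_le.2 h2)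
  · have : c :: X.word = (c :: (X.dec ++ [X.mid])) ++ X.inc := by simp [HookRow.word]
    rw [this]
    refine isHook_append (List.pairwise_cons.2 ⟨fun d hd => ?_, hX.dec⟩) hX.inc_sorted (by simp)
    rcases List.mem_append.1 hd with hd | hd
    · exact h1 d hd
    · rw [List.mem_singleton.1 hd]; exact h2

theorem rowAct_concat (r : List Letter) (u : Word) (x : Letter) :
    rowAct r (u ++ [x]) = ((insertRow x (rowAct r u).1).1,
      (rowAct r u).2 ++ (insertRow x (rowAct r u).1).2.toList) := by
  simp [rowAct_append, rowAct]

theorem rowAct_dec {D : List ℕ+} {m : ℕ+} (hD : (D ++ [m]).Pairwise (· ≥ ·)) (β : Bool) :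
    rowAct [] (plain D ++ [⟨m, β⟩]) = (HookRow.row ⟨D, m, []⟩ β, []) := by
  induction D using List.reverseRecOn generalizing m β with
  | nil => simp [rowAct, insertRow_nil, HookRow.row]
  | append_singleton D d ih =>
    have hD' := pairwise_concat.1 hD
    have h := ih hD'.1 false
    have hX : HookRow.Valid ⟨D, d, []⟩ := ⟨hD'.1, by simp⟩
    rw [rowAct_concat, show plain (D ++ [d]) = plain D ++ [⟨d, false⟩] by simp, h]
    simp [insertRow_append_dec hX (hD'.2 d (by simp)) β false]

theorem rowAct_inc {D I J : List ℕ+} {m : ℕ+} (hX : HookRow.Valid ⟨D, m, I ++ J⟩) (β : Bool) :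
    rowAct (HookRow.row ⟨D, m, I⟩ β) (plain J) = (HookRow.row ⟨D, m, I ++ J⟩ β, []) := by
  induction J generalizing I with
  | nil => simp [rowAct]
  | cons a J ih =>
    have hI := List.pairwise_append.1 hX.inc_sorted
    have hX' : HookRow.Valid ⟨D, m, I⟩ :=
      ⟨hX.dec, hX.inc.sublist (List.cons_sublist_cons.2 (List.sublist_append_left I (a :: J)))⟩
    have h := insertRow_append_inc hX' (a := a) (hX.lt_inc (i := a) (by simp))
      (fun i hi => hI.2.2 i hi a (by simp)) false β
    have h2 := ih (I := I ++ [a]) (by simpa using hX)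
    simp only [List.append_assoc, List.singleton_append] at h2
    simp only [plain, List.map_cons, rowAct, h, h2, Option.toList_none, List.append_nil]

theorem HookRow.Valid.rowAct_row {X : HookRow ℕ+} (hX : X.Valid) (β : Bool) :
    rowAct [] (X.row β) = (X.row β, []) := by
  have h : X.row β = (plain X.dec ++ [⟨X.mid, β⟩]) ++ plain X.inc := by simp [HookRow.row]
  conv_lhs => rw [h]
  rw [rowAct_append, rowAct_dec hX.dec β, rowAct_inc (I := []) hX β]
  rfl

/-- Let both words act on `r :: T`: the first row and the remaining rows are compared separately. -/
theorem Eqv.rowAct {u v : Word} (h : Eqv u v) {r : List Letter} (hr : GoodRow r) :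
    (rowAct r u).1 = (rowAct r v).1 ∧ Eqv (rowAct r u).2 (rowAct r v).2 := by
  have key : ∀ T : Tableau, (∀ r ∈ T, GoodRow r) →
      (DecompTab.rowAct r u).1 = (DecompTab.rowAct r v).1 ∧
      act T (DecompTab.rowAct r u).2 = act T (DecompTab.rowAct r v).2 := fun T hT => by
    have := h (r :: T) (by simpa using ⟨hr, hT⟩)
    rw [act_cons_row, act_cons_row] at this
    exact List.cons.inj this
  exact ⟨(key [] (by simp)).1, fun T hT => (key T hT).2⟩

theorem Step.length_word {X X' : HookRow ℕ+} {a c : ℕ+} {f : Bool} (h : Step X a c X' f) :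
    X'.word.length = X.word.length := by
  cases h with
  | bulk h1 h2 h3 => simp [HookRow.word, h2.length_eq, h3.length_eq]
  | head h1 h2 h3 => simp [HookRow.word, h3.length_eq]; omega
  | deep h1 h2 h3 => simp [HookRow.word, h2.length_eq]

theorem vals_append (u v : Word) : vals (u ++ v) = vals u ++ vals v := List.map_append

/-- If no hook subword of `u` followed by a row is longer than this row, then the row is the first
row of the insertion tableau. -/
theorem rowAct_append_row (u : Word) {X : HookRow ℕ+} (hX : X.Valid) (β : Bool)
    (h : ∀ v : List ℕ+, v.Sublist (vals u ++ X.word) → IsHook v → v.length ≤ X.word.length) :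
    (rowAct [] (u ++ X.row β)).1 = X.row β ∧ Eqv (rowAct [] (u ++ X.row β)).2 u := by
  induction u using List.reverseRecOn generalizing X β with
  | nil => rw [List.nil_append, hX.rowAct_row β]; exact ⟨rfl, Eqv.refl _⟩
  | append_singleton u y ih =>
    obtain ⟨c, κ⟩ := y
    -- Otherwise this would be a hook subword longer than the row, so the maximality of the row is
    -- what permits reverse insertion of the last letter of `u`.
    have h1 : ¬ IsHook (c :: X.word) := fun h1 => by
      have := h _ (by simp [vals]) h1
      simp at this
    obtain ⟨Z, x, f, hZ, hs⟩ := exists_reverse_of_not_isHook hX h1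
    -- A step either keeps or exchanges the two primes according to its flag, so it can be inverted
    -- on primes.
    obtain ⟨ξ, γ, hξ, hγ⟩ : ∃ ξ γ : Bool, (bif f then ξ else γ) = β ∧
        (bif f then γ else ξ) = κ := by
      cases f
      · exact ⟨κ, β, rfl, rfl⟩
      · exact ⟨β, κ, rfl, rfl⟩
    have h2 := hs.insertRow hZ ξ γ
    have h3 := hs.eqv hZ ξ γ
    rw [hξ, hγ] at h2 h3
    have h4 : Eqv (u ++ Z.row γ ++ [⟨x, ξ⟩]) (u ++ [⟨c, κ⟩] ++ X.row β) := by
      simpa using h3.append_left u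
    -- Equivalent words have equally long first rows, hence equal maximal lengths of hook subwords.
    -- So the shorter word `u` with the row `Z` inherits the hypothesis.
    have h5 : ∀ v : List ℕ+, v.Sublist (vals u ++ Z.word) → IsHook v →
        v.length ≤ Z.word.length := by
      intro v hv hv'
      have h6 := length_le_of_isHook (w := u ++ Z.row γ ++ [⟨x, ξ⟩]) (hv.trans (by
        simp only [vals_append, HookRow.vals_row]
        exact List.sublist_append_left _ _)) hv'
      rw [(h4.rowAct goodRow_nil).1] at h6
      obtain ⟨v', h7, h8, h9⟩ := exists_isHook (w := u ++ [⟨c, κ⟩] ++ X.row β) (by simp)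
      rw [vals_append, HookRow.vals_row] at h7
      have := h v' h7 h8
      rw [hs.length_word] at this
      omega
    obtain ⟨h6, h7⟩ := ih hZ γ h5
    have h8 := h4.symm.rowAct goodRow_nil
    rw [rowAct_concat, h6, h2] at h8
    exact ⟨h8.1, h8.2.trans (h7.append_right [⟨c, κ⟩])⟩

/-- A tableau whose rows are hook words with at most the middle element primed, such that each row
is a longest hook subword of the next row followed by it. -/
structure GoodTableau (T : Tableau) : Prop where
  row : ∀ r ∈ T, ∃ (X : HookRow ℕ+) (β : Bool), X.Valid ∧ r = X.row β
  chain : T.IsChain fun r s =>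
    ∀ v : List ℕ+, v.Sublist (vals s ++ vals r) → IsHook v → v.length ≤ r.length

theorem HookRow.length_row_eq (X : HookRow ℕ+) (β : Bool) :
    (X.row β).length = X.word.length := by
  simp [HookRow.row, HookRow.word]

theorem GoodTableau.tail {r : List Letter} {T : Tableau} (h : GoodTableau (r :: T)) :
    GoodTableau T :=
  ⟨fun s hs => h.row s (by simp [hs]), h.chain.tail⟩

/-- By induction, reading the rows above `r` leaves the row `s` and bumps a word equivalent to the
rest. Inserting `r` into `s` is then the case of two rows, and it bumps a word equivalent to `s`. -/
theorem GoodTableau.rowAct_row {r : List Letter} {T : Tableau} (h : GoodTableau (r :: T)) :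
    (rowAct [] (DecompTab.row (r :: T))).1 = r ∧
      Eqv (rowAct [] (DecompTab.row (r :: T))).2 (DecompTab.row T) := by
  induction T generalizing r with
  | nil =>
    obtain ⟨X, β, hX, rfl⟩ := h.row r (by simp)
    rw [show DecompTab.row [X.row β] = X.row β by simp [DecompTab.row], hX.rowAct_row β]
    exact ⟨rfl, Eqv.refl _⟩
  | cons s T ih =>
    obtain ⟨X, β, hX, rfl⟩ := h.row r (by simp)
    obtain ⟨Y, γ, hY, rfl⟩ := h.row s (by simp)
    obtain ⟨h1, h2⟩ := ih h.tail
    have h3 := (List.isChain_cons_cons.1 h.chain).1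
    have h4 := rowAct_append_row (Y.row γ) hX β (by simpa [HookRow.length_row_eq] using h3)
    rw [rowAct_append, hY.rowAct_row γ, List.nil_append] at h4
    have h5 := h2.append h4.2
    rw [← row_cons] at h5
    rw [row_cons, rowAct_append, h1]
    exact ⟨h4.1, h5⟩

theorem act_nil_of_ne_nil {u : Word} (hu : u ≠ []) :
    act [] u = (rowAct [] u).1 :: act [] (rowAct [] u).2 := by
  cases u with
  | nil => exact absurd rfl hu
  | cons x u => rw [act_nil_cons, act_cons_row]

/-- A tableau is the insertion tableau of its row reading word. -/
theorem GoodTableau.act_row {T : Tableau} (h : GoodTableau T) : act [] (DecompTab.row T) = T := by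
  induction T with
  | nil => rfl
  | cons r T ih =>
    have hne : DecompTab.row (r :: T) ≠ [] := by
      obtain ⟨X, β, hX, rfl⟩ := h.row r (by simp)
      rw [row_cons]
      simp [HookRow.row]
    obtain ⟨h1, h2⟩ := h.rowAct_row
    rw [act_nil_of_ne_nil hne, h1, h2 [] (by simp), ih h.tail]

theorem exists_row_of_ne_nil {u : Word} (hu : u ≠ []) :
    ∃ (X : HookRow ℕ+) (β : Bool), X.Valid ∧ (rowAct [] u).1 = X.row β := by
  rcases RowBounds.rowAct (Or.inl ⟨rfl, rfl⟩ : RowBounds [] []) u with ⟨-, h1⟩ | ⟨X, β, hX, h1, -⟩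
  · simp [vals] at h1; exact absurd h1 hu
  · exact ⟨X, β, hX, h1⟩

/-- The rows above the first form the insertion tableau of the shorter bumped word, so induction
applies to them. For the first two rows, a hook subword of `s` followed by `r` is a subword of the
reading word, which is equivalent to `u` and therefore has the same first row `r`. -/
theorem goodTableau_act (u : Word) : GoodTableau (act [] u) := by
  induction h : u.length using Nat.strong_induction_on generalizing u with
  | _ n ih =>
    subst h
    by_cases hu : u = []
    · subst hu; exact ⟨by simp [act], by simp [act]⟩
    · have h1 := ih _ (length_rowAct_nil_lt hu) (rowAct [] u).2 rfl
      have h2 := eqv_row_act_nil u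
      rw [act_nil_of_ne_nil hu] at h2 ⊢
      obtain ⟨X, β, hX, hr⟩ := exists_row_of_ne_nil hu
      refine ⟨fun s hs => ?_, ?_⟩
      · rcases List.mem_cons.1 hs with rfl | hs
        · exact ⟨X, β, hX, hr⟩
        · exact h1.row s hs
      · have h3 := h1.chain
        generalize act [] (rowAct [] u).2 = T at h2 h3 ⊢
        cases T with
        | nil => simp
        | cons s T =>
          refine List.isChain_cons_cons.2 ⟨fun v hv hv' => ?_, h3⟩
          have h4 := (h2.rowAct goodRow_nil).1
          rw [row_cons, row_cons] at h4
          rw [← h4]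
          refine length_le_of_isHook (hv.trans ?_) hv'
          simp only [vals_append, List.append_assoc]
          exact List.sublist_append_right _ _

end Tableaux
end DecompTab

namespace DecompTab
-- Primed decomposition tableaux as good tableaux, and the two monoids.
section Monoids

/-- Maximality of the row `X` forces every letter of the next row `Y` below the first letter `d` of
`X`, as a letter at least `d` could be put in front of `X`. Then `Y` followed by `d` is a hook
subword, so `X` is longer than `Y`. -/
theorem GoodTableau.isStrictPartition {T : Tableau} (h : GoodTableau T) :
    IsStrictPartition (shape T) := by
  refine ⟨List.isChain_iff_pairwise.1 ((List.isChain_map _).2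
    (h.chain.imp_of_mem_imp fun r s hr hs hrs => ?_)), fun k hk => ?_⟩
  · obtain ⟨X, β, hX, rfl⟩ := h.row r hr
    obtain ⟨Y, γ, hY, rfl⟩ := h.row s hs
    simp only [HookRow.vals_row, HookRow.length_row_eq] at hrs ⊢
    obtain ⟨d, K, hK, hXK⟩ : ∃ d K, X.word = d :: K ∧ (∀ y, d ≤ y → IsHook (y :: X.word)) := by
      rcases X with ⟨_ | ⟨d, D⟩, m, I⟩
      · refine ⟨m, I, rfl, fun y hy => ?_⟩
        have := isHook_append (d := [y, m]) (e := I) (by simpa using hy) hX.inc_sorted (by simp)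
        exact this
      · refine ⟨d, D ++ m :: I, rfl, fun y hy => ?_⟩
        have := isHook_append (d := y :: d :: (D ++ [m])) (e := I)
          (List.pairwise_cons.2 ⟨fun x hx => ?_, hX.dec⟩) hX.inc_sorted (by simp)
        · simpa [HookRow.word] using this
        · rcases List.mem_cons.1 hx with rfl | hx
          · exact hy
          · exact ((List.pairwise_cons.1 hX.dec).1 x hx).trans hy
    have h1 : ∀ y ∈ Y.word, y < d := by
      intro y hy
      by_contra hyd
      have := hrs (y :: X.word) ((List.singleton_sublist.2 hy).append_right X.word)
        (hXK y (not_lt.1 hyd))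
      simp at this
    have h2 := hrs (Y.word ++ [d]) ((List.singleton_sublist.2 (by simp [hK])).append_left Y.word) (by
      have := (valid_append_inc hY (h1 _ (by simp [HookRow.word]))
        fun i hi => h1 i (by simp [HookRow.word, hi])).isHook
      simpa [HookRow.word] using this)
    rw [List.length_append, List.length_singleton] at h2
    exact h2
  · obtain ⟨r, hr, rfl⟩ := List.mem_map.1 hk
    obtain ⟨X, β, hX, rfl⟩ := h.row r hr
    simp [HookRow.row]

theorem vals_unprime_row (r : List Letter) :
    vals (r.map fun x => (⟨x.val, false⟩ : Letter)) = vals r := by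
  simp [vals]

theorem isChain_unprime {T : Tableau} :
    ((unprime T).IsChain fun r s => ∀ v : List ℕ+, v.Sublist (vals s ++ vals r) → IsHook v →
      v.length ≤ r.length) ↔ T.IsChain fun r s => ∀ v : List ℕ+, v.Sublist (vals s ++ vals r) →
        IsHook v → v.length ≤ r.length := by
  rw [unprime, List.isChain_map]
  simp only [vals_unprime_row, List.length_map]

theorem HookRow.Valid.primed_row {X : HookRow ℕ+} (hX : X.Valid) (β : Bool) {j : ℕ}
    (hj : j < (X.row β).length) :
    (X.row β)[j].primed = (β && decide (j = X.dec.length)) := by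
  have h := hX.primeMiddle_word β
  have h1 : (X.row β)[j] = (primeMiddle β X.word)[j]'(by rw [h]; exact hj) := by
    simp only [h]
  rw [h1]
  simp [primeMiddle, hX.decPart_word]

theorem GoodTableau.isPrimedDecTab {T : Tableau} (h : GoodTableau T) : IsPrimedDecTab T := by
  refine ⟨⟨?_, ?_, ?_, isChain_unprime.2 h.chain⟩, ?_⟩
  · intro r hr x hx
    obtain ⟨s, -, rfl⟩ := List.mem_map.1 hr
    obtain ⟨y, -, rfl⟩ := List.mem_map.1 hx
    rfl
  · have : shape (unprime T) = shape T := by simp [shape, unprime]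
    rw [this]; exact h.isStrictPartition
  · intro r hr
    obtain ⟨s, hs, rfl⟩ := List.mem_map.1 hr
    obtain ⟨X, β, hX, rfl⟩ := h.row s hs
    rw [vals_unprime_row, HookRow.vals_row]
    exact hX.isHook
  · intro r hr j hj hp
    obtain ⟨X, β, hX, rfl⟩ := h.row r hr
    rw [hX.primed_row β hj] at hp
    simp at hp
    simp [hX.decPart_word, hp.2]

theorem IsPrimedDecTab.goodTableau {T : Tableau} (h : IsPrimedDecTab T) : GoodTableau T := by
  refine ⟨fun r hr => ?_, isChain_unprime.1 h.isDecTab_unprime.maximal⟩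
  have h1 := h.isDecTab_unprime.hook _ (List.mem_map_of_mem hr)
  rw [vals_unprime_row] at h1
  obtain ⟨X, hX, hr'⟩ := isHook_iff.1 h1
  have hlen : r.length = X.word.length := by rw [← hr']; simp [vals]
  have hd : X.dec.length < r.length := by rw [hlen]; simp [HookRow.word]
  refine ⟨X, r[X.dec.length].primed, hX, List.ext_getElem (by simp [hlen, HookRow.length_row_eq])
    fun j hj hj' => Letter.ext ?_ ?_⟩
  · have h2 : vals r = vals (X.row r[X.dec.length].primed) := by rw [hr', HookRow.vals_row]
    have h3 := congrArg (fun l => l[j]?) h2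
    simpa [vals, hj, hj'] using h3
  · rw [hX.primed_row _ hj']
    by_cases hjd : j = X.dec.length
    · subst hjd; simp
    · have h4 := h.middle r hr j hj
      rw [hr', hX.decPart_word] at h4
      simp only [hjd, decide_false, Bool.and_false]
      by_contra h5
      have := h4 (by simpa using h5)
      simp at this
      exact hjd this

theorem Pdec_eq_act (w : Word) : Pdec w = act [] w.reverse := by
  rw [Pdec, act, List.foldl_reverse]

theorem Pdec_revrow_append (T U : Tableau) :
    Pdec (revrow T ++ revrow U) = act [] (row U ++ row T) := by
  rw [Pdec_eq_act, revrow, revrow, ← List.reverse_append, List.reverse_reverse]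

/-- Inside a longer word, the reading word of an insertion tableau may be replaced by the word
inserted; both sides become the insertion tableau of the three reading words together. -/
theorem act_row_mul_assoc (T U V : Tableau) :
    act [] (row V ++ row (act [] (row U ++ row T))) =
      act [] (row (act [] (row V ++ row U)) ++ row T) := by
  have h1 := (eqv_row_act_nil (row U ++ row T)).append_left (row V)
  have h2 := (eqv_row_act_nil (row V ++ row U)).append_right (row T)
  rw [h1 [] (by simp), h2 [] (by simp), List.append_assoc]

/-- No letter of the tableau is primed. -/
def Unprimed (T : Tableau) : Prop := ∀ r ∈ T, ∀ x ∈ r, x.primed = false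

theorem Unprimed.row {T : Tableau} (h : Unprimed T) : ∀ x ∈ row T, x.primed = false := by
  intro x hx
  obtain ⟨r, hr, hx⟩ := List.mem_flatten.1 hx
  exact h r (List.mem_reverse.1 hr) x hx

theorem primeMiddle_false (w : List ℕ+) : ∀ x ∈ primeMiddle false w, x.primed = false := by
  intro x hx
  obtain ⟨j, hj, rfl⟩ := List.mem_mapIdx.1 hx
  simp

theorem insertRow_unprimed {x : Letter} {r : List Letter} (hx : x.primed = false)
    (hr : ∀ y ∈ r, y.primed = false) :
    (∀ y ∈ (insertRow x r).1, y.primed = false) ∧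
      ∀ y ∈ (insertRow x r).2.toList, y.primed = false := by
  have hm : middlePrimed r = false := by
    rw [middlePrimed]
    split
    · rfl
    · rename_i y hy
      exact hr y (List.mem_of_getElem? hy)
  rw [insertRow]
  simp only [hx, hm, ite_self]
  refine ⟨primeMiddle_false _, fun y hy => ?_⟩
  simp only [Option.mem_toList, Option.map_eq_some_iff] at hy
  obtain ⟨c, -, rfl⟩ := hy
  rfl

theorem Unprimed.insert {T : Tableau} (hT : Unprimed T) {x : Letter} (hx : x.primed = false) :
    Unprimed (insert x T) := by
  induction T generalizing x with
  | nil =>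
    intro r hr y hy
    rw [DecompTab.insert, List.mem_singleton] at hr
    rw [hr, List.mem_singleton] at hy
    exact hy ▸ hx
  | cons s T ih =>
    obtain ⟨h1, h2⟩ := insertRow_unprimed hx (hT s (by simp))
    have hT' : Unprimed T := fun r hr => hT r (by simp [hr])
    rw [insert_cons]
    intro r hr
    rcases List.mem_cons.1 hr with rfl | hr
    · exact h1
    · rcases h : (insertRow x s).2 with _ | y
      · rw [h] at hr; exact hT' r hr
      · rw [h] at hr h2
        exact ih hT' (h2 y (by simp)) r hr

theorem Unprimed.act {T : Tableau} (hT : Unprimed T) {u : Word} (hu : ∀ x ∈ u, x.primed = false) :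
    Unprimed (act T u) := by
  induction u generalizing T with
  | nil => exact hT
  | cons x u ih => exact ih (hT.insert (hu x (by simp))) fun y hy => hu y (by simp [hy])

theorem unprime_eq_self {T : Tableau} (h : Unprimed T) : unprime T = T := by
  rw [unprime]
  conv_rhs => rw [← List.map_id T]
  refine List.map_congr_left fun r hr => ?_
  conv_rhs => rw [id, ← List.map_id r]
  exact List.map_congr_left fun x hx => Letter.ext rfl (h r hr x hx).symm

theorem isDecTab_iff {T : Tableau} : IsDecTab T ↔ GoodTableau T ∧ Unprimed T := by
  constructor
  · intro h
    refine ⟨IsPrimedDecTab.goodTableau ⟨by rwa [unprime_eq_self h.unprimed], ?_⟩, h.unprimed⟩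
    intro r hr j hj hp
    rw [h.unprimed r hr _ (List.getElem_mem hj)] at hp
    exact absurd hp (by simp)
  · rintro ⟨h, h'⟩
    have := h.isPrimedDecTab.isDecTab_unprime
    rwa [unprime_eq_self h'] at this

/-- A set of tableaux that contains the empty tableau, consists of insertion tableaux and is closed
under the product is a monoid. -/
theorem exists_monoid (P : Tableau → Prop) (h1 : P [])
    (hmul : ∀ T U, P T → P U → P (act [] (row U ++ row T)))
    (hrow : ∀ T, P T → act [] (row T) = T) :
    ∃ M : Monoid {T : Tableau // P T},
      (∀ T U : {T : Tableau // P T},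
        (M.mul T U).val = Pdec (revrow T.val ++ revrow U.val)) ∧ M.one.val = [] :=
  ⟨{ mul := fun T U => ⟨_, hmul T.val U.val T.2 U.2⟩
     mul_assoc := fun T U V => Subtype.ext (act_row_mul_assoc T.val U.val V.val)
     one := ⟨[], h1⟩
     one_mul := fun T => Subtype.ext ((congrArg (act []) (List.append_nil _)).trans (hrow T.val T.2))
     mul_one := fun T => Subtype.ext (hrow T.val T.2) },
    fun T U => (Pdec_revrow_append T.val U.val).symm, rfl⟩

theorem goodTableau_nil : GoodTableau [] := ⟨by simp, by simp⟩

theorem exists_monoid_decTab : ∃ M : Monoid DecTab,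
    (∀ T U : DecTab, (M.mul T U).val = Pdec (revrow T.val ++ revrow U.val)) ∧ M.one.val = [] :=
  exists_monoid IsDecTab (isDecTab_iff.2 ⟨goodTableau_nil, by simp [Unprimed]⟩)
    (fun T U hT hU => isDecTab_iff.2 ⟨goodTableau_act _, Unprimed.act (by simp [Unprimed])
      fun x hx => (List.mem_append.1 hx).elim ((isDecTab_iff.1 hU).2.row x)
        ((isDecTab_iff.1 hT).2.row x)⟩)
    fun _ hT => (isDecTab_iff.1 hT).1.act_row

theorem exists_monoid_decTabPlus : ∃ M : Monoid DecTabPlus,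
    (∀ T U : DecTabPlus, (M.mul T U).val = Pdec (revrow T.val ++ revrow U.val)) ∧
      M.one.val = [] :=
  exists_monoid IsPrimedDecTab goodTableau_nil.isPrimedDecTab
    (fun _ _ _ _ => (goodTableau_act _).isPrimedDecTab) fun _ hT => hT.goodTableau.act_row

end Monoids
end DecompTab

theorem mainTheorem11 :
    (∃ M : Monoid DecompTab.DecTab,
      (∀ T U : DecompTab.DecTab,
        (M.mul T U).val =
          DecompTab.Pdec (DecompTab.revrow T.val ++ DecompTab.revrow U.val)) ∧
      M.one.val = []) ∧
    (∃ M : Monoid DecompTab.DecTabPlus,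
      (∀ T U : DecompTab.DecTabPlus,
        (M.mul T U).val =
          DecompTab.Pdec (DecompTab.revrow T.val ++ DecompTab.revrow U.val)) ∧
      M.one.val = []) := by
  exact ⟨DecompTab.exists_monoid_decTab, DecompTab.exists_monoid_decTabPlus⟩
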